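/- **Conventions.** Let $X$ be a countably infinite alphabet, $X^*$ the free monoid of words over $X$; $x,y,z,t,s$ are distinct letters of $X$. An identity $u\approx v$ is a pair of words; it holds in a monoid $M$ if every substitution $X\to M$ gives $u$ and $v$ the same value. A variety of monoids is the class $\mathrm{var}\,\Sigma$ of all monoids satisfying some set $\Sigma$ of identities. Varieties are ordered by inclusion; $\vee$ is the join of varieties, and the subvarieties of a variety form a lattice. $\mathrm{FIC}(\mathbf V)$ is the congruence on $X^*$ consisting of all $(u,v)$ such that $u\approx v$ holds in $\mathbf V$. For a congruence $\alpha$ on $X^*$ and a word $w$, let $[w]^\alpha$ be the $\alpha$-class of $w$, let $M_\alpha([w]^\alpha)$ be the Rees quotient of $X^*/\alpha$ over the ideal of all elements that do not divide $[w]^\alpha$ (where $b$ divides $a$ if $a=pbq$ for some $p,q\in X^*/\alpha$), and let $\mathbf M_\alpha([w]^\alpha)$ be the variety generated by this monoid. If $\alpha$ is the equality relation, write $\mathbf M(w)$. A class is also written by a regular expression, with $x^+=\{x^n: n\ge 1\}$; e.g. $xx^+y=[x^2y]^\gamma$, $xyx^+=[xyx]^\lambda$. A letter is simple (multiple) in a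 word if it occurs there exactly once (at least twice). The congruences used are: * $u\mathrel\gamma v$ iff $u$ and $v$ have the same simple letters and $u$ is obtained from $v$ by changing the (positive) exponents of individual letters; * $u\mathrel\lambda v$ iff $u\mathrel\gamma v$ and, for each multiple letter, its first two occurrences are adjacent in $u$ iff they are adjacent in $v$; * $\overline\lambda$, the dual of $\lambda$: $u\mathrel{\overline\lambda}v$ iff the words $u,v$ read from right to left are $\lambda$-related; * $\gamma'=\gamma\wedge\mathrm{FIC}(\mathbf M(xyx))$ and $\lambda'=\lambda\wedge\mathrm{FIC}(\mathbf M(xyx))$; * $\nu=\mathrm{FIC}(\mathrm{var}\{xy\approx xyx\}\vee\mathbf M(xyx))$; * $\eta=\mathrm{FIC}(\mathrm{var}\{xyxz\approx xyxzx,\ ytx^2y\approx ytyx^2\}\vee\mathbf M(xyx))$; * $\mu=\mathrm{FIC}(\mathrm{var}\{x^2\approx x^3,\ xyxzx\approx xyxzx^2\})$. Finally, let $$\mathbf H=\mathrm{var}\{x^2\approx x^3,\ x^2y^2\approx y^2x^2,\ xyx\approx xyx^2,\ x^2y\approx x^2yx,\ xyxty\approx yx^2ty\},$$ $$\mathbf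 N=\mathrm{var}\{x^2\approx x^3,\ x^2y\approx yx^2,\ xyxzx\approx x^2yz,\ xzytxy\approx xzytyx,\ xzxyty\approx xzyxty\}.$$ **Proposition.** Each of the following varieties of monoids has a non-modular lattice of subvarieties: - (i) $\mathbf M_\gamma(xx^+y)\vee\mathbf H$; - (ii) $\mathbf M_\gamma(xx^+y)\vee\mathbf M_\nu([yx^2ty]^\nu)$; - (iii) $\mathbf M_\gamma(xx^+y)\vee\mathbf M_\eta([xyzx^2ty]^\eta)$; - (iv) $\mathbf M_\lambda(xyx^+)\vee\mathbf M_{\overline\lambda}(x^+yx)$; - (v) $\mathbf M_\lambda(xyx^+)\vee\mathbf M_\nu([yx^2ty]^\nu)$; - (vi) $\mathbf M_\lambda(xyx^+)\vee\mathbf M_{\gamma'}(yxx^+ty)$; - (vii) $\mathbf M_\lambda(xyx^+)\vee\mathbf M_{\gamma'}(ytyxx^+)$; - (viii) $\mathbf M_\lambda(xyx^+)\vee\mathbf M_{\gamma'}([x^2yzytx^2]^{\gamma'})$; - (ix) $\mathbf M_\lambda(xyx^+)\vee\mathbf M_{\gamma'}([x^2yzx^2ty]^{\gamma'})$; - (x)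 $\mathbf M_\lambda(xyx^+)\vee\mathbf M_{\gamma'}([yzx^2ytx^2]^{\gamma'})$; - (xi) $\mathbf M_\lambda(xyx^+)\vee\mathbf M_{\gamma'}([x^2zytx^2y]^{\gamma'})$; - (xii) $\mathbf M(xyx)\vee\mathbf H$; - (xiii) $\mathbf M(xyx)\vee\mathbf M_\lambda(xyzx^+ty^+)$; - (xiv) $\mathbf M(xyx)\vee\mathbf M_\lambda(xx^+yty^+)$; - (xv) $\mathbf M(xyxzx)\vee\mathbf M_\nu([yx^2ty]^\nu)$; - (xvi) $\mathbf M(xyxzx)\vee\mathbf M_{\gamma'}(yxx^+ty)$; - (xvii) $\mathbf M(xyxzx)\vee\mathbf M_{\gamma'}(xx^+yty)$; - (xviii) $\mathbf M(xyxzx)\vee\mathbf M_{\lambda'}(xyzxx^+ty)$; - (xix) $\mathbf M(xyxzx)\vee\mathbf M_{\lambda'}(xyzytxx^+)$; - (xx) $\mathbf M(xyxzx)\vee\mathbf M_{\lambda'}(yzyxtxx^+)$; - (xxi) $\mathbf M_\mu(xyxzx^+)\vee\mathbf M_{\lambda'}(xyzx^+tysx^+)$; - (xxii) $\mathbf M_\mu(xyxzx^+)\vee\mathbf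 M_\eta([xyzx^2ty]^\eta)$; - (xxiii) $\mathbf M(xzxyty)\vee\mathbf N$; - (xxiv) $\mathbf M(xzytxy)\vee\mathbf N$. -/

import Mathlib

namespace MonVar

/-! ### Words, identities, varieties of monoids -/

/-- Words over a countably infinite alphabet: the free monoid on the letters `0, 1, 2, …`. -/
abbrev Word := FreeMonoid ℕ

/-- The identity `u ≈ v`, encoded as the pair `(u, v)`, holds in `M`:
every substitution of the letters by elements of `M` gives the two words the same value. -/
def Satisfies (M : Type*) [Monoid M] (e : Word × Word) : Prop :=
  ∀ φ : ℕ → M, FreeMonoid.lift φ e.1 = FreeMonoid.lift φ e.2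

/-- The class of all monoids satisfying a set of identities. -/
def models (S : Set (Word × Word)) : Set MonCat.{0} :=
  {M | ∀ e ∈ S, Satisfies M e}

/-- A variety of monoids: a class of monoids which consists of all monoids
satisfying some set of identities. -/
structure Variety where
  carrier : Set MonCat.{0}
  equational : ∃ S : Set (Word × Word), carrier = models S

namespace Variety

@[ext]
theorem ext {V W : Variety} (h : V.carrier = W.carrier) : V = W := by
  cases V; cases W; cases h; rfl

/-- Varieties are ordered by inclusion of classes. -/
instance : PartialOrder Variety :=
  PartialOrder.lift Variety.carrier fun _ _ h => ext h

theorem le_def {V W : Variety} : V ≤ W ↔ V.carrier ⊆ W.carrier := Iff.rfl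

/-- The infimum of a set of varieties is the intersection of the classes. -/
instance : InfSet Variety where
  sInf 𝒱 :=
    { carrier := ⋂ V ∈ 𝒱, V.carrier
      equational := by
        refine ⟨⋃ V ∈ 𝒱, Classical.choose V.equational, ?_⟩
        ext M
        have key : ∀ V : Variety, M ∈ V.carrier ↔
            ∀ e ∈ Classical.choose V.equational, Satisfies M e := by
          intro V
          have h := Classical.choose_spec V.equational
          constructor
          · intro hM
            rw [h] at hM
            exact hM
          · intro hM
            rw [h]
            exact hM
        simp only [models, Set.mem_iInter, Set.mem_ofPred_eq, Set.mem_iUnion, key]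
        constructor
        · rintro h e ⟨V, hV, he⟩
          exact h V hV e he
        · intro h V hV e he
          exact h e ⟨V, hV, he⟩ }

theorem mem_sInf {𝒱 : Set Variety} {M : MonCat.{0}} :
    M ∈ (sInf 𝒱).carrier ↔ ∀ V ∈ 𝒱, M ∈ V.carrier := by
  simp [sInf]

/-- The complete lattice of all varieties of monoids: the meet is the intersection and the join
is the least variety containing the given ones. -/
instance : CompleteLattice Variety :=
  completeLatticeOfInf Variety fun _ =>
    ⟨fun V hV _ hM => mem_sInf.1 hM V hV,
      fun _ hW _ hM => mem_sInf.2 fun _ hV => hW hV hM⟩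

end Variety

/-- `var Σ`: the variety given by a set `Σ` of identities. -/
def var (S : Set (Word × Word)) : Variety := ⟨models S, S, rfl⟩

/-- The variety generated by a monoid: the least variety containing it. -/
def generatedBy (M : Type) [Monoid M] : Variety :=
  sInf {V | MonCat.of M ∈ V.carrier}

/-- The lattice of subvarieties of `V` is not modular. -/
def HasNonmodularSubvarietyLattice (V : Variety) : Prop :=
  ¬ IsModularLattice (Set.Iic V)

/-- `FIC(V)`: the fully invariant congruence of all identities holding in the variety `V`. -/
def FIC (V : Variety) : Con Word where
  r u v := ∀ M ∈ V.carrier, Satisfies M (u, v)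
  iseqv :=
    ⟨fun _ _ _ _ => rfl, fun h M hM φ => (h M hM φ).symm,
      fun h h' M hM φ => (h M hM φ).trans (h' M hM φ)⟩
  mul' := by
    intro a b c d h h' M hM φ
    have h1 := h M hM φ
    have h2 := h' M hM φ
    simp only at h1 h2
    simp only [map_mul, h1, h2]

/-! ### Rees quotients and Sapir's construction -/

/-- The closure of `W` under taking factors. -/
def factors {S : Type*} [Monoid S] (W : Set S) : Set S :=
  {v | ∃ u ∈ W, ∃ p s, u = p * v * s}

/-- The Rees congruence on `S` over the ideal of all elements that are not factors of elements
of `W`: this ideal is collapsed to one element, and nothing else is identified. -/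
def reesCon {S : Type*} [Monoid S] (W : Set S) : Con S where
  r a b := a = b ∨ (a ∉ factors W ∧ b ∉ factors W)
  iseqv := by
    refine ⟨fun _ => Or.inl rfl, ?_, ?_⟩
    · rintro a b (h | ⟨h, h'⟩)
      · exact Or.inl h.symm
      · exact Or.inr ⟨h', h⟩
    · rintro a b c (rfl | ⟨h, h'⟩) hbc
      · exact hbc
      · rcases hbc with rfl | ⟨_, h''⟩
        · exact Or.inr ⟨h, h'⟩
        · exact Or.inr ⟨h, h''⟩
  mul' := by
    have hl : ∀ a c : S, a ∉ factors W → a * c ∉ factors W := by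
      rintro a c ha ⟨u, hu, p, s, rfl⟩
      exact ha ⟨_, hu, p, c * s, by simp only [mul_assoc]⟩
    have hr : ∀ a c : S, c ∉ factors W → a * c ∉ factors W := by
      rintro a c hc ⟨u, hu, p, s, rfl⟩
      exact hc ⟨_, hu, p * a, s, by simp only [mul_assoc]⟩
    rintro a b c d (rfl | ⟨h, h'⟩) (rfl | ⟨k, k'⟩)
    · exact Or.inl rfl
    · exact Or.inr ⟨hr _ _ k, hr _ _ k'⟩
    · exact Or.inr ⟨hl _ _ h, hl _ _ h'⟩
    · exact Or.inr ⟨hl _ _ h, hl _ _ h'⟩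

/-- The variety generated by `M(w)`, the Rees quotient of the free monoid over the ideal of all
words that are not factors of `w`. -/
def varM (w : Word) : Variety := generatedBy (reesCon ({w} : Set Word)).Quotient

/-- The variety generated by `M_α(𝚠)` for the `α`-class `𝚠 = [w]^α`: the Rees quotient of
`X* / α` over the ideal of all `α`-classes that do not divide `[w]^α`. -/
def varMα (α : Con Word) (w : Word) : Variety :=
  generatedBy (reesCon ({(w : α.Quotient)} : Set α.Quotient)).Quotient

/-! ### The congruences `γ` and `λ` -/

/-- The number of occurrences of the letter `a` in `w`. -/
def occ (a : ℕ) (w : Word) : ℕ := (FreeMonoid.toList w).count a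

/-- The simple letters of `w`: those occurring exactly once. -/
def sim (w : Word) : Set ℕ := {a | occ a w = 1}

/-- Replace every maximal power of a letter in `w` by one occurrence of this letter. Two words
can be obtained from each other by changing the (positive) exponents of letters if and only if
these reduced forms coincide. -/
def squash (w : Word) : List ℕ := (FreeMonoid.toList w).destutter (· ≠ ·)

/-- The first two occurrences of `a` in `w` exist and are adjacent: the suffix of `w` beginning at
the first occurrence of `a` begins with `aa`. -/
def FirstTwoAdjacent (a : ℕ) (w : Word) : Prop :=
  [a, a] <+: (FreeMonoid.toList w).dropWhile (· != a)

/-- One step of `squash`, read from the right. -/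
def sqStep (a : ℕ) (l : List ℕ) : List ℕ := if l.head? = some a then l else a :: l

theorem head?_sqStep (a : ℕ) (l : List ℕ) : (sqStep a l).head? = some a := by
  unfold sqStep; split_ifs with h <;> simp [h]

theorem sqStep_sqStep (a : ℕ) (l : List ℕ) : sqStep a (sqStep a l) = sqStep a l := by
  exact if_pos (head?_sqStep a l)

theorem destutter'_eq (l : List ℕ) : ∀ a : ℕ,
    l.destutter' (· ≠ ·) a = sqStep a (l.foldr sqStep []) := by
  induction l with
  | nil => intro a; simp [sqStep]
  | cons b l ih =>
    intro a
    rw [List.destutter'_cons, List.foldr_cons]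
    by_cases h : a = b
    · subst h
      simp only [ne_eq, not_true_eq_false, if_false, sqStep_sqStep, ih]
    · rw [if_pos h, ih b]
      refine (if_neg ?_).symm
      rw [head?_sqStep]
      simpa using fun h' => h h'.symm

theorem squash_eq (w : Word) : squash w = (FreeMonoid.toList w).foldr sqStep [] := by
  unfold squash
  cases h : FreeMonoid.toList w with
  | nil => rfl
  | cons a l => rw [List.destutter_cons', destutter'_eq]; rfl

theorem foldr_sqStep (l m : List ℕ) :
    l.foldr sqStep m = (l.foldr sqStep []).foldr sqStep m := by
  induction l with
  | nil => rfl
  | cons a l ih =>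
    rw [List.foldr_cons, List.foldr_cons, ih]
    generalize l.foldr sqStep [] = k
    by_cases h : k.head? = some a
    · cases k with
      | nil => simp at h
      | cons b k =>
        obtain rfl : b = a := by simpa using h
        rw [show sqStep b (b :: k) = b :: k by simp [sqStep], List.foldr_cons, sqStep_sqStep]
    · rw [show sqStep a k = a :: k by simp [sqStep, h], List.foldr_cons]

theorem squash_mul {u u' v v' : Word} (h : squash u = squash u') (h' : squash v = squash v') :
    squash (u * v) = squash (u' * v') := by
  simp only [squash_eq] at h h' ⊢
  rw [FreeMonoid.toList_mul, FreeMonoid.toList_mul, List.foldr_append, List.foldr_append,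
    foldr_sqStep, h, h', ← foldr_sqStep]

theorem mem_iff_squash (a : ℕ) (w : Word) : a ∈ FreeMonoid.toList w ↔ a ∈ squash w := by
  rw [squash_eq]
  induction FreeMonoid.toList w with
  | nil => rfl
  | cons b l ih =>
    rw [List.foldr_cons, List.mem_cons, ih]
    generalize l.foldr sqStep [] = k
    unfold sqStep
    split_ifs with h
    · constructor
      · rintro (rfl | h')
        · exact List.mem_of_mem_head? h
        · exact h'
      · exact Or.inr
    · exact List.mem_cons.symm

theorem head?_squash (w : Word) : (squash w).head? = (FreeMonoid.toList w).head? := by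
  rw [squash_eq]
  cases FreeMonoid.toList w with
  | nil => rfl
  | cons b l => rw [List.foldr_cons, head?_sqStep]; rfl

theorem getLast?_squash (w : Word) : (squash w).getLast? = (FreeMonoid.toList w).getLast? := by
  rw [squash_eq]
  induction FreeMonoid.toList w with
  | nil => rfl
  | cons b l ih =>
    rw [List.foldr_cons, List.getLast?_cons, ← ih]
    generalize l.foldr sqStep [] = k
    unfold sqStep
    split_ifs with h
    · cases k with
      | nil => simp at h
      | cons c k => simp [List.getLast?_cons]
    · rw [List.getLast?_cons]

theorem occ_mul (a : ℕ) (u v : Word) : occ a (u * v) = occ a u + occ a v := by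
  simp [occ, FreeMonoid.toList_mul, List.count_append]

theorem occ_eq_zero (a : ℕ) (w : Word) : occ a w = 0 ↔ a ∉ squash w := by
  rw [← mem_iff_squash]; exact List.count_eq_zero

/-- `u γ v`: the words `u` and `v` have the same simple letters, and `u` can be obtained from `v`
by changing the individual exponents of letters. -/
def gam : Con Word where
  r u v := sim u = sim v ∧ squash u = squash v
  iseqv := ⟨fun _ => ⟨rfl, rfl⟩, fun h => ⟨h.1.symm, h.2.symm⟩,
    fun h h' => ⟨h.1.trans h'.1, h.2.trans h'.2⟩⟩
  mul' := by
    rintro u u' v v' ⟨h1, h2⟩ ⟨k1, k2⟩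
    refine ⟨?_, squash_mul h2 k2⟩
    ext a
    have e1 : occ a u = 1 ↔ occ a u' = 1 := Set.ext_iff.1 h1 a
    have e2 : occ a v = 1 ↔ occ a v' = 1 := Set.ext_iff.1 k1 a
    have e3 : occ a u = 0 ↔ occ a u' = 0 := by rw [occ_eq_zero, occ_eq_zero, h2]
    have e4 : occ a v = 0 ↔ occ a v' = 0 := by rw [occ_eq_zero, occ_eq_zero, k2]
    simp only [sim, Set.mem_ofPred_eq, occ_mul]
    omega

theorem dropWhile_of_notMem {a : ℕ} {l : List ℕ} (h : a ∉ l) (m : List ℕ) :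
    (l ++ m).dropWhile (· != a) = m.dropWhile (· != a) := by
  induction l with
  | nil => rfl
  | cons b l ih =>
    simp only [List.mem_cons, not_or] at h
    rw [List.cons_append, List.dropWhile_cons_of_pos (by simpa using Ne.symm h.1), ih h.2]

theorem firstTwoAdjacent_mul (a : ℕ) (u v : Word) : FirstTwoAdjacent a (u * v) ↔
    (occ a u = 0 ∧ FirstTwoAdjacent a v) ∨
    (occ a u = 1 ∧ (squash u).getLast? = some a ∧ (squash v).head? = some a) ∨
    (2 ≤ occ a u ∧ FirstTwoAdjacent a u) := by
  rw [getLast?_squash, head?_squash]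
  unfold FirstTwoAdjacent occ
  rw [FreeMonoid.toList_mul]
  generalize FreeMonoid.toList u = l
  generalize FreeMonoid.toList v = m
  by_cases ha : a ∈ l
  · obtain ⟨p, r, rfl, hp⟩ := List.eq_append_cons_of_mem ha
    have hc : (p ++ a :: r).count a = r.count a + 1 := by
      simp [List.count_append, List.count_eq_zero.2 hp]
    rw [hc, List.append_assoc, dropWhile_of_notMem hp, dropWhile_of_notMem hp, List.cons_append,
      List.dropWhile_cons_of_neg (by simp), List.dropWhile_cons_of_neg (by simp),
      List.cons_prefix_cons, List.cons_prefix_cons]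
    cases r with
    | nil =>
      cases m with
      | nil => simp
      | cons c m =>
        simp only [List.nil_append, List.cons_prefix_cons, List.nil_prefix, and_true, true_and,
          List.count_nil, List.head?_cons, Option.some.injEq, List.getLast?_concat]
        constructor
        · rintro rfl
          exact Or.inr (Or.inl rfl)
        · rintro (⟨h, _⟩ | h | ⟨h, _⟩)
          · omega
          · exact h.symm
          · omega
    | cons b r =>
      have hlast : (p ++ a :: b :: r).getLast? = (b :: r).getLast? := by
        simp [List.getLast?_append, List.getLast?_cons]
      rw [hlast]
      simp only [List.cons_append, List.cons_prefix_cons, List.nil_prefix, and_true, true_and]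
      constructor
      · rintro rfl
        right; right
        simp
      · rintro (⟨h, _⟩ | ⟨h, h', _⟩ | ⟨_, h⟩)
        · omega
        · exact absurd (List.mem_of_getLast? h') (List.count_eq_zero.1 (by omega))
        · exact h
  · have hc := List.count_eq_zero.2 ha
    rw [dropWhile_of_notMem ha, hc]
    simp

/-- `u λ v`: `u γ v`, and the first two occurrences of each multiple letter are adjacent in `u`
if and only if they are adjacent in `v` (words related by `γ` have the same multiple letters). -/
def lam : Con Word where
  r u v := gam u v ∧ ∀ a, 2 ≤ occ a u → (FirstTwoAdjacent a u ↔ FirstTwoAdjacent a v)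
  iseqv := by
    have e : ∀ {u v : Word}, gam u v → ∀ a, 2 ≤ occ a u ↔ 2 ≤ occ a v := by
      rintro u v ⟨h1, h2⟩ a
      have e1 : occ a u = 1 ↔ occ a v = 1 := Set.ext_iff.1 h1 a
      have e3 : occ a u = 0 ↔ occ a v = 0 := by rw [occ_eq_zero, occ_eq_zero, h2]
      omega
    exact ⟨fun u => ⟨gam.refl u, fun _ _ => Iff.rfl⟩,
      fun h => ⟨gam.symm h.1, fun a ha => (h.2 a ((e h.1 a).2 ha)).symm⟩,
      fun h h' => ⟨gam.trans h.1 h'.1,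
        fun a ha => (h.2 a ha).trans (h'.2 a ((e h.1 a).1 ha))⟩⟩
  mul' := by
    rintro u u' v v' ⟨h, hu⟩ ⟨k, hv⟩
    refine ⟨gam.mul h k, fun a ha => ?_⟩
    have e1 : occ a u = 1 ↔ occ a u' = 1 := Set.ext_iff.1 h.1 a
    have e3 : occ a u = 0 ↔ occ a u' = 0 := by rw [occ_eq_zero, occ_eq_zero, h.2]
    rw [firstTwoAdjacent_mul, firstTwoAdjacent_mul, ← h.2, ← k.2, ← e1, ← e3]
    rw [occ_mul] at ha
    rcases (show occ a u = 0 ∨ occ a u = 1 ∨ 2 ≤ occ a u by omega) with h0 | h0 | h0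
    · have := hv a (by omega)
      have h2 : ¬ 2 ≤ occ a u' := by omega
      simp [h0, h2, this]
    · have h2 : ¬ 2 ≤ occ a u' := by omega
      simp [h0, h2]
    · have := hu a h0
      have h2 : 2 ≤ occ a u' := by omega
      have h3 : occ a u ≠ 0 := by omega
      have h4 : occ a u ≠ 1 := by omega
      simp [h0, h2, h3, h4, this]

/-- The congruence dual to `α`: it relates `u` and `v` if and only if `α` relates these words read
from right to left. -/
def dualCon (α : Con Word) : Con Word where
  r u v := α u.reverse v.reverse
  iseqv := ⟨fun _ => α.refl _, fun h => α.symm h, fun h h' => α.trans h h'⟩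
  mul' := by
    intro a b c d h h'
    rw [FreeMonoid.reverse_mul, FreeMonoid.reverse_mul]
    exact α.mul h' h

/-! ### Letters, and the remaining congruences and varieties -/

/-- The letters `x, y, z, t, s` are pairwise distinct. -/
def x : Word := FreeMonoid.of 0
def y : Word := FreeMonoid.of 1
def z : Word := FreeMonoid.of 2
def t : Word := FreeMonoid.of 3
def s : Word := FreeMonoid.of 4

/-- `γ' = γ ∧ FIC(𝐌(xyx))`. -/
def gam' : Con Word := gam ⊓ FIC (varM (x * y * x))

/-- `λ' = λ ∧ FIC(𝐌(xyx))`. -/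
def lam' : Con Word := lam ⊓ FIC (varM (x * y * x))

/-- `ν = FIC(var{xy ≈ xyx} ∨ 𝐌(xyx))`. -/
def nu : Con Word := FIC (var {(x * y, x * y * x)} ⊔ varM (x * y * x))

/-- `η = FIC(var{xyxz ≈ xyxzx, ytx²y ≈ ytyx²} ∨ 𝐌(xyx))`. -/
def eta : Con Word :=
  FIC (var {(x * y * x * z, x * y * x * z * x), (y * t * x ^ 2 * y, y * t * y * x ^ 2)} ⊔
    varM (x * y * x))

/-- `μ = FIC(var{x² ≈ x³, xyxzx ≈ xyxzx²})`. -/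
def mu : Con Word :=
  FIC (var {(x ^ 2, x ^ 3), (x * y * x * z * x, x * y * x * z * x ^ 2)})

/-- `𝐃₁ = var{x² ≈ x³, x²y² ≈ y²x², xyx ≈ xyx², x²y ≈ x²yx}`. -/
def D₁ : Variety :=
  var {(x ^ 2, x ^ 3), (x ^ 2 * y ^ 2, y ^ 2 * x ^ 2), (x * y * x, x * y * x ^ 2),
    (x ^ 2 * y, x ^ 2 * y * x)}

/-- The subvariety `𝐇` of `𝐃₁` defined within `𝐃₁` by `xyxty ≈ yx²ty`. -/
def H : Variety := D₁ ⊓ var {(x * y * x * t * y, y * x ^ 2 * t * y)}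

/-- `𝐍 = var{x² ≈ x³, x²y ≈ yx², xyxzx ≈ x²yz, σ₂, σ₃}` with `σ₂ : xzytxy ≈ xzytyx` and
`σ₃ : xzxyty ≈ xzyxty`. -/
def N : Variety :=
  var {(x ^ 2, x ^ 3), (x ^ 2 * y, y * x ^ 2), (x * y * x * z * x, x ^ 2 * y * z),
    (x * z * y * t * x * y, x * z * y * t * y * x), (x * z * x * y * t * y, x * z * y * x * t * y)}

end MonVar

open MonVar

set_option linter.unusedSimpArgs false

namespace MonVar

/-! ### Varieties and their identities -/

/-! Every join A ∨ B is treated by one criterion, `nonmodular_of`. Let Z = (A ∨ B) ∧ var{e₁ ≈ e₂}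
with A ⊆ Z. The modular law would force Z ⊆ A ∨ (B ∧ Z). If both A and B ∧ var{e₁ ≈ e₂} satisfy u ≈
v, so does the right-hand side. But Z fails u ≈ v as soon as A ∨ B fails it and applying e₁ ≈ e₂
never alters a word equal to u in A ∨ B: the class of u is then saturated by the identities of Z,
and v lies outside it.

In most cases u and v differ by exchanging two adjacent letters x and y, and e₁, e₂ arise from u, v
by adding, doubling or moving an occurrence of x, an operation invisible in B. The variety A is
𝐌_α(w) for a word w with a single multiple letter. An instance dividing w sends x and y to powers of
that letter, so A does not see the exchange (`FIC_of_swapEquiv`). To isolate u, one finds a few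
scattered subwords which no word equal to u contains, and checks that every instance of e₁ or e₂
with non-commuting images of x and y contains one of them. A simple letter k of u serves as a
marker, which makes this the finite check `Blocked` (`nonmodular_of_swap`).

That B fails u ≈ v is seen on the class of w if B = 𝐌_α(w). For 𝐇, 𝐍 and the varieties behind η and
μ the separating sets of words are `Pre L k C`, which prescribe what precedes a simple letter k; for
ν it is the order of first occurrences.

Two situations differ. For 𝐌_λ(xyx⁺) and its dual there is simply no room for a third x. In the
joins with 𝐍 the word w has two multiple letters, so the exchange is justified by
`FIC_varM_of_pattern`, and `exists_split` locates a hypothetical instance of e₁ or e₂. -/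

theorem FIC_iff {V : Variety} {u v : Word} :
    FIC V u v ↔ ∀ M ∈ V.carrier, Satisfies M (u, v) := Iff.rfl

theorem mem_var {S : Set (Word × Word)} {M : MonCat.{0}} :
    M ∈ (var S).carrier ↔ ∀ e ∈ S, Satisfies M e := Iff.rfl

theorem FIC_iff_le {V : Variety} {u v : Word} : FIC V u v ↔ V ≤ var {(u, v)} := by
  rw [FIC_iff, Variety.le_def]
  constructor
  · rintro h M hM e rfl
    exact h M hM
  · intro h M hM
    exact h hM _ rfl

theorem FIC_mono {V W : Variety} (h : V ≤ W) {u v : Word} (hW : FIC W u v) : FIC V u v :=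
  fun M hM => hW M (h hM)

theorem FIC_sup {V W : Variety} {u v : Word} :
    FIC (V ⊔ W) u v ↔ FIC V u v ∧ FIC W u v := by
  simp only [FIC_iff_le, sup_le_iff]

theorem mem_iff_generatedBy_le {V : Variety} {M : Type} [Monoid M] :
    MonCat.of M ∈ V.carrier ↔ generatedBy M ≤ V := by
  constructor
  · intro h
    exact sInf_le h
  · intro h
    exact h (Variety.mem_sInf.2 fun _ hW => hW)

theorem mem_inf {V W : Variety} {M : Type} [Monoid M] :
    MonCat.of M ∈ (V ⊓ W).carrier ↔ MonCat.of M ∈ V.carrier ∧ MonCat.of M ∈ W.carrier := by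
  simp only [mem_iff_generatedBy_le, le_inf_iff]

theorem FIC_generatedBy {M : Type} [Monoid M] {u v : Word} :
    FIC (generatedBy M) u v ↔ Satisfies M (u, v) := by
  rw [FIC_iff_le, ← mem_iff_generatedBy_le, mem_var]
  simp

theorem FIC_var {S : Set (Word × Word)} {u v : Word} (h : (u, v) ∈ S) : FIC (var S) u v :=
  fun _ hM => hM _ h

/-- Varieties are equational by definition, so it suffices to transfer the defining identities of
`W`; Birkhoff's theorem is not needed. -/
theorem le_of_FIC {V W : Variety} (h : ∀ u v, FIC W u v → FIC V u v) : V ≤ W := by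
  obtain ⟨S, hS⟩ := W.equational
  intro M hM
  rw [hS]
  intro e he
  refine h e.1 e.2 (fun N hN => ?_) M hM
  rw [hS] at hN
  exact hN e he

theorem lift_of (u : Word) : FreeMonoid.lift FreeMonoid.of u = u :=
  DFunLike.congr_fun (FreeMonoid.lift_restrict (MonoidHom.id Word)) u

theorem lift_lift {M : Type*} [Monoid M] (φ : ℕ → Word) (ψ : ℕ → M) (u : Word) :
    FreeMonoid.lift ψ (FreeMonoid.lift φ u) =
      FreeMonoid.lift (fun i => FreeMonoid.lift ψ (φ i)) u := by
  rw [← MonoidHom.comp_apply, FreeMonoid.comp_lift]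
  rfl

theorem FIC_lift {V : Variety} {u v : Word} (h : FIC V u v) (φ : ℕ → Word) :
    FIC V (FreeMonoid.lift φ u) (FreeMonoid.lift φ v) := by
  intro M hM ψ
  simp only [lift_lift]
  exact h M hM _

/-- Substitutions into a quotient of the free monoid lift to substitutions by words, so validity in
the quotient becomes a statement about words. -/
theorem satisfies_iff_of_surjective {Q : Type*} [Monoid Q] (π : Word →* Q)
    (hπ : Function.Surjective π) {u v : Word} :
    Satisfies Q (u, v) ↔
      ∀ φ : ℕ → Word, π (FreeMonoid.lift φ u) = π (FreeMonoid.lift φ v) := by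
  have key : ∀ (φ : ℕ → Word) (w : Word),
      π (FreeMonoid.lift φ w) = FreeMonoid.lift (fun i => π (φ i)) w := by
    intro φ w
    rw [← MonoidHom.comp_apply, FreeMonoid.comp_lift]
    rfl
  constructor
  · intro h φ
    rw [key, key]
    exact h _
  · intro h ψ
    choose φ hφ using fun i => hπ (ψ i)
    have := h φ
    rw [key, key] at this
    simpa only [hφ] using this

/-! ### Saturated sets of words and the criterion of non-modularity -/

/-- The largest fully invariant congruence saturating the set `S` of words. -/
def syn (S : Set Word) : Con Word where
  r u v := ∀ (φ : ℕ → Word) (a b : Word),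
    a * FreeMonoid.lift φ u * b ∈ S ↔ a * FreeMonoid.lift φ v * b ∈ S
  iseqv := ⟨fun _ _ _ _ => Iff.rfl, fun h φ a b => (h φ a b).symm,
    fun h h' φ a b => (h φ a b).trans (h' φ a b)⟩
  mul' := by
    intro u u' v v' h h' φ a b
    have h1 := h φ a (FreeMonoid.lift φ v * b)
    have h2 := h' φ (a * FreeMonoid.lift φ u') b
    simp only [map_mul, mul_assoc] at h1 h2 ⊢
    exact h1.trans h2

theorem syn_lift {S : Set Word} {u v : Word} (h : syn S u v) (φ : ℕ → Word) :
    syn S (FreeMonoid.lift φ u) (FreeMonoid.lift φ v) := by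
  intro ψ a b
  simp only [lift_lift]
  exact h _ a b

/-- Since `syn S` is fully invariant, its quotient satisfies exactly the pairs it contains. These
quotients are the monoids that separate identities throughout. -/
theorem satisfies_syn {S : Set Word} {u v : Word} :
    Satisfies (syn S).Quotient (u, v) ↔ syn S u v := by
  rw [satisfies_iff_of_surjective (syn S).mk' Con.mk'_surjective]
  constructor
  · intro h
    have := h FreeMonoid.of
    rw [lift_of, lift_of] at this
    exact (Con.eq _).1 this
  · intro h φ
    exact (Con.eq _).2 (syn_lift h φ)

theorem syn_mem {S : Set Word} {u v : Word} (h : syn S u v) : u ∈ S ↔ v ∈ S := by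
  have := h FreeMonoid.of 1 1
  simpa [lift_of] using this

/-- A set of words saturated by the identities of a variety `V` separates no identity of `V`. -/
theorem mem_iff_of_FIC {V : Variety} {S : Set Word}
    (hS : MonCat.of (syn S).Quotient ∈ V.carrier) {u v : Word} (h : FIC V u v) :
    u ∈ S ↔ v ∈ S :=
  syn_mem (satisfies_syn.1 (h _ hS))

/-- A criterion for the subvariety lattice of `A ⊔ B` to be non-modular: the subvarieties `A`, `B`
and `(A ⊔ B) ⊓ var {e₁ ≈ e₂}` violate the modular law, as `u ≈ v` shows. -/
theorem nonmodular_of {A B : Variety} {e₁ e₂ u v : Word} (hA : FIC A e₁ e₂) (hAuv : FIC A u v)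
    (hB : B ⊓ var {(e₁, e₂)} ≤ var {(u, v)}) (hV : ¬ FIC (A ⊔ B) u v)
    (hS : ∀ p, FIC (A ⊔ B) u p → ∀ (φ : ℕ → Word) (a b : Word),
      p = a * FreeMonoid.lift φ e₁ * b ∨ p = a * FreeMonoid.lift φ e₂ * b →
        FreeMonoid.lift φ e₁ = FreeMonoid.lift φ e₂) :
    HasNonmodularSubvarietyLattice (A ⊔ B) := by
  intro hmod
  set S : Set Word := {p | FIC (A ⊔ B) u p} with hSdef
  -- `S` is a class of `FIC (A ⊔ B)`, so the identities of `A ⊔ B` saturate it; `e₁ ≈ e₂` does so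
  -- because by `hS` its instances inside `S` are trivial.
  have hZ : MonCat.of (syn S).Quotient ∈ ((A ⊔ B) ⊓ var {(e₁, e₂)}).carrier := by
    refine mem_inf.2 ⟨?_, ?_⟩
    · rw [mem_iff_generatedBy_le]
      refine le_of_FIC fun p q hpq => FIC_generatedBy.2 (satisfies_syn.2 fun φ a b => ?_)
      have := (FIC (A ⊔ B)).mul ((FIC (A ⊔ B)).mul ((FIC (A ⊔ B)).refl a) (FIC_lift hpq φ))
        ((FIC (A ⊔ B)).refl b)
      exact ⟨fun h => (FIC (A ⊔ B)).trans h this,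
        fun h => (FIC (A ⊔ B)).trans h ((FIC (A ⊔ B)).symm this)⟩
    · rintro e rfl
      refine satisfies_syn.2 fun φ a b => ⟨fun h => ?_, fun h => ?_⟩
      · rw [← hS _ h φ a b (Or.inl rfl)]; exact h
      · rw [hS _ h φ a b (Or.inr rfl)]; exact h
  have hAZ : A ≤ (A ⊔ B) ⊓ var {(e₁, e₂)} := le_inf le_sup_left (FIC_iff_le.1 hA)
  let X : Set.Iic (A ⊔ B) := ⟨A, show A ≤ A ⊔ B from le_sup_left⟩
  let Y : Set.Iic (A ⊔ B) := ⟨B, show B ≤ A ⊔ B from le_sup_right⟩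
  let Z : Set.Iic (A ⊔ B) := ⟨(A ⊔ B) ⊓ var {(e₁, e₂)}, show _ ≤ A ⊔ B from inf_le_left⟩
  have hXZ : X ≤ Z := hAZ
  -- As `Z` lies below `X ⊔ Y`, the left side is `Z` itself.
  have h1 : (X ⊔ Y) ⊓ Z ≤ X ⊔ (Y ⊓ Z) := hmod.sup_inf_le_assoc_of_le Y hXZ
  have h2 : (A ⊔ B) ⊓ ((A ⊔ B) ⊓ var {(e₁, e₂)}) ≤ A ⊔ (B ⊓ ((A ⊔ B) ⊓ var {(e₁, e₂)})) := h1
  rw [inf_left_idem] at h2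
  have h3 : (A ⊔ B) ⊓ var {(e₁, e₂)} ≤ var {(u, v)} :=
    h2.trans (sup_le (FIC_iff_le.1 hAuv) ((inf_le_inf_left B inf_le_right).trans hB))
  have h4 := mem_iff_of_FIC hZ (FIC_iff_le.2 h3)
  exact hV (h4.1 ((FIC (A ⊔ B)).refl u))

/-- The chain u ≈ e₁ ≈ e₂ ≈ v: the outer links hold in `B`, the middle one is imposed. -/
theorem inf_le_of_FIC {B : Variety} {e₁ e₂ u v : Word} (h₁ : FIC B u e₁) (h₂ : FIC B v e₂) :
    B ⊓ var {(e₁, e₂)} ≤ var {(u, v)} := by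
  have h : FIC (B ⊓ var {(e₁, e₂)}) e₁ e₂ := FIC_mono inf_le_right (FIC_var rfl)
  exact FIC_iff_le.1 ((FIC _).trans ((FIC _).trans (FIC_mono inf_le_left h₁) h)
    ((FIC _).symm (FIC_mono inf_le_left h₂)))

/-! ### The varieties generated by Rees quotients -/

/-- The class of `p` divides the class of `w` modulo `α`. -/
def Divides (α : Con Word) (w p : Word) : Prop := ∃ a b, α w (a * p * b)

theorem mem_factors {α : Con Word} {w p : Word} :
    (p : α.Quotient) ∈ factors ({(w : α.Quotient)} : Set α.Quotient) ↔ Divides α w p := by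
  constructor
  · rintro ⟨_, rfl, a, b, h⟩
    induction a using Con.induction_on with | H a =>
    induction b using Con.induction_on with | H b =>
    exact ⟨a, b, (Con.eq _).1 h⟩
  · rintro ⟨a, b, h⟩
    exact ⟨_, rfl, a, b, (Con.eq _).2 h⟩

/-- The Rees quotient merges only the classes not dividing that of `w`: the two values of an
instance agree if they are α-related or both become zero. -/
theorem FIC_varMα {α : Con Word} {w u v : Word} : FIC (varMα α w) u v ↔ ∀ φ : ℕ → Word,
    α (FreeMonoid.lift φ u) (FreeMonoid.lift φ v) ∨
      (¬ Divides α w (FreeMonoid.lift φ u) ∧ ¬ Divides α w (FreeMonoid.lift φ v)) := by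
  rw [varMα, FIC_generatedBy, satisfies_iff_of_surjective
    ((reesCon ({(w : α.Quotient)} : Set α.Quotient)).mk'.comp α.mk')
    (Con.mk'_surjective.comp Con.mk'_surjective)]
  refine forall_congr' fun φ => ?_
  rw [← mem_factors, ← mem_factors, ← Con.eq α]
  exact Con.eq _

/-- With equality as α, the varieties 𝐌(w) fall under the results on 𝐌_α(w). -/
theorem varM_eq (w : Word) : varM w = varMα ⊥ w := by
  have key : ∀ u v, FIC (varM w) u v ↔ FIC (varMα ⊥ w) u v := by
    intro u v
    rw [FIC_varMα, varM, FIC_generatedBy, satisfies_iff_of_surjective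
      (reesCon ({w} : Set Word)).mk' Con.mk'_surjective]
    refine forall_congr' fun φ => ?_
    have hd : ∀ p : Word, p ∈ factors ({w} : Set Word) ↔ Divides ⊥ w p := by
      intro p
      simp only [factors, Divides, Set.mem_singleton_iff, exists_eq_left]
      rfl
    rw [← hd, ← hd]
    exact Con.eq _
  exact le_antisymm (le_of_FIC fun u v => (key u v).2) (le_of_FIC fun u v => (key u v).1)

/-- If `u ≈ v` holds in `𝐌_α(w)`, then the substitutions which, in a context, send `u` to the
class of `w` send `v` there. -/
theorem class_of_FIC {α : Con Word} {w u v : Word} (h : FIC (varMα α w) u v) (φ : ℕ → Word)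
    (a b : Word) (hu : α w (a * FreeMonoid.lift φ u * b)) :
    α w (a * FreeMonoid.lift φ v * b) := by
  rcases FIC_varMα.1 h φ with h1 | h1
  · exact α.trans hu (α.mul (α.mul (α.refl a) h1) (α.refl b))
  · exact absurd ⟨a, b, hu⟩ h1.1

theorem FIC_varMα_of {α : Con Word} {w u v : Word}
    (h : ∀ φ : ℕ → Word,
      Divides α w (FreeMonoid.lift φ u) ∨ Divides α w (FreeMonoid.lift φ v) →
        α (FreeMonoid.lift φ u) (FreeMonoid.lift φ v)) : FIC (varMα α w) u v := by
  refine FIC_varMα.2 fun φ => ?_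
  by_cases h1 : Divides α w (FreeMonoid.lift φ u) ∨ Divides α w (FreeMonoid.lift φ v)
  · exact Or.inl (h φ h1)
  · exact Or.inr (not_or.1 h1)

/-- A fully invariant α already identifies the two sides of each instance, before the Rees quotient
is formed. -/
theorem FIC_varMα_of_FIC {V : Variety} {w u v : Word} (h : FIC V u v) :
    FIC (varMα (FIC V) w) u v :=
  FIC_varMα.2 fun φ => Or.inl (FIC_lift h φ)

/-! ### Words, occurrences of letters, subwords -/

open FreeMonoid in
theorem toList_lift (φ : ℕ → Word) (u : Word) :
    toList (lift φ u) = (toList u).flatMap fun i => toList (φ i) := by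
  induction u using FreeMonoid.inductionOn' with
  | one => simp
  | of_mul a u ih => simp [ih]

theorem occ_one (a : ℕ) : occ a 1 = 0 := by simp [occ]

theorem occ_of (a b : ℕ) : occ a (FreeMonoid.of b) = if b = a then 1 else 0 := by
  simp [occ, List.count_singleton]

theorem mem_iff_occ {a : ℕ} {u : Word} : a ∈ FreeMonoid.toList u ↔ 1 ≤ occ a u :=
  List.one_le_count_iff.symm

theorem occ_pow (a : ℕ) (u : Word) (n : ℕ) : occ a (u ^ n) = n * occ a u := by
  induction n with
  | zero => simp [occ_one]
  | succ n ih => rw [pow_succ, occ_mul, ih]; ring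

/-- The basic counting tool: letters in the image of a multiple letter are multiple in the instance.
-/
theorem mul_occ_le_occ_lift (φ : ℕ → Word) (a c : ℕ) (u : Word) :
    occ c u * occ a (φ c) ≤ occ a (FreeMonoid.lift φ u) := by
  induction u using FreeMonoid.inductionOn' with
  | one => simp [occ_one]
  | of_mul b u ih =>
    rw [map_mul, FreeMonoid.lift_eval_of, occ_mul, occ_mul, occ_of]
    split_ifs with h
    · subst h
      linarith [add_mul 1 (occ b u) (occ a (φ b))]
    · simpa using ih.trans (Nat.le_add_left _ _)

/-- Letters which do not occur in the image of the letter `c` are not affected by erasing `c`. -/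
theorem occ_lift_update {φ : ℕ → Word} {a c : ℕ} (h : occ a (φ c) = 0) (u : Word) :
    occ a (FreeMonoid.lift (Function.update φ c 1) u) = occ a (FreeMonoid.lift φ u) := by
  induction u using FreeMonoid.inductionOn' with
  | one => simp
  | of_mul b u ih =>
    rw [map_mul, map_mul, FreeMonoid.lift_eval_of, FreeMonoid.lift_eval_of, occ_mul, occ_mul, ih]
    by_cases hb : b = c
    · subst hb
      simp [h, occ_one]
    · rw [Function.update_of_ne hb]

theorem lift_single (a : ℕ) (m u : Word) :
    FreeMonoid.lift (fun i => if i = a then m else 1) u = m ^ occ a u := by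
  induction u using FreeMonoid.inductionOn' with
  | one => simp [occ_one]
  | of_mul b u ih =>
    rw [map_mul, FreeMonoid.lift_eval_of, occ_mul, ih, occ_of]
    split_ifs with h
    · rw [pow_add, pow_one]
    · simp

theorem toList_of_pow (m n : ℕ) :
    FreeMonoid.toList (FreeMonoid.of m ^ n) = List.replicate n m := by
  induction n with
  | zero => rfl
  | succ n ih =>
    rw [pow_succ', FreeMonoid.toList_mul, ih, FreeMonoid.toList_of, List.replicate_succ]
    rfl

theorem eq_pow_of_forall_mem {m : ℕ} {u : Word} (h : ∀ a ∈ FreeMonoid.toList u, a = m) :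
    ∃ i, u = FreeMonoid.of m ^ i := by
  refine ⟨(FreeMonoid.toList u).length, FreeMonoid.toList.injective ?_⟩
  rw [toList_of_pow]
  exact List.eq_replicate_iff.2 ⟨rfl, h⟩

theorem commute_of_forall_mem {m : ℕ} {u v : Word} (hu : ∀ a ∈ FreeMonoid.toList u, a = m)
    (hv : ∀ a ∈ FreeMonoid.toList v, a = m) : u * v = v * u := by
  obtain ⟨i, rfl⟩ := eq_pow_of_forall_mem hu
  obtain ⟨j, rfl⟩ := eq_pow_of_forall_mem hv
  exact (Commute.pow_pow_self _ i j).eq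

/-! ### Scattered subwords -/

/-- The word `u` is a scattered subword of `v`. -/
def Sub (u v : Word) : Prop := (FreeMonoid.toList u).Sublist (FreeMonoid.toList v)

instance (u v : Word) : Decidable (Sub u v) :=
  inferInstanceAs (Decidable ((FreeMonoid.toList u).Sublist (FreeMonoid.toList v)))

theorem Sub.refl (u : Word) : Sub u u := List.Sublist.refl _

theorem Sub.trans {u v w : Word} (h : Sub u v) (h' : Sub v w) : Sub u w :=
  List.Sublist.trans h h'

theorem Sub.mul {u u' v v' : Word} (h : Sub u u') (h' : Sub v v') : Sub (u * v) (u' * v') := by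
  unfold Sub
  rw [FreeMonoid.toList_mul, FreeMonoid.toList_mul]
  exact List.Sublist.append h h'

theorem one_sub (u : Word) : Sub 1 u := List.nil_sublist _

theorem Sub.of_context {u v : Word} (h : Sub u v) (a b : Word) : Sub u (a * v * b) := by
  simpa using ((one_sub a).mul h).mul (one_sub b)

theorem of_sub_iff {a : ℕ} {u : Word} : Sub (FreeMonoid.of a) u ↔ 1 ≤ occ a u := by
  rw [← mem_iff_occ]
  exact List.singleton_sublist

theorem Sub.occ_le {u v : Word} (h : Sub u v) (a : ℕ) : occ a u ≤ occ a v :=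
  List.Sublist.count_le a h

theorem Sub.lift_mono {φ ψ : ℕ → Word} (h : ∀ i, Sub (φ i) (ψ i)) (u : Word) :
    Sub (FreeMonoid.lift φ u) (FreeMonoid.lift ψ u) := by
  induction u using FreeMonoid.inductionOn' with
  | one => simpa using Sub.refl 1
  | of_mul b u ih =>
    rw [map_mul, map_mul, FreeMonoid.lift_eval_of, FreeMonoid.lift_eval_of]
    exact (h b).mul ih

theorem Sub.lift {u v : Word} (h : Sub u v) (φ : ℕ → Word) :
    Sub (FreeMonoid.lift φ u) (FreeMonoid.lift φ v) := by
  unfold Sub at h ⊢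
  rw [toList_lift, toList_lift]
  exact h.flatMap _

theorem exists_eq_of_occ {k : ℕ} {p : Word} (h : 1 ≤ occ k p) :
    ∃ a b, p = a * FreeMonoid.of k * b ∧ occ k a = 0 := by
  obtain ⟨a, b, h1, h2⟩ := List.eq_append_cons_of_mem (mem_iff_occ.2 h)
  refine ⟨FreeMonoid.ofList a, FreeMonoid.ofList b, FreeMonoid.toList.injective ?_, ?_⟩
  · simpa using h1
  · simpa [occ, List.count_eq_zero] using h2

/-- The letter `k` has a single occurrence in `p`, so both embeddings use it: `f` goes before it and
`g` after it. -/
theorem Sub.glue {k : ℕ} {p f g : Word} (hk : occ k p = 1) (hf : Sub (f * FreeMonoid.of k) p)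
    (hg : Sub (FreeMonoid.of k * g) p) : Sub (f * FreeMonoid.of k * g) p := by
  obtain ⟨a, b, rfl, ha⟩ := exists_eq_of_occ hk.ge
  have hb : occ k b = 0 := by simp [occ_mul, occ_of] at hk; omega
  have ha' : k ∉ FreeMonoid.toList a := by rw [mem_iff_occ]; omega
  have hb' : k ∉ FreeMonoid.toList b := by rw [mem_iff_occ]; omega
  unfold Sub at *
  simp only [FreeMonoid.toList_mul, FreeMonoid.toList_of, List.append_assoc,
    List.singleton_append] at *
  have h1 : (FreeMonoid.toList f).Sublist (FreeMonoid.toList a) := by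
    obtain ⟨l1, l2, h1, h2, h3⟩ := List.sublist_append_iff.1 hf
    rcases List.append_eq_append_iff.1 h1 with ⟨c, hc1, hc2⟩ | ⟨c, hc1, hc2⟩
    · rw [hc1] at h2
      exact (List.sublist_append_left _ _).trans h2
    · cases c with
      | nil => rw [hc1]; simpa using h2
      -- Otherwise the final `k` of `f * k` would be matched beyond the only occurrence of `k`.
      | cons d c =>
        rw [hc1]
        have : l2 = d :: c ++ [k] := hc2
        rw [this, List.cons_append] at h3
        exfalso
        rcases List.sublist_cons_iff.1 h3 with h4 | ⟨r, h4, h5⟩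
        · exact hb' (h4.subset (by simp))
        · obtain ⟨-, rfl⟩ := List.cons_eq_cons.1 h4
          exact hb' (h5.subset (by simp))
  have h2 : (FreeMonoid.toList g).Sublist (FreeMonoid.toList b) := by
    obtain ⟨l1, l2, h1, h2, h3⟩ := List.sublist_append_iff.1 hg
    cases l1 with
    | nil =>
      rw [List.nil_append] at h1
      rw [← h1] at h3
      simpa using h3
    | cons d l1 =>
      obtain ⟨rfl, -⟩ := List.cons_eq_cons.1 h1
      exact absurd (h2.subset (by simp)) ha'
  exact h1.append (h2.cons_cons k)

/-! ### Patterns forced by substitution instances -/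

/-- A simple letter `k` of `p = a φ(e) b` occurs in `a`, in `b` or in the image of some letter. -/
theorem exists_mem_of_occ {φ : ℕ → Word} {k : ℕ} {e : Word}
    (h : 1 ≤ occ k (FreeMonoid.lift φ e)) :
    ∃ c ∈ FreeMonoid.toList e, 1 ≤ occ k (φ c) := by
  rw [← mem_iff_occ, toList_lift, List.mem_flatMap] at h
  simpa only [mem_iff_occ] using h

/-- The substitution sending the letters `0`, `1`, `c` to the letters `α`, `β`, `k` and erasing
the others. -/
def probe (α β c k : ℕ) (i : ℕ) : Word :=
  if i = 0 then FreeMonoid.of α else if i = 1 then FreeMonoid.of β else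
    if i = c then FreeMonoid.of k else 1

/-- The subwords one of which occurs in `a φ(e) b` whenever the images of the letters `0` and `1`
contain the letters `α` and `β`, and the letter `k` occurs outside of these images. -/
def patterns (e : Word) (k α β : ℕ) : List Word :=
  -- With `c = 0` the test for `c` in `probe` is never reached, so here `k` stands only outside the
  -- instance.
  (FreeMonoid.of k * FreeMonoid.lift (probe α β 0 k) e) ::
  (FreeMonoid.lift (probe α β 0 k) e * FreeMonoid.of k) ::
  ((FreeMonoid.toList e).filter (2 ≤ ·)).map fun c => FreeMonoid.lift (probe α β c k) e

/-- Every pattern contains one of the words from `F` as a subword. -/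
def Blocked (F : List Word) (k : ℕ) (e : Word) : Prop :=
  (∀ q ∈ patterns e k 0 1, ∃ f ∈ F, Sub f q) ∧ ∀ q ∈ patterns e k 1 0, ∃ f ∈ F, Sub f q

instance (F : List Word) (k : ℕ) (e : Word) : Decidable (Blocked F k e) :=
  inferInstanceAs (Decidable (_ ∧ _))

theorem exists_pattern_sub {φ : ℕ → Word} {a b e : Word} {k α β : ℕ}
    (hα : 1 ≤ occ α (φ 0)) (hβ : 1 ≤ occ β (φ 1)) (h0 : 2 ≤ occ 0 e) (h1 : 2 ≤ occ 1 e)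
    (hk : occ k (a * FreeMonoid.lift φ e * b) = 1) :
    ∃ q ∈ patterns e k α β, Sub q (a * FreeMonoid.lift φ e * b) := by
  have base : ∀ c, (c = 0 ∨ 1 ≤ occ k (φ c)) → ∀ i, Sub (probe α β c k i) (φ i) := by
    intro c hc i
    unfold probe
    split_ifs with h h' h''
    · subst h; exact of_sub_iff.2 hα
    · subst h'; exact of_sub_iff.2 hβ
    · subst h''
      exact of_sub_iff.2 (hc.resolve_left h)
    · exact one_sub _
  rw [occ_mul, occ_mul] at hk
  rcases (show 1 ≤ occ k a ∨ 1 ≤ occ k b ∨ 1 ≤ occ k (FreeMonoid.lift φ e) by omega)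
    with h | h | h
  · refine ⟨_, List.mem_cons_self, ?_⟩
    simpa using ((of_sub_iff.2 h).mul (Sub.lift_mono (base 0 (Or.inl rfl)) e)).mul (one_sub b)
  · refine ⟨_, List.mem_cons_of_mem _ List.mem_cons_self, ?_⟩
    simpa using ((one_sub a).mul (Sub.lift_mono (base 0 (Or.inl rfl)) e)).mul (of_sub_iff.2 h)
  · obtain ⟨c, hc, hck⟩ := exists_mem_of_occ h
    -- The letters `0` and `1` are multiple in `e`, so their images cannot contain the simple letter
    -- `k`.
    have h2 : 2 ≤ c := by
      have := mul_occ_le_occ_lift φ k c e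
      by_contra hlt
      rcases (show c = 0 ∨ c = 1 by omega) with rfl | rfl
      · nlinarith
      · nlinarith
    refine ⟨_, List.mem_cons_of_mem _ (List.mem_cons_of_mem _ (List.mem_map.2
      ⟨c, List.mem_filter.2 ⟨hc, by simpa using h2⟩, rfl⟩)), ?_⟩
    exact (Sub.lift_mono (base c (Or.inr hck)) e).of_context a b

/-- If the word `a φ(e) b` avoids the subwords from `F`, which block all patterns, then the images
of the letters `0` and `1` commute. -/
theorem commute_of_blocked {φ : ℕ → Word} {p a b e : Word} {k : ℕ} {F : List Word}
    (hp : p = a * FreeMonoid.lift φ e * b) (hm : ∀ c, 2 ≤ occ c p → c = 0 ∨ c = 1)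
    (hk : occ k p = 1) (h0 : 2 ≤ occ 0 e) (h1 : 2 ≤ occ 1 e) (hF : ∀ f ∈ F, ¬ Sub f p)
    (hB : Blocked F k e) : φ 0 * φ 1 = φ 1 * φ 0 := by
  subst hp
  have key : ∀ i, 2 ≤ occ i e → ∀ c ∈ FreeMonoid.toList (φ i), c = 0 ∨ c = 1 := by
    intro i hi c hc
    refine hm c ?_
    rw [mem_iff_occ] at hc
    have := mul_occ_le_occ_lift φ c i e
    rw [occ_mul, occ_mul]
    nlinarith
  have no : ∀ α β, (∀ q ∈ patterns e k α β, ∃ f ∈ F, Sub f q) → 1 ≤ occ α (φ 0) →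
      1 ≤ occ β (φ 1) → False := by
    intro α β h hα hβ
    obtain ⟨q, hq, hs⟩ := exists_pattern_sub (a := a) (b := b) hα hβ h0 h1 hk
    obtain ⟨f, hf, hfq⟩ := h q hq
    exact hF f hf (hfq.trans hs)
  -- By `no1` and `no2`, the letters `0` and `1` are never split between `φ 0` and `φ 1`. Hence one
  -- image is empty or both are powers of the same letter.
  have no1 := no 0 1 hB.1
  have no2 := no 1 0 hB.2
  by_cases hx : 1 ≤ occ 0 (φ 0)
  · have hy : ∀ c ∈ FreeMonoid.toList (φ 1), c = 0 := fun c hc =>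
      (key 1 h1 c hc).resolve_right (by rintro rfl; exact no1 hx (mem_iff_occ.1 hc))
    by_cases hx' : 1 ≤ occ 1 (φ 0)
    · have hy' : ∀ c ∈ FreeMonoid.toList (φ 1), c ≠ 0 := by
        rintro c hc rfl; exact no2 hx' (mem_iff_occ.1 hc)
      have : FreeMonoid.toList (φ 1) = [] :=
        List.eq_nil_iff_forall_not_mem.2 fun c hc => hy' c hc (hy c hc)
      rw [FreeMonoid.toList.injective (this.trans FreeMonoid.toList_one.symm)]
      simp
    · exact commute_of_forall_mem (fun c hc => (key 0 h0 c hc).resolve_right (by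
        rintro rfl; exact hx' (mem_iff_occ.1 hc))) hy
  · have hx0 : ∀ c ∈ FreeMonoid.toList (φ 0), c = 1 := fun c hc =>
      (key 0 h0 c hc).resolve_left (by rintro rfl; exact hx (mem_iff_occ.1 hc))
    by_cases hx' : 1 ≤ occ 1 (φ 0)
    · exact commute_of_forall_mem hx0 fun c hc =>
        (key 1 h1 c hc).resolve_left (by
          rintro rfl; exact no2 hx' (mem_iff_occ.1 hc))
    · have : FreeMonoid.toList (φ 0) = [] :=
        List.eq_nil_iff_forall_not_mem.2 fun c hc => hx' (hx0 c hc ▸ mem_iff_occ.1 hc)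
      rw [FreeMonoid.toList.injective (this.trans FreeMonoid.toList_one.symm)]
      simp

/-! ### Congruences preserving the simple and the multiple letters -/

/-- The congruence `α` preserves the content and the simple letters of words. -/
def Keeps (α : Con Word) : Prop := ∀ p q, α p q → ∀ a, min (occ a p) 2 = min (occ a q) 2

theorem Keeps.mono {α β : Con Word} (h : ∀ p q, α p q → β p q) (hβ : Keeps β) : Keeps α :=
  fun p q hpq => hβ p q (h p q hpq)

theorem keeps_bot : Keeps ⊥ := by
  intro p q h a
  rw [show p = q from h]

theorem keeps_gam : Keeps gam := by
  rintro p q ⟨h1, h2⟩ a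
  have e1 : occ a p = 1 ↔ occ a q = 1 := Set.ext_iff.1 h1 a
  have e3 : occ a p = 0 ↔ occ a q = 0 := by rw [occ_eq_zero, occ_eq_zero, h2]
  omega

theorem keeps_lam : Keeps lam := keeps_gam.mono fun _ _ h => h.1

theorem occ_reverse (a : ℕ) (p : Word) : occ a p.reverse = occ a p := by
  unfold occ
  exact List.count_reverse

theorem keeps_dualCon {α : Con Word} (h : Keeps α) : Keeps (dualCon α) := by
  intro p q hpq a
  rw [← occ_reverse, ← occ_reverse a q]
  exact h _ _ hpq a

/-- Send `a` to a simple letter `k` of `w` and erase all other letters. Put in place of `k` in `w`,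
the image detects whether `a` is simple; put next to `k`, it detects whether `a` is absent. -/
theorem keeps_FIC_varMα {α : Con Word} (hα : Keeps α) {w : Word} {k : ℕ} (hk : occ k w = 1) :
    Keeps (FIC (varMα α w)) := by
  have key : ∀ p q, FIC (varMα α w) p q → ∀ a,
      (occ a p = 0 → occ a q = 0) ∧ (occ a p = 1 → occ a q = 1) := by
    intro p q h a
    obtain ⟨b, c, rfl, hb⟩ := exists_eq_of_occ hk.ge
    have hc : occ k c = 0 := by simp [occ_mul, occ_of] at hk; omega
    constructor
    · intro h0
      have h1 := class_of_FIC h (fun i => if i = a then FreeMonoid.of k else 1)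
        (b * FreeMonoid.of k * c) 1
      simp only [lift_single, h0, pow_zero, mul_one] at h1
      have := hα _ _ (h1 (α.refl _)) k
      simp only [occ_mul, occ_of, occ_pow, if_true] at this
      omega
    · intro h0
      have h1 := class_of_FIC h (fun i => if i = a then FreeMonoid.of k else 1) b c
      simp only [lift_single, h0, pow_one] at h1
      have := hα _ _ (h1 (α.refl _)) k
      simp only [occ_mul, occ_of, occ_pow, if_true] at this
      omega
  intro p q h a
  have h1 := key p q h a
  have h2 := key q p ((FIC _).symm h) a
  omega

theorem Keeps.of_divides {α : Con Word} (hα : Keeps α) {w u : Word} {φ : ℕ → Word}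
    (h : Divides α w (FreeMonoid.lift φ u)) {c a : ℕ} (hc : 2 ≤ occ c u)
    (ha : a ∈ FreeMonoid.toList (φ c)) : 2 ≤ occ a w := by
  obtain ⟨b, d, h⟩ := h
  have h1 := hα _ _ h a
  have h2 := mul_occ_le_occ_lift φ a c u
  rw [mem_iff_occ] at ha
  rw [occ_mul, occ_mul] at h1
  have : 2 ≤ occ c u * occ a (φ c) := by nlinarith
  omega

/-- The words `u` and `v` have the same value under all substitutions for which the images of the
letters `0` and `1` commute. -/
def SwapEquiv (u v : Word) : Prop := ∀ φ : ℕ → Word, φ 0 * φ 1 = φ 1 * φ 0 →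
  FreeMonoid.lift φ u = FreeMonoid.lift φ v

/-- If `0` is the only multiple letter of `w`, then multiple letters may be permuted in the
identities of `𝐌_α(w)`. -/
theorem FIC_of_swapEquiv {α : Con Word} (hα : Keeps α) {w u v : Word}
    (hw : ∀ a ∈ FreeMonoid.toList w, 2 ≤ occ a w → a = 0) (hs : SwapEquiv u v)
    (hu : 2 ≤ occ 0 u ∧ 2 ≤ occ 1 u) (hv : 2 ≤ occ 0 v ∧ 2 ≤ occ 1 v) :
    FIC (varMα α w) u v := by
  have hw' : ∀ a, 2 ≤ occ a w → a = 0 := fun a ha => hw a (mem_iff_occ.2 (by omega)) ha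
  refine FIC_varMα_of fun φ h => ?_
  rw [hs φ]
  · exact α.refl _
  · rcases h with h | h
    · exact commute_of_forall_mem (fun a ha => hw' a (hα.of_divides h hu.1 ha))
        fun a ha => hw' a (hα.of_divides h hu.2 ha)
    · exact commute_of_forall_mem (fun a ha => hw' a (hα.of_divides h hv.1 ha))
        fun a ha => hw' a (hα.of_divides h hv.2 ha)

/-- The main case of the criterion `nonmodular_of`: the varieties `A = 𝐌_α(w)`, where `w` has one
multiple letter, and `B`; the words `u` and `v`, as well as `e₁` and `e₂`, differ by a permutation
of occurrences of the letters `0` and `1`. -/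
theorem nonmodular_of_swap {α : Con Word} {w : Word} {B : Variety} {u v e₁ e₂ : Word}
    (k : ℕ) (F : List Word) (hα : Keeps α) {m : ℕ} (hm : occ m w = 1)
    (hw : ∀ a ∈ FreeMonoid.toList w, 2 ≤ occ a w → a = 0)
    (huv : SwapEquiv u v) (he : SwapEquiv e₁ e₂)
    (hB₁ : FIC B u e₁) (hB₂ : FIC B v e₂) (hV : ¬ FIC B u v)
    (hF : ∀ p, FIC (varMα α w) u p → FIC B u p → ∀ f ∈ F, ¬ Sub f p)
    (hk : occ k u = 1) (hu : ∀ a ∈ FreeMonoid.toList u, 2 ≤ occ a u → a = 0 ∨ a = 1)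
    (ho : (2 ≤ occ 0 u ∧ 2 ≤ occ 1 u) ∧ (2 ≤ occ 0 v ∧ 2 ≤ occ 1 v) ∧
      (2 ≤ occ 0 e₁ ∧ 2 ≤ occ 1 e₁) ∧ (2 ≤ occ 0 e₂ ∧ 2 ≤ occ 1 e₂))
    (h₁ : Blocked F k e₁) (h₂ : Blocked F k e₂) :
    HasNonmodularSubvarietyLattice (varMα α w ⊔ B) := by
  refine nonmodular_of (FIC_of_swapEquiv hα hw he ho.2.2.1 ho.2.2.2)
    (FIC_of_swapEquiv hα hw huv ho.1 ho.2.1) (inf_le_of_FIC hB₁ hB₂)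
    (fun h => hV (FIC_sup.1 h).2) fun p hp φ a b h => he φ ?_
  obtain ⟨hpA, hpB⟩ := FIC_sup.1 hp
  have hkeep := keeps_FIC_varMα hα hm _ _ hpA
  have hkp : occ k p = 1 := by have := hkeep k; omega
  have hmp : ∀ c, 2 ≤ occ c p → c = 0 ∨ c = 1 := by
    intro c hc
    have := hkeep c
    exact hu c (mem_iff_occ.2 (by omega)) (by omega)
  rcases h with h | h
  · exact commute_of_blocked h hmp hkp ho.2.2.1.1 ho.2.2.1.2 (hF p hpA hpB) h₁
  · exact commute_of_blocked h hmp hkp ho.2.2.2.1 ho.2.2.2.2 (hF p hpA hpB) h₂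

/-- Subwords avoided in a class are avoided, up to a substitution, in words equal in `𝐌_α(w)`. -/
theorem not_sub_of_class {α : Con Word} {w u p f : Word} (h : FIC (varMα α w) u p)
    (φ : ℕ → Word) (a b : Word) (hu : α w (a * FreeMonoid.lift φ u * b))
    (hf : ∀ q, α w q → ¬ Sub (a * FreeMonoid.lift φ f * b) q) : ¬ Sub f p := fun hs =>
  hf _ (class_of_FIC h φ a b hu) (((Sub.refl a).mul (hs.lift φ)).mul (Sub.refl b))

/-! ### The varieties `𝐌(w)` -/

/-- A letter occurring more often than any letter of `w` may be erased in the identities of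
`𝐌(w)`. -/
theorem FIC_varM_of_erase {w u v : Word} (c n : ℕ) (hw : ∀ a ∈ FreeMonoid.toList w, occ a w ≤ n)
    (hu : n < occ c u) (hv : n < occ c v)
    (h : ∀ φ : ℕ → Word, φ c = 1 → FreeMonoid.lift φ u = FreeMonoid.lift φ v) :
    FIC (varM w) u v := by
  rw [varM_eq]
  -- A letter in the image of `c` would occur more than `n` times in `w`.
  have key : ∀ (φ : ℕ → Word) (p : Word), n < occ c p → Divides ⊥ w (FreeMonoid.lift φ p) →
      φ c = 1 := by
    rintro φ p hp ⟨a, b, hab⟩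
    have hab' : w = a * FreeMonoid.lift φ p * b := hab
    refine FreeMonoid.toList.injective (List.eq_nil_iff_forall_not_mem.2 fun d hd => ?_)
    rw [mem_iff_occ] at hd
    have h1 := mul_occ_le_occ_lift φ d c p
    have h2 : occ d w = occ d a + occ d (FreeMonoid.lift φ p) + occ d b := by
      conv_lhs => rw [hab']
      rw [occ_mul, occ_mul]
    have h3 : occ c p ≤ occ c p * occ d (φ c) := Nat.le_mul_of_pos_right _ hd
    have := hw d (mem_iff_occ.2 (by omega))
    omega
  refine FIC_varMα_of fun φ hd => ?_
  rw [h φ]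
  · exact (⊥ : Con Word).refl _
  · rcases hd with hd | hd
    · exact key φ u hu hd
    · exact key φ v hv hd

/-- The word xyx has no nonempty square as a factor: the repeated letter would be x, and the single
y would lie to one side of both copies. So only trivial instances of either side divide xyx. -/
theorem FIC_xyx_sq : FIC (varM (x * y * x)) (x ^ 2) (x ^ 3) := by
  rw [varM_eq]
  have key : ∀ X a b : Word, x * y * x = a * (X * X) * b → X = 1 := by
    intro X a b h
    refine FreeMonoid.toList.injective (List.eq_nil_iff_forall_not_mem.2 fun d hd => ?_)
    rw [mem_iff_occ] at hd
    have h1 : ∀ c, occ c (x * y * x) = occ c a + (occ c X + occ c X) + occ c b := by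
      intro c
      rw [h, occ_mul, occ_mul, occ_mul]
    have h0 : d = 0 := by
      have := h1 d
      simp only [x, y, occ_mul, occ_of] at this
      split_ifs at this <;> omega
    subst h0
    have h2 := h1 1
    rw [show occ 1 (x * y * x) = 1 from rfl] at h2
    have hX : Sub (x * x) (X * X) := (of_sub_iff.2 hd).mul (of_sub_iff.2 hd)
    rcases (show 1 ≤ occ 1 a ∨ 1 ≤ occ 1 b by omega) with h3 | h3
    · have : Sub (y * (x * x) * 1) (x * y * x) := by
        rw [h]; exact ((of_sub_iff.2 h3).mul hX).mul (one_sub b)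
      revert this; decide
    · have : Sub (1 * (x * x) * y) (x * y * x) := by
        rw [h]; exact ((one_sub a).mul hX).mul (of_sub_iff.2 h3)
      revert this; decide
  refine FIC_varMα_of fun φ hd => ?_
  have : φ 0 = 1 := by
    rcases hd with ⟨a, b, h⟩ | ⟨a, b, h⟩
    · refine key (φ 0) a b ?_
      have h' : x * y * x = _ := h
      simpa [x, pow_succ] using h'
    · refine key (φ 0) a (φ 0 * b) ?_
      have h' : x * y * x = _ := h
      rw [h']
      simp [x, pow_succ, mul_assoc]
  simp only [x, map_pow, FreeMonoid.lift_eval_of, this, one_pow]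
  exact (⊥ : Con Word).refl _

/-- The substitution erasing all letters except `a` and `b`, which become `0` and `1`. -/
def two (a b i : ℕ) : Word := if i = a then x else if i = b then y else 1

/-- For the equality relation the class of xyx is a singleton, so the value of `p` is forced. -/
theorem FIC_xyx_pin {u p : Word} (h : FIC (varM (x * y * x)) u p) (φ : ℕ → Word)
    (hu : FreeMonoid.lift φ u = x * y * x) : FreeMonoid.lift φ p = x * y * x := by
  rw [varM_eq] at h
  have h1 := class_of_FIC h φ 1 1 (by rw [hu]; exact (⊥ : Con Word).refl _)
  simpa using (show x * y * x = _ from h1).symm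

/-- If `𝐌(xyx)` satisfies `u ≈ p` and `u` restricted to `a`, `b` is `aba`, then so is `p`. -/
theorem FIC_xyx_avoid {u p : Word} (h : FIC (varM (x * y * x)) u p) (a b : ℕ)
    (hu : FreeMonoid.lift (two a b) u = x * y * x) {f : Word}
    (hf : ¬ Sub (FreeMonoid.lift (two a b) f) (x * y * x)) : ¬ Sub f p := fun hs => by
  have := hs.lift (two a b)
  rw [FIC_xyx_pin h _ hu] at this
  exact hf this

/-! ### The congruences `γ` and `λ` -/

theorem gam_of {u v : Word} (h : squash u = squash v)
    (h' : ∀ a ∈ FreeMonoid.toList u, occ a u = 1 ↔ occ a v = 1) : gam u v := by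
  refine ⟨Set.ext fun a => ?_, h⟩
  by_cases ha : a ∈ FreeMonoid.toList u
  · exact h' a ha
  · have h1 : occ a u = 0 := List.count_eq_zero.2 ha
    have h2 : occ a v = 0 := by rwa [occ_eq_zero, ← h, ← occ_eq_zero]
    simp [sim, h1, h2]

instance (a : ℕ) (w : Word) : Decidable (FirstTwoAdjacent a w) :=
  inferInstanceAs (Decidable ([a, a] <+: (FreeMonoid.toList w).dropWhile (· != a)))

theorem lam_of {u v : Word} (h : squash u = squash v)
    (h' : ∀ a ∈ FreeMonoid.toList u, (occ a u = 1 ↔ occ a v = 1) ∧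
      (FirstTwoAdjacent a u ↔ FirstTwoAdjacent a v)) : lam u v :=
  ⟨gam_of h fun a ha => (h' a ha).1, fun a ha => (h' a (mem_iff_occ.2 (by omega))).2⟩

theorem sqStep_sublist (a : ℕ) (l : List ℕ) : l.Sublist (sqStep a l) := by
  unfold sqStep
  split_ifs
  · exact List.Sublist.refl _
  · exact List.sublist_cons_self a l

theorem sqStep_mono (a : ℕ) {l m : List ℕ} (h : l.Sublist m) :
    (sqStep a l).Sublist (sqStep a m) := by
  by_cases hl : l.head? = some a
  · rw [show sqStep a l = l from if_pos hl]
    exact h.trans (sqStep_sublist a m)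
  · rw [show sqStep a l = a :: l from if_neg hl]
    by_cases hm : m.head? = some a
    · rw [show sqStep a m = m from if_pos hm]
      cases m with
      | nil => simp at hm
      | cons b m =>
        obtain rfl : b = a := by simpa using hm
        -- As `l` does not begin with `a`, it embeds into the tail of the longer list, which leaves
        -- the head free for the new `a`.
        rcases List.sublist_cons_iff.1 h with h | ⟨r, rfl, -⟩
        · exact h.cons_cons b
        · simp at hl
    · rw [show sqStep a m = a :: m from if_neg hm]
      exact h.cons_cons a

/-- Adding a letter on the left never removes anything from the reduced form, and `sqStep` is
monotone. Forbidden subwords of a γ-class can therefore be read off from its common reduced form. -/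
theorem Sub.squash_sublist {f p : Word} (h : Sub f p) : (squash f).Sublist (squash p) := by
  rw [squash_eq, squash_eq]
  unfold Sub at h
  generalize FreeMonoid.toList f = l at h
  generalize FreeMonoid.toList p = m at h
  induction h with
  | slnil => exact List.Sublist.refl _
  | cons a _ ih => exact ih.trans (sqStep_sublist a _)
  | cons_cons a _ ih => exact sqStep_mono a ih

theorem not_sub_of_squash {w p f : Word} (h : squash w = squash p)
    (hf : ¬ (squash f).Sublist (squash w)) : ¬ Sub f p := fun hs => hf (h ▸ hs.squash_sublist)

/-- If the first two occurrences of the multiple letter `a` are not adjacent, then the power `aa`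
of a subword `aab` is not squashed. -/
theorem not_sub_of_lam {w p : Word} (h : lam w p) {a b : ℕ} (ha : 2 ≤ occ a w)
    (ha' : ¬ FirstTwoAdjacent a w) (hab : a ≠ b) (hs : ¬ [a, a, b].Sublist (squash w)) :
    ¬ Sub (FreeMonoid.of a * FreeMonoid.of a * FreeMonoid.of b) p := by
  intro hsub
  rw [h.2 a ha] at ha'
  obtain ⟨c, d, rfl, hc⟩ := exists_eq_of_occ
    ((hsub.occ_le a).trans' (by simp only [occ_mul, occ_of, if_true]; omega))
  have hc' : a ∉ FreeMonoid.toList c := by rw [mem_iff_occ]; omega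
  have h1 : [a, a, b].Sublist (FreeMonoid.toList c ++ (a :: FreeMonoid.toList d)) := by
    simpa [Sub] using hsub
  have h2 : [a, b].Sublist (FreeMonoid.toList d) := by
    obtain ⟨l1, l2, e, h3, h4⟩ := List.sublist_append_iff.1 h1
    cases l1 with
    | nil =>
      rw [List.nil_append] at e
      subst e
      exact List.cons_sublist_cons.1 h4
    | cons i l1 =>
      obtain ⟨rfl, -⟩ := List.cons_eq_cons.1 e
      exact absurd (h3.subset (by simp)) hc'
  have h5 : ¬ [a, a] <+: a :: FreeMonoid.toList d := by
    intro hp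
    apply ha'
    unfold FirstTwoAdjacent
    rw [show FreeMonoid.toList (c * FreeMonoid.of a * d) =
      FreeMonoid.toList c ++ (a :: FreeMonoid.toList d) by simp, dropWhile_of_notMem hc']
    simpa using hp
  -- The letter following the first `a` differs from `a`, and keeps the two copies of `a` apart
  -- under squashing.
  obtain ⟨i, r, hr, hi⟩ : ∃ i r, FreeMonoid.toList d = i :: r ∧ i ≠ a := by
    cases hd : FreeMonoid.toList d with
    | nil => rw [hd] at h2; simp at h2
    | cons i r =>
      refine ⟨i, r, rfl, ?_⟩
      rintro rfl
      rw [hd] at h5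
      simp at h5
  have h6 : Sub (FreeMonoid.ofList [a, i, a, b]) (c * FreeMonoid.of a * d) := by
    unfold Sub
    simp only [FreeMonoid.toList_mul, FreeMonoid.toList_of, FreeMonoid.toList_ofList,
      List.append_assoc, List.singleton_append, hr] at h2 ⊢
    refine List.Sublist.trans ?_ (List.sublist_append_right _ _)
    refine List.Sublist.cons_cons a (List.Sublist.cons_cons i ?_)
    rcases List.sublist_cons_iff.1 h2 with h7 | ⟨r', h7, -⟩
    · exact h7
    · exact absurd (List.cons_eq_cons.1 h7).1.symm hi
  have h7 := h6.squash_sublist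
  rw [← h.1.2] at h7
  refine hs (List.Sublist.trans ?_ h7)
  have h8 : squash (FreeMonoid.ofList [a, i, a, b]) = [a, i, a, b] := by
    rw [squash_eq]
    simp [sqStep, hab.symm, hi, Ne.symm hi]
  rw [h8]
  exact (List.sublist_cons_self i [a, b]).cons_cons a

/-! ### Identities changing exponents -/

/-- The congruence relating the words with the same reduced form. -/
def sqCon : Con Word where
  r u v := squash u = squash v
  iseqv := ⟨fun _ => rfl, fun h => h.symm, fun h h' => h.trans h'⟩
  mul' := fun h h' => squash_mul h h'

theorem squash_pow (m i : ℕ) : sqCon (FreeMonoid.of m ^ (i + 1)) (FreeMonoid.of m) := by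
  induction i with
  | zero => rw [zero_add, pow_one]; exact sqCon.refl _
  | succ i ih =>
    rw [pow_succ]
    refine sqCon.trans (sqCon.mul ih (sqCon.refl _)) ?_
    show squash _ = squash _
    simp [squash_eq, sqStep]

/-- The doubled occurrence of `m` is not the first one, so the first two occurrences of `m` are
already in place before the doubling. -/
theorem lam_mul_self {m : ℕ} {P : Word} (h : 1 ≤ occ m P) :
    lam (P * FreeMonoid.of m) (P * FreeMonoid.of m * FreeMonoid.of m) := by
  refine ⟨⟨Set.ext fun a => ?_, ?_⟩, fun a ha => ?_⟩
  · simp only [sim, Set.mem_ofPred_eq, occ_mul, occ_of]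
    split_ifs with hm
    · subst hm; omega
    · omega
  · rw [mul_assoc]
    refine sqCon.mul (sqCon.refl P) (sqCon.symm ?_)
    simpa [pow_succ] using squash_pow m 1
  · rw [firstTwoAdjacent_mul a (P * FreeMonoid.of m) (FreeMonoid.of m)]
    constructor
    · intro h'
      exact Or.inr (Or.inr ⟨ha, h'⟩)
    · rintro (h' | h' | h')
      · omega
      · omega
      · exact h'.2

theorem lam_mul_pow {m : ℕ} {P : Word} (h : 1 ≤ occ m P) (i : ℕ) :
    lam (P * FreeMonoid.of m) (P * FreeMonoid.of m ^ (i + 1)) := by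
  induction i with
  | zero => rw [zero_add, pow_one]; exact lam.refl _
  | succ i ih =>
    refine lam.trans ih ?_
    have := lam_mul_self (m := m) (P := P * FreeMonoid.of m ^ i) (by rw [occ_mul]; omega)
    simpa only [pow_succ, mul_assoc] using this

theorem lam_mul_sq {P X : Word} {m : ℕ} (hX : ∀ a ∈ FreeMonoid.toList X, a = m)
    (hP : X = 1 ∨ 1 ≤ occ m P) : lam (P * X) (P * X ^ 2) := by
  obtain ⟨i, rfl⟩ := eq_pow_of_forall_mem hX
  rcases i with _ | i
  · simpa using lam.refl P
  · have hP : 1 ≤ occ m P := by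
      rcases hP with hP | hP
      · have := congrArg (occ m) hP
        simp [occ_pow, occ_of, occ_one] at this
      · exact hP
    rw [← pow_mul, show (i + 1) * 2 = (2 * i + 1) + 1 by ring]
    exact lam.trans (lam.symm (lam_mul_pow hP i)) (lam_mul_pow hP _)

/-- Squaring an occurrence of the letter `0` other than the first one is a `λ`-equivalence, if the
image of this letter is a power of a letter. -/
theorem lam_lift_sq {c d : Word} (hc : 1 ≤ occ 0 c) {φ : ℕ → Word} {m : ℕ}
    (hm : ∀ a ∈ FreeMonoid.toList (φ 0), a = m) :
    lam (FreeMonoid.lift φ (c * x * d)) (FreeMonoid.lift φ (c * x ^ 2 * d)) := by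
  simp only [map_mul, map_pow, x, FreeMonoid.lift_eval_of]
  refine lam.mul (lam_mul_sq hm ?_) (lam.refl _)
  by_cases h : φ 0 = 1
  · exact Or.inl h
  · refine Or.inr ?_
    have h1 : 1 ≤ occ m (φ 0) := by
      by_contra h2
      refine h (FreeMonoid.toList.injective (List.eq_nil_iff_forall_not_mem.2 fun a ha => h2 ?_))
      have h3 := hm a ha
      subst h3
      exact mem_iff_occ.1 ha
    exact (Nat.mul_le_mul hc h1).trans (mul_occ_le_occ_lift φ m 0 c)

/-! ### Identities of the varieties 𝐌_λ'(w), 𝐌_γ'(w) and 𝐌_λ(w) -/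

theorem sub_cube_iff {a : ℕ} {p : Word} :
    Sub (FreeMonoid.of a * FreeMonoid.of a * FreeMonoid.of a) p ↔ 3 ≤ occ a p :=
  List.replicate_sublist_iff (n := 3)

/-- The letter `0` is the only one which may occur more than twice in the words equal to `w` in
`𝐌(xyx)`, if it is the only multiple letter apart from `1`, and `w` restricted to `1` and `k`
is `1k1`. -/
theorem eq_zero_of_pinned {w q : Word} (k : ℕ) (hk : FreeMonoid.lift (two 1 k) w = x * y * x)
    (hw : ∀ a ∈ FreeMonoid.toList w, 2 ≤ occ a w → a = 0 ∨ a = 1)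
    (h : FIC (varM (x * y * x)) w q) (a : ℕ) (ha : 3 ≤ occ a q) : a = 0 := by
  have hk' := keeps_FIC_varMα keeps_bot (w := x * y * x) (k := 1) rfl w q (by rwa [← varM_eq]) a
  refine (hw a (mem_iff_occ.2 (by omega)) (by omega)).resolve_right ?_
  rintro rfl
  refine FIC_xyx_avoid h 1 k hk (f := FreeMonoid.of 1 * FreeMonoid.of 1 * FreeMonoid.of 1) ?_
    (sub_cube_iff.2 ha)
  simp only [map_mul, FreeMonoid.lift_eval_of, two, if_true]
  decide

/-- A letter in the image of `0` occurs at least three times in some word of the class of `w`, and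
there only `0` may do so. -/
theorem forall_mem_of_divides {α : Con Word} {w u : Word} {φ : ℕ → Word}
    (hq : ∀ q, α w q → ∀ a, 3 ≤ occ a q → a = 0) (hu : 3 ≤ occ 0 u)
    (h : Divides α w (FreeMonoid.lift φ u)) : ∀ a ∈ FreeMonoid.toList (φ 0), a = 0 := by
  intro a ha
  obtain ⟨b, c, h⟩ := h
  refine hq _ h a ?_
  have h1 := mul_occ_le_occ_lift φ a 0 u
  rw [mem_iff_occ] at ha
  rw [occ_mul, occ_mul]
  nlinarith

/-- In an instance dividing `w` the image of x is a power of x, so doubling a later occurrence is a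
λ-equivalence; `hM` supplies the component of λ' from 𝐌(xyx). -/
theorem FIC_varMα_lam' {w c d : Word} (k : ℕ)
    (hk : FreeMonoid.lift (two 1 k) w = x * y * x)
    (hw : ∀ a ∈ FreeMonoid.toList w, 2 ≤ occ a w → a = 0 ∨ a = 1)
    (hc : 1 ≤ occ 0 c) (hu : 3 ≤ occ 0 (c * x * d))
    (hM : FIC (varM (x * y * x)) (c * x * d) (c * x ^ 2 * d)) :
    FIC (varMα lam' w) (c * x * d) (c * x ^ 2 * d) := by
  have hu' : 3 ≤ occ 0 (c * x ^ 2 * d) := by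
    simp only [occ_mul, occ_pow] at hu ⊢
    omega
  have hq : ∀ q, lam' w q → ∀ a, 3 ≤ occ a q → a = 0 :=
    fun q h a => eq_zero_of_pinned k hk hw h.2 a
  refine FIC_varMα_of fun φ h => ⟨lam_lift_sq hc (m := 0) ?_, FIC_lift hM φ⟩
  rcases h with h | h
  · exact forall_mem_of_divides hq hu h
  · exact forall_mem_of_divides hq hu' h

/-- Simple letters: those outside `φ 0` are counted after erasing `0`, by `hE`, and those of `φ 0`
are multiple on both sides. Reduced forms: `φ 0` is a power of one letter, hence idempotent modulo
`sqCon`, and `hS` applies. In 𝐌(xyx) the letter `0`, occurring more than twice, may be erased. -/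
theorem FIC_varMα_gam' {w u v : Word} (k : ℕ)
    (hk : FreeMonoid.lift (two 1 k) w = x * y * x)
    (hw : ∀ a ∈ FreeMonoid.toList w, 2 ≤ occ a w → a = 0 ∨ a = 1)
    (hu : 3 ≤ occ 0 u) (hv : 3 ≤ occ 0 v)
    (hE : ∀ φ : ℕ → Word, φ 0 = 1 → FreeMonoid.lift φ u = FreeMonoid.lift φ v)
    (hS : ∀ φ : ℕ → sqCon.Quotient, φ 0 * φ 0 = φ 0 →
      FreeMonoid.lift φ u = FreeMonoid.lift φ v) :
    FIC (varMα gam' w) u v := by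
  have hM : FIC (varM (x * y * x)) u v :=
    FIC_varM_of_erase 0 2 (by decide) (by omega) (by omega) hE
  have hq : ∀ q, gam' w q → ∀ a, 3 ≤ occ a q → a = 0 :=
    fun q h a => eq_zero_of_pinned k hk hw h.2 a
  refine FIC_varMα_of fun φ h => ⟨⟨Set.ext fun a => ?_, ?_⟩, FIC_lift hM φ⟩
  · show occ a _ = 1 ↔ occ a _ = 1
    by_cases ha : occ a (φ 0) = 0
    · rw [← occ_lift_update ha, ← occ_lift_update ha,
        hE (Function.update φ 0 1) (Function.update_self ..)]
    · have h1 := mul_occ_le_occ_lift φ a 0 u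
      have h2 := mul_occ_le_occ_lift φ a 0 v
      have h3 : 1 ≤ occ a (φ 0) := by omega
      have : occ a (FreeMonoid.lift φ u) ≠ 1 := by nlinarith
      have : occ a (FreeMonoid.lift φ v) ≠ 1 := by nlinarith
      tauto
  · have h0 : ∀ a ∈ FreeMonoid.toList (φ 0), a = 0 := by
      rcases h with h | h
      · exact forall_mem_of_divides hq hu h
      · exact forall_mem_of_divides hq hv h
    obtain ⟨i, hi⟩ := eq_pow_of_forall_mem h0
    have key : ∀ p : Word, ((FreeMonoid.lift φ p : Word) : sqCon.Quotient) =
        FreeMonoid.lift (fun j => ((φ j : Word) : sqCon.Quotient)) p := by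
      intro p
      have := FreeMonoid.comp_lift (α := ℕ) sqCon.mk' φ
      exact DFunLike.congr_fun this p
    refine (Con.eq sqCon).1 ?_
    rw [key, key]
    refine hS _ ?_
    rw [← Con.coe_mul, Con.eq, hi]
    rcases i with _ | i
    · simpa using sqCon.refl 1
    · rw [← pow_add, show i + 1 + (i + 1) = (2 * i + 1) + 1 by ring]
      exact sqCon.trans (squash_pow 0 _) (sqCon.symm (squash_pow 0 i))

/-- λ alone does not bound numbers of occurrences, so another reason is needed why the image of x is
a power of a letter. Suppose a factor repeated in a word of the class contained both x and y. If the
simple letter t precedes the second copy, the subword tx arises; if t follows both copies, yyt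
arises. Both are excluded. -/
theorem FIC_varMα_lam {w c d : Word}
    (hw : ∀ a ∈ FreeMonoid.toList w, 2 ≤ occ a w → a = 0 ∨ a = 1) (h3 : occ 3 w = 1)
    (h1 : 2 ≤ occ 1 w) (h1' : ¬ FirstTwoAdjacent 1 w) (hs : ¬ [1, 1, 3].Sublist (squash w))
    (hs' : ¬ [3, 0].Sublist (squash w)) (hc : 1 ≤ occ 0 c) :
    FIC (varMα lam w) (c * x * d) (c * x ^ 2 * d) := by
  have key : ∀ X p₁ p₂ p₃ : Word, lam w (p₁ * X * p₂ * X * p₃) →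
      ∃ m, ∀ a ∈ FreeMonoid.toList X, a = m := by
    intro X p₁ p₂ p₃ h
    have hkeep := keeps_lam _ _ h
    have hX : ∀ a ∈ FreeMonoid.toList X, a = 0 ∨ a = 1 := by
      intro a ha
      rw [mem_iff_occ] at ha
      have := hkeep a
      simp only [occ_mul] at this
      exact hw a (mem_iff_occ.2 (by omega)) (by omega)
    by_cases h0 : 1 ≤ occ 0 X
    · refine ⟨0, fun a ha => (hX a ha).resolve_right ?_⟩
      rintro rfl
      rw [mem_iff_occ] at ha
      have hk := hkeep 3
      simp only [occ_mul] at hk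
      have sub0 := of_sub_iff.2 h0
      have sub1 := of_sub_iff.2 ha
      have no1 : ¬ Sub (FreeMonoid.of 3 * FreeMonoid.of 0) (p₁ * X * p₂ * X * p₃) :=
        not_sub_of_squash h.1.2 hs'
      have no2 := not_sub_of_lam h h1 h1' (b := 3) (by decide) hs
      rcases (show 1 ≤ occ 3 p₁ ∨ 1 ≤ occ 3 p₂ ∨ 1 ≤ occ 3 p₃ by omega) with h | h | h
      · refine no1 ?_
        simpa using (((((of_sub_iff.2 h).mul sub0).mul (one_sub p₂)).mul (one_sub X)).mul
          (one_sub p₃))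
      · refine no1 ?_
        simpa using (((((one_sub p₁).mul (one_sub X)).mul (of_sub_iff.2 h)).mul sub0).mul
          (one_sub p₃))
      · refine no2 ?_
        simpa using (((((one_sub p₁).mul sub1).mul (one_sub p₂)).mul sub1).mul
          (of_sub_iff.2 h))
    · refine ⟨1, fun a ha => (hX a ha).resolve_left ?_⟩
      rintro rfl
      exact h0 (mem_iff_occ.1 ha)
  refine FIC_varMα_of fun φ h => ?_
  suffices ∃ m, ∀ a ∈ FreeMonoid.toList (φ 0), a = m by
    obtain ⟨m, hm⟩ := this
    exact lam_lift_sq hc hm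
  obtain ⟨c₁, c₂, rfl, -⟩ := exists_eq_of_occ hc
  rcases h with ⟨a, b, h⟩ | ⟨a, b, h⟩
  · refine key (φ 0) (a * FreeMonoid.lift φ c₁) (FreeMonoid.lift φ c₂) (FreeMonoid.lift φ d * b) ?_
    simpa [x, mul_assoc] using h
  · refine key (φ 0) (a * FreeMonoid.lift φ c₁) (FreeMonoid.lift φ c₂)
      (φ 0 * FreeMonoid.lift φ d * b) ?_
    simpa [x, mul_assoc, pow_two] using h

/-! ### Sets of words saturated by the identities of a variety -/

/-- The part of `p` before the first occurrence of `k`. -/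
def before (k : ℕ) (p : Word) : List ℕ := (FreeMonoid.toList p).takeWhile (· != k)

theorem before_mul_of_mem {k : ℕ} {a : Word} (h : 1 ≤ occ k a) (b : Word) :
    before k (a * b) = before k a := by
  obtain ⟨c, d, rfl, hc⟩ := exists_eq_of_occ h
  have hc' : ∀ i ∈ FreeMonoid.toList c, (i != k) = true := by
    rintro i hi
    rw [bne_iff_ne]
    rintro rfl
    rw [mem_iff_occ] at hi
    omega
  unfold before
  simp only [FreeMonoid.toList_mul, FreeMonoid.toList_of, List.append_assoc, List.cons_append]
  rw [List.takeWhile_append_of_pos hc', List.takeWhile_append_of_pos hc']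
  simp

theorem before_mul_of_not_mem {k : ℕ} {a : Word} (h : occ k a = 0) (b : Word) :
    before k (a * b) = FreeMonoid.toList a ++ before k b := by
  have hc' : ∀ i ∈ FreeMonoid.toList a, (i != k) = true := by
    rintro i hi
    rw [bne_iff_ne]
    rintro rfl
    rw [mem_iff_occ] at hi
    omega
  unfold before
  rw [FreeMonoid.toList_mul, List.takeWhile_append_of_pos hc']

/-- The words in which `k` is simple, the word before `k` restricted to the letters of `L` is `L`,
and the numbers of occurrences of the letters of `L` satisfy the condition `C`. -/
def Pre (L : List ℕ) (k : ℕ) (C : ℕ → ℕ → Prop) : Set Word :=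
  {p | occ k p = 1 ∧ (before k p).filter (· ∈ L) = L ∧ ∀ g ∈ L, C g (occ g p)}

variable {L : List ℕ} {k : ℕ} {C : ℕ → ℕ → Prop}

theorem Pre.prefix {q b : Word} (h : q * b ∈ Pre L k C) (hq : occ k q = 0) :
    (FreeMonoid.toList q).filter (· ∈ L) <+: L := by
  have h1 := h.2.1
  rw [before_mul_of_not_mem hq, List.filter_append] at h1
  exact ⟨_, h1⟩

theorem count_filter_mem {g : ℕ} (hg : g ∈ L) (l : List ℕ) :
    (l.filter (· ∈ L)).count g = l.count g :=
  List.count_filter (by simpa using hg)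

theorem Pre.occ_le {q b : Word} (h : q * b ∈ Pre L k C) (hq : occ k q = 0) {g : ℕ}
    (hg : g ∈ L) : occ g q ≤ L.count g := by
  have := (Pre.prefix h hq).sublist.count_le g
  rwa [count_filter_mem hg] at this

theorem Pre.le_occ {q b : Word} (h : q * b ∈ Pre L k C) (hq : 1 ≤ occ k q) {g : ℕ}
    (hg : g ∈ L) : L.count g ≤ occ g q := by
  have h1 := h.2.1
  rw [before_mul_of_mem hq] at h1
  conv_lhs => rw [← h1]
  rw [count_filter_mem hg]
  exact (List.takeWhile_sublist _).count_le g

/-- The final `k` is matched to the only occurrence of `k`, so `f` embeds into the part before it,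
whose restriction to the letters of `L` is `L`. -/
theorem Pre.sub {p f : Word} (h : p ∈ Pre L k C) (hf : ∀ a ∈ FreeMonoid.toList f, a ∈ L)
    (hs : Sub (f * FreeMonoid.of k) p) : (FreeMonoid.toList f).Sublist L := by
  obtain ⟨a, b, rfl, ha⟩ := exists_eq_of_occ h.1.ge
  have hb : occ k b = 0 := by have := h.1; simp [occ_mul, occ_of] at this; omega
  have hb' : k ∉ FreeMonoid.toList b := by rw [mem_iff_occ]; omega
  have h2 := h.2.1
  rw [mul_assoc, before_mul_of_not_mem ha, before_mul_of_mem (by simp [occ_of])] at h2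
  have h3 : (FreeMonoid.toList f).Sublist (FreeMonoid.toList a) := by
    have hs' : (FreeMonoid.toList f ++ [k]).Sublist
        ((FreeMonoid.toList a ++ [k]) ++ FreeMonoid.toList b) := by simpa [Sub] using hs
    obtain ⟨l1, l2, e, h4, h5⟩ := List.sublist_append_iff.1 hs'
    have : l2 = [] := by
      rcases List.eq_nil_or_concat l2 with h6 | ⟨l3, d, rfl⟩
      · exact h6
      · exfalso
        have e' : FreeMonoid.toList f ++ [k] = (l1 ++ l3) ++ [d] := by rw [e]; simp
        have := (List.append_inj' e' rfl).2
        obtain rfl : k = d := by simpa using this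
        exact hb' (h5.subset (by simp))
    rw [this, List.append_nil] at e
    rw [← e] at h4
    exact List.append_sublist_append_right _ |>.1 h4
  have h4 := h3.filter (· ∈ L)
  have h5 : (FreeMonoid.toList f).filter (· ∈ L) = FreeMonoid.toList f :=
    List.filter_eq_self.2 (by simpa using hf)
  rw [h5] at h4
  refine h4.trans ?_
  have h6 := List.sublist_append_left ((FreeMonoid.toList a).filter (· ∈ L))
    ((before k (FreeMonoid.of k)).filter (· ∈ L))
  rw [← List.filter_append, h2] at h6
  exact h6

theorem filter_lift_update {K : List ℕ} {φ : ℕ → Word} (h : ∀ g ∈ K, occ g (φ 0) = 0)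
    (u : Word) : (FreeMonoid.toList (FreeMonoid.lift (Function.update φ 0 1) u)).filter (· ∈ K) =
      (FreeMonoid.toList (FreeMonoid.lift φ u)).filter (· ∈ K) := by
  induction u using FreeMonoid.inductionOn' with
  | one => simp
  | of_mul b u ih =>
    simp only [map_mul, FreeMonoid.lift_eval_of, FreeMonoid.toList_mul, List.filter_append, ih]
    by_cases hb : b = 0
    · subst hb
      rw [Function.update_self]
      congr 1
      symm
      simp only [FreeMonoid.toList_one, List.filter_nil, List.filter_eq_nil_iff, decide_eq_true_eq]
      intro a ha haK
      rw [mem_iff_occ, h a haK] at ha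
      omega
    · rw [Function.update_of_ne hb]

theorem filter_takeWhile (hk : k ∉ L) (l : List ℕ) : (l.takeWhile (· != k)).filter (· ∈ L) =
    ((l.filter (· ∈ k :: L)).takeWhile (· != k)).filter (· ∈ L) := by
  induction l with
  | nil => rfl
  | cons a l ih =>
    by_cases h : a = k
    · subst h; simp
    · by_cases h' : a ∈ L
      · simp [h, h', ih]
      · simp [h, h', ih]

/-- All conditions in `Pre` depend only on the restriction of a word to `k` and the letters of `L`.
-/
theorem Pre.congr (hk : k ∉ L) {p p' : Word} (h : (FreeMonoid.toList p).filter (· ∈ k :: L) =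
    (FreeMonoid.toList p').filter (· ∈ k :: L)) (hp : p ∈ Pre L k C) : p' ∈ Pre L k C := by
  have ho : ∀ g ∈ k :: L, occ g p' = occ g p := by
    intro g hg
    unfold occ
    rw [← count_filter_mem hg, ← count_filter_mem hg (FreeMonoid.toList p), h]
  refine ⟨(ho k (by simp)).trans hp.1, ?_, fun g hg => ?_⟩
  · unfold before
    rw [filter_takeWhile hk, ← h, ← filter_takeWhile hk]
    exact hp.2.1
  · rw [ho g (by simp [hg])]
    exact hp.2.2 g hg

/-- An image of `0` free of relevant letters can be erased without changing the relevant
restriction, and after erasing it the two instances coincide. -/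
theorem Pre.erase (hk : k ∉ L) {u v : Word}
    (hE : ∀ φ : ℕ → Word, φ 0 = 1 → FreeMonoid.lift φ u = FreeMonoid.lift φ v) {φ : ℕ → Word}
    {a b : Word} (h : ∀ g ∈ k :: L, occ g (φ 0) = 0)
    (hp : a * FreeMonoid.lift φ u * b ∈ Pre L k C) :
    a * FreeMonoid.lift φ v * b ∈ Pre L k C := by
  refine Pre.congr hk ?_ hp
  simp only [FreeMonoid.toList_mul, List.filter_append]
  rw [← filter_lift_update h u, ← filter_lift_update h v, hE _ (Function.update_self ..)]

/-- One direction of the saturation of the set `Pre L k C` by the identity `cl ≈ cr`, which becomes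
trivial after erasing the letter `0`: the letter `k` occurs before the images of `l` and `r`, or the
image of `0` contains none of the relevant letters. The latter follows from the numbers of
occurrences in the images of the prefixes `c₀` and `c₁` of `cl`. -/
theorem Pre.step (hk : k ∉ L) (c l r c₀ c₁ : Word) (hc₀ : ∃ d, c * l = c₀ * d)
    (hc₁ : ∃ d, c * l = c₁ * d)
    (hE : ∀ φ : ℕ → Word, φ 0 = 1 → FreeMonoid.lift φ (c * l) = FreeMonoid.lift φ (c * r))
    {φ : ℕ → Word} {a b : Word}
    (hA : occ k (a * FreeMonoid.lift φ (c * l) * b) = 1 → 1 ≤ occ k (a * FreeMonoid.lift φ c) →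
      occ k (FreeMonoid.lift φ r * b) = 0 ∧ ∀ g ∈ L, L.count g ≤ occ g (a * FreeMonoid.lift φ c) →
        C g (occ g (a * FreeMonoid.lift φ (c * l) * b)) →
        C g (occ g (a * FreeMonoid.lift φ (c * r) * b)))
    (hB : occ k (a * FreeMonoid.lift φ (c * l) * b) = 1 → occ k (a * FreeMonoid.lift φ c) = 0 →
      occ k (φ 0) = 0 ∧ ∀ g ∈ L,
        (occ k (a * FreeMonoid.lift φ c₀) = 0 → occ g (a * FreeMonoid.lift φ c₀) ≤ L.count g) →
        (1 ≤ occ k (a * FreeMonoid.lift φ c₁) → L.count g ≤ occ g (a * FreeMonoid.lift φ c₁)) →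
        C g (occ g (a * FreeMonoid.lift φ (c * l) * b)) → occ g (φ 0) = 0)
    (hp : a * FreeMonoid.lift φ (c * l) * b ∈ Pre L k C) :
    a * FreeMonoid.lift φ (c * r) * b ∈ Pre L k C := by
  -- If `k` lies in the common prefix, both sides have the same part before `k` and only the counts
  -- matter. Otherwise the image of `0` turns out to be irrelevant.
  by_cases h : 1 ≤ occ k (a * FreeMonoid.lift φ c)
  · obtain ⟨h1, h2⟩ := hA hp.1 h
    have e : ∀ d, a * FreeMonoid.lift φ (c * d) * b =
        (a * FreeMonoid.lift φ c) * (FreeMonoid.lift φ d * b) := by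
      intro d; simp only [map_mul, mul_assoc]
    have hp' := hp
    rw [e] at hp' ⊢
    have hle := fun g (hg : g ∈ L) => Pre.le_occ hp' h hg
    refine ⟨?_, ?_, fun g hg => ?_⟩
    · have := hp'.1
      rw [occ_mul] at this ⊢
      omega
    · have := hp'.2.1
      rw [before_mul_of_mem h] at this ⊢
      exact this
    · rw [← e]
      exact h2 g hg (hle g hg) (hp.2.2 g hg)
  · obtain ⟨h1, h2⟩ := hB hp.1 (by omega)
    have e : ∀ c' d, c * l = c' * d →
        (a * FreeMonoid.lift φ c') * (FreeMonoid.lift φ d * b) ∈ Pre L k C := by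
      intro c' d h
      rw [h] at hp
      simpa only [map_mul, mul_assoc] using hp
    obtain ⟨d₀, hd₀⟩ := hc₀
    obtain ⟨d₁, hd₁⟩ := hc₁
    refine Pre.erase hk hE (fun g hg => ?_) hp
    rcases List.mem_cons.1 hg with rfl | hg
    · exact h1
    · exact h2 g hg (fun h => Pre.occ_le (e _ _ hd₀) h hg) (fun h => Pre.le_occ (e _ _ hd₁) h hg)
        (hp.2.2 g hg)

theorem syn_of_forall {S : Set Word} {u v : Word}
    (h : ∀ (φ : ℕ → Word) (a b : Word), a * FreeMonoid.lift φ u * b ∈ S →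
      a * FreeMonoid.lift φ v * b ∈ S)
    (h' : ∀ (φ : ℕ → Word) (a b : Word), a * FreeMonoid.lift φ v * b ∈ S →
      a * FreeMonoid.lift φ u * b ∈ S) : syn S u v :=
  fun φ a b => ⟨h φ a b, h' φ a b⟩

theorem mem_var_of_syn {S : Set Word} {I : Set (Word × Word)} (h : ∀ e ∈ I, syn S e.1 e.2) :
    MonCat.of (syn S).Quotient ∈ (var I).carrier :=
  fun e he => satisfies_syn.2 (h e he)

/-! ### Separating sets for 𝐇, 𝐍 and the variety behind η -/

/-- The numerical conditions of `Pre.step` for words `L` without repetitions, where the condition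
on the number of occurrences does not depend on the letter. -/
def Step (C : ℕ → Prop) (c l r c₀ c₁ : Word) : Prop :=
  ∀ (φ : ℕ → Word) (a b : Word) (k g : ℕ), occ k (a * FreeMonoid.lift φ (c * l) * b) = 1 →
    (1 ≤ occ k (a * FreeMonoid.lift φ c) → occ k (FreeMonoid.lift φ r * b) = 0 ∧
      (1 ≤ occ g (a * FreeMonoid.lift φ c) → C (occ g (a * FreeMonoid.lift φ (c * l) * b)) →
        C (occ g (a * FreeMonoid.lift φ (c * r) * b)))) ∧
    (occ k (a * FreeMonoid.lift φ c) = 0 → occ k (φ 0) = 0 ∧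
      ((occ k (a * FreeMonoid.lift φ c₀) = 0 → occ g (a * FreeMonoid.lift φ c₀) ≤ 1) →
        (1 ≤ occ k (a * FreeMonoid.lift φ c₁) → 1 ≤ occ g (a * FreeMonoid.lift φ c₁)) →
        C (occ g (a * FreeMonoid.lift φ (c * l) * b)) → occ g (φ 0) = 0))

theorem Step.step (hk : k ∉ L) (hL : L.Nodup) {C : ℕ → Prop} {c l r c₀ c₁ : Word}
    (h : Step C c l r c₀ c₁) (hc₀ : ∃ d, c * l = c₀ * d) (hc₁ : ∃ d, c * l = c₁ * d)
    (hE : ∀ φ : ℕ → Word, φ 0 = 1 → FreeMonoid.lift φ (c * l) = FreeMonoid.lift φ (c * r))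
    (φ : ℕ → Word) (a b : Word) (hp : a * FreeMonoid.lift φ (c * l) * b ∈ Pre L k (fun _ => C)) :
    a * FreeMonoid.lift φ (c * r) * b ∈ Pre L k (fun _ => C) := by
  refine Pre.step hk c l r c₀ c₁ hc₀ hc₁ hE (fun h1 h2 => ⟨((h φ a b k 0 h1).1 h2).1, ?_⟩)
    (fun h1 h2 => ⟨((h φ a b k 0 h1).2 h2).1, ?_⟩) hp
  · intro g hg
    rw [List.count_eq_one_of_mem hL hg]
    exact ((h φ a b k g h1).1 h2).2
  · intro g hg
    rw [List.count_eq_one_of_mem hL hg]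
    exact ((h φ a b k g h1).2 h2).2

theorem syn_pre (hk : k ∉ L) (hL : L.Nodup) {C : ℕ → Prop} {u v : Word} (c l r c₀ c₁ c₂ c₃ : Word)
    (hu : u = c * l) (hv : v = c * r) (hc : (∃ d, c * l = c₀ * d) ∧ (∃ d, c * l = c₁ * d) ∧
      (∃ d, c * r = c₂ * d) ∧ ∃ d, c * r = c₃ * d)
    (hE : ∀ φ : ℕ → Word, φ 0 = 1 → FreeMonoid.lift φ (c * l) = FreeMonoid.lift φ (c * r))
    (h₁ : Step C c l r c₀ c₁) (h₂ : Step C c r l c₂ c₃) : syn (Pre L k fun _ => C) u v := by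
  rw [hu, hv]
  exact syn_of_forall (h₁.step hk hL hc.1 hc.2.1 hE)
    (h₂.step hk hL hc.2.2.1 hc.2.2.2 fun φ h => (hE φ h).symm)

/-- The prefixes `c₀` and `c₂` passed to `syn_pre` contain x twice. If `k` comes later, a letter of
`L` in the image of x would occur twice before `k`, impossible as `L` has no repetitions. If `k`
comes in the common prefix, only the multiplicity of the letters has to be preserved. -/
theorem mem_H (hk : k ∉ L) (hL : L.Nodup) :
    MonCat.of (syn (Pre L k fun _ n => 2 ≤ n)).Quotient ∈ H.carrier := by
  refine mem_inf.2 ⟨mem_var_of_syn ?_, mem_var_of_syn ?_⟩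
  · rintro e (rfl | rfl | rfl | rfl) <;> dsimp only
    · refine syn_pre hk hL (1) (x ^ 2) (x ^ 3) (x ^ 2) 1 (x ^ 3) (1) rfl rfl
        ⟨⟨1, rfl⟩, ⟨_, rfl⟩, ⟨1, rfl⟩, ⟨1 * (x ^ 3), rfl⟩⟩ (fun φ h => by simp [x, y, z, t, h]) ?_ ?_ <;>
      intro φ a b k g <;>
      simp only [x, y, z, t, map_mul, map_pow, map_one, FreeMonoid.lift_eval_of, occ_mul, occ_pow,
        occ_one] <;> omega
    · refine syn_pre hk hL (1) (x ^ 2 * y ^ 2) (y ^ 2 * x ^ 2) (x ^ 2) 1 (y ^ 2 * x ^ 2) (1) rfl rfl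
        ⟨⟨y ^ 2, rfl⟩, ⟨_, rfl⟩, ⟨1, rfl⟩, ⟨1 * (y ^ 2 * x ^ 2), rfl⟩⟩ (fun φ h => by simp [x, y, z, t, h]) ?_ ?_ <;>
      intro φ a b k g <;>
      simp only [x, y, z, t, map_mul, map_pow, map_one, FreeMonoid.lift_eval_of, occ_mul, occ_pow,
        occ_one] <;> omega
    · refine syn_pre hk hL (x * y * x) (1) (x) (x * y * x) 1 (x * y * x) (1) rfl rfl
        ⟨⟨1, rfl⟩, ⟨_, rfl⟩, ⟨x, rfl⟩, ⟨x * y * x * (x), rfl⟩⟩ (fun φ h => by simp [x, y, z, t, h]) ?_ ?_ <;>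
      intro φ a b k g <;>
      simp only [x, y, z, t, map_mul, map_pow, map_one, FreeMonoid.lift_eval_of, occ_mul, occ_pow,
        occ_one] <;> omega
    · refine syn_pre hk hL (x ^ 2 * y) (1) (x) (x ^ 2) 1 (x ^ 2) (1) rfl rfl
        ⟨⟨y, rfl⟩, ⟨_, rfl⟩, ⟨y * x, rfl⟩, ⟨x ^ 2 * y * (x), rfl⟩⟩ (fun φ h => by simp [x, y, z, t, h]) ?_ ?_ <;>
      intro φ a b k g <;>
      simp only [x, y, z, t, map_mul, map_pow, map_one, FreeMonoid.lift_eval_of, occ_mul, occ_pow,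
        occ_one] <;> omega
  · rintro e rfl
    dsimp only
    refine syn_pre hk hL (1) (x * y * x * t * y) (y * x ^ 2 * t * y) (x * y * x) 1 (y * x ^ 2) (1) rfl rfl
        ⟨⟨t * y, rfl⟩, ⟨_, rfl⟩, ⟨t * y, rfl⟩, ⟨1 * (y * x ^ 2 * t * y), rfl⟩⟩ (fun φ h => by simp [x, y, z, t, h]) ?_ ?_ <;>
      intro φ a b k g <;>
      simp only [x, y, z, t, map_mul, map_pow, map_one, FreeMonoid.lift_eval_of, occ_mul, occ_pow,
        occ_one] <;> omega

theorem mem_var_eta (hk : k ∉ L) (hL : L.Nodup) :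
    MonCat.of (syn (Pre L k fun _ n => 2 ≤ n)).Quotient ∈
      (var {(x * y * x * z, x * y * x * z * x), (y * t * x ^ 2 * y, y * t * y * x ^ 2)}).carrier := by
  refine mem_var_of_syn ?_
  rintro e (rfl | rfl) <;> dsimp only
  · refine syn_pre hk hL (x * y * x * z) (1) (x) (x * y * x) 1 (x * y * x) (1) rfl rfl
      ⟨⟨z, rfl⟩, ⟨_, rfl⟩, ⟨z * x, rfl⟩, ⟨x * y * x * z * (x), rfl⟩⟩ (fun φ h => by simp [x, y, z, t, h]) ?_ ?_ <;>
    intro φ a b k g <;>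
    simp only [x, y, z, t, map_mul, map_pow, map_one, FreeMonoid.lift_eval_of, occ_mul, occ_pow,
      occ_one] <;> omega
  · refine syn_pre hk hL (y * t) (x ^ 2 * y) (y * x ^ 2) (y * t * x ^ 2) 1 (y * t * y * x ^ 2) (1) rfl rfl
      ⟨⟨y, rfl⟩, ⟨_, rfl⟩, ⟨1, rfl⟩, ⟨y * t * (y * x ^ 2), rfl⟩⟩ (fun φ h => by simp [x, y, z, t, h]) ?_ ?_ <;>
    intro φ a b k g <;>
    simp only [x, y, z, t, map_mul, map_pow, map_one, FreeMonoid.lift_eval_of, occ_mul, occ_pow,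
      occ_one] <;> omega

/-- Requiring exactly two occurrences is what handles two of the sides: xyxzx contains x three
times, and in yx² with `k` in the image of y a letter of `L` has already occurred before two more
copies of x. -/
theorem mem_N (hk : k ∉ L) (hL : L.Nodup) :
    MonCat.of (syn (Pre L k fun _ n => n = 2)).Quotient ∈ N.carrier := by
  refine mem_var_of_syn ?_
  rintro e (rfl | rfl | rfl | rfl | rfl) <;> dsimp only
  · refine syn_pre hk hL (1) (x ^ 2) (x ^ 3) (x ^ 2) 1 (x ^ 3) (1) rfl rfl
      ⟨⟨1, rfl⟩, ⟨_, rfl⟩, ⟨1, rfl⟩, ⟨1 * (x ^ 3), rfl⟩⟩ (fun φ h => by simp [x, y, z, t, h]) ?_ ?_ <;>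
    intro φ a b k g <;>
    simp only [x, y, z, t, map_mul, map_pow, map_one, FreeMonoid.lift_eval_of, occ_mul, occ_pow,
      occ_one] <;> omega
  · refine syn_pre hk hL (1) (x ^ 2 * y) (y * x ^ 2) (x ^ 2) 1 (y * x ^ 2) (y) rfl rfl
      ⟨⟨y, rfl⟩, ⟨_, rfl⟩, ⟨1, rfl⟩, ⟨x ^ 2, rfl⟩⟩ (fun φ h => by simp [x, y, z, t, h]) ?_ ?_ <;>
    intro φ a b k g <;>
    simp only [x, y, z, t, map_mul, map_pow, map_one, FreeMonoid.lift_eval_of, occ_mul, occ_pow,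
      occ_one] <;> omega
  · refine syn_pre hk hL (1) (x * y * x * z * x) (x ^ 2 * y * z) (x * y * x) 1 (x ^ 2) (1) rfl rfl
      ⟨⟨z * x, rfl⟩, ⟨_, rfl⟩, ⟨y * z, rfl⟩, ⟨1 * (x ^ 2 * y * z), rfl⟩⟩ (fun φ h => by simp [x, y, z, t, h]) ?_ ?_ <;>
    intro φ a b k g <;>
    simp only [x, y, z, t, map_mul, map_pow, map_one, FreeMonoid.lift_eval_of, occ_mul, occ_pow,
      occ_one] <;> omega
  · refine syn_pre hk hL (x * z * y * t) (x * y) (y * x) (x * z * y * t * x) 1 (x * z * y * t * y * x) (1) rfl rfl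
      ⟨⟨y, rfl⟩, ⟨_, rfl⟩, ⟨1, rfl⟩, ⟨x * z * y * t * (y * x), rfl⟩⟩ (fun φ h => by simp [x, y, z, t, h]) ?_ ?_ <;>
    intro φ a b k g <;>
    simp only [x, y, z, t, map_mul, map_pow, map_one, FreeMonoid.lift_eval_of, occ_mul, occ_pow,
      occ_one] <;> omega
  · refine syn_pre hk hL (x * z) (x * y * t * y) (y * x * t * y) (x * z * x) 1 (x * z * y * x) (1) rfl rfl
      ⟨⟨y * t * y, rfl⟩, ⟨_, rfl⟩, ⟨t * y, rfl⟩, ⟨x * z * (y * x * t * y), rfl⟩⟩ (fun φ h => by simp [x, y, z, t, h]) ?_ ?_ <;>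
    intro φ a b k g <;>
    simp only [x, y, z, t, map_mul, map_pow, map_one, FreeMonoid.lift_eval_of, occ_mul, occ_pow,
      occ_one] <;> omega

/-! ### The identities of the varieties defining `μ` and `ν` -/

/-- The defining identities only change numbers of occurrences which are at least two on both sides.
-/
theorem keeps_mu : Keeps mu := by
  intro p q h a
  have hS : MonCat.of (syn {p | min (occ a p) 2 = min (occ a q) 2}).Quotient ∈
      (var {(x ^ 2, x ^ 3), (x * y * x * z * x, x * y * x * z * x ^ 2)}).carrier := by
    refine mem_var_of_syn ?_
    rintro e (rfl | rfl) <;> intro φ b c <;>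
    simp only [x, y, z, map_mul, map_pow, FreeMonoid.lift_eval_of, occ_mul, occ_pow,
      Set.mem_ofPred_eq] <;> omega
  exact (mem_iff_of_FIC hS h).2 rfl

/-- The class of `xyxzx` with respect to `μ`. -/
def muClass : Set Word := Pre [0, 1, 0] 2 fun g n => if g = 0 then 3 ≤ n else n = 1

/-- Before z the relevant letters spell xyx, where two x are never adjacent, while the relevant part
of `X` is a power of x. -/
theorem mem_muClass_of_sq {a b X : Word} (h : a * (X * X) * b ∈ muClass) (ha : occ 2 a = 0)
    (hX : occ 2 X = 0) (hX' : occ 1 X = 0) : occ 0 X = 0 := by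
  have h : a * X * X * b ∈ muClass := by simpa only [mul_assoc] using h
  have hp := Pre.prefix (q := a * X * X) h (by simp [occ_mul, ha, hX])
  simp only [FreeMonoid.toList_mul, List.filter_append] at hp
  have h0 : occ 0 X = ((FreeMonoid.toList X).filter (· ∈ [0, 1, 0])).count 0 :=
    (count_filter_mem (by simp) _).symm
  have h1 : ((FreeMonoid.toList X).filter (· ∈ [0, 1, 0])).count 1 = 0 :=
    (count_filter_mem (by simp) _).trans hX'
  rw [h0]
  generalize (FreeMonoid.toList X).filter (· ∈ [0, 1, 0]) = l at hp h1 ⊢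
  generalize (FreeMonoid.toList a).filter (· ∈ [0, 1, 0]) = m at hp
  have hl := hp.length_le
  simp only [List.length_append, List.length_cons, List.length_nil] at hl
  rcases l with _ | ⟨c, _ | ⟨d, l⟩⟩
  · rfl
  · rcases m with _ | ⟨e, _ | ⟨f, m⟩⟩
    · simp at hp; omega
    · simp at hp; omega
    · simp at hl
      omega
  · simp at hl
    omega

theorem mem_mu : MonCat.of (syn muClass).Quotient ∈
    (var {(x ^ 2, x ^ 3), (x * y * x * z * x, x * y * x * z * x ^ 2)}).carrier := by
  have hk : 2 ∉ [0, 1, 0] := by decide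
  have hC : ∀ {P : ℕ → Prop}, P 0 → P 1 → ∀ g ∈ [0, 1, 0], P g := by
    intro P h0 h1 g hg
    simp only [List.mem_cons, List.not_mem_nil, or_false] at hg
    rcases hg with rfl | rfl | rfl <;> assumption
  refine mem_var_of_syn ?_
  rintro e (rfl | rfl) <;> dsimp only
  · rw [← one_mul (x ^ 2), ← one_mul (x ^ 3)]
    refine syn_of_forall ?_ ?_ <;> intro φ a b
    · intro hp
      refine Pre.step hk 1 (x ^ 2) (x ^ 3) (x ^ 2) 1 ⟨1, rfl⟩ ⟨_, rfl⟩
        (fun φ h => by simp [x, h]) (fun h1 h2 => ?_) (fun h1 h2 => ?_) hp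
      · simp only [x, map_mul, map_pow, map_one, FreeMonoid.lift_eval_of, occ_mul, occ_pow,
          occ_one] at h1 h2 ⊢
        refine ⟨by omega, hC ?_ ?_⟩ <;> simp <;> omega
      · have hp' := hp
        simp only [x, map_mul, map_pow, map_one, FreeMonoid.lift_eval_of, occ_mul, occ_pow,
          occ_one, one_mul] at h1 h2 hp' ⊢
        rw [pow_two] at hp'
        have h3 := hp.2.2 1 (by simp)
        simp [x, occ_mul, occ_pow] at h3
        -- Counting alone would allow one x in the image, since xyx contains two; the order of
        -- letters excludes it.
        have := mem_muClass_of_sq hp' (by omega) (by omega) (by omega)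
        refine ⟨by omega, hC ?_ ?_⟩ <;> simp <;> omega
    · refine Pre.step hk 1 (x ^ 3) (x ^ 2) (x ^ 3) 1 ⟨1, rfl⟩ ⟨_, rfl⟩
        (fun φ h => by simp [x, h]) (fun h1 h2 => ?_) (fun h1 h2 => ?_) <;>
      simp only [x, map_mul, map_pow, map_one, FreeMonoid.lift_eval_of, occ_mul, occ_pow,
          occ_one] at h1 h2 ⊢ <;>
      refine ⟨by omega, hC ?_ ?_⟩ <;> simp <;> omega
  · refine syn_of_forall ?_ ?_ <;> intro φ a b
    · refine Pre.step hk (x * y * x * z) x (x ^ 2) (x * y * x * z * x) 1 ⟨1, rfl⟩ ⟨_, rfl⟩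
        (fun φ h => by simp [x, y, z, h]) (fun h1 h2 => ?_) (fun h1 h2 => ?_) <;>
      simp only [x, y, z, map_mul, map_pow, map_one, FreeMonoid.lift_eval_of, occ_mul, occ_pow,
          occ_one] at h1 h2 ⊢ <;>
      refine ⟨by omega, hC ?_ ?_⟩ <;> simp <;> omega
    · refine Pre.step hk (x * y * x * z) (x ^ 2) x (x * y * x * z * x) 1 ⟨x, rfl⟩ ⟨_, rfl⟩
        (fun φ h => by simp [x, y, z, h]) (fun h1 h2 => ?_) (fun h1 h2 => ?_) <;>
      simp only [x, y, z, map_mul, map_pow, map_one, FreeMonoid.lift_eval_of, occ_mul, occ_pow,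
          occ_one] at h1 h2 ⊢ <;>
      refine ⟨by omega, hC ?_ ?_⟩ <;> simp <;> omega

theorem mem_muClass {q : Word} (h : mu (x * y * x * z * x) q) : q ∈ muClass := by
  refine (mem_iff_of_FIC mem_mu h).1 ⟨by decide, by decide, ?_⟩
  decide

/-- The words in which the letter `1` occurs, and the first occurrence of `0`, if any, follows
the one of `1`. -/
def firstOne : Set Word := {p | ((FreeMonoid.toList p).filter (· ∈ [0, 1])).head? = some 1}

/-- A repeated x placed after xy is never a first occurrence. -/
theorem mem_firstOne : MonCat.of (syn firstOne).Quotient ∈ (var {(x * y, x * y * x)}).carrier := by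
  refine mem_var_of_syn ?_
  rintro e rfl φ a b
  simp only [firstOne, Set.mem_ofPred_eq, x, y, map_mul, FreeMonoid.lift_eval_of,
    FreeMonoid.toList_mul, List.filter_append, List.head?_append]
  generalize (FreeMonoid.toList (φ 0)).filter (· ∈ [0, 1]) = l
  cases l <;> simp

/-! ### Deriving identities and class membership -/

theorem FIC_context {V : Variety} {l r : Word} (h : FIC V l r) (φ : ℕ → Word) (a b : Word)
    {u v : Word} (hu : u = a * FreeMonoid.lift φ l * b) (hv : v = a * FreeMonoid.lift φ r * b) :
    FIC V u v := by
  rw [hu, hv]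
  exact (FIC V).mul ((FIC V).mul ((FIC V).refl a) (FIC_lift h φ)) ((FIC V).refl b)

theorem FIC_xyx_erase {u v : Word} (hu : 3 ≤ occ 0 u) (hv : 3 ≤ occ 0 v)
    (h : ∀ φ : ℕ → Word, φ 0 = 1 → FreeMonoid.lift φ u = FreeMonoid.lift φ v) :
    FIC (varM (x * y * x)) u v :=
  FIC_varM_of_erase 0 2 (by decide) hu hv h

/-- The substitution erasing the letters from `l`. -/
def er (l : List ℕ) (i : ℕ) : Word := if i ∈ l then 1 else FreeMonoid.of i

/-- The restrictions `aba` of `w` are inherited by the words which become, by a substitution,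
equal to `w` in `𝐌_α(w)`. -/
theorem not_sub_of_pin {α : Con Word} {w u p f : Word}
    (hα : ∀ q, α w q → FIC (varM (x * y * x)) w q) (h : FIC (varMα α w) u p) (φ : ℕ → Word)
    (hu : α w (FreeMonoid.lift φ u)) (a b : ℕ) (hw : FreeMonoid.lift (two a b) w = x * y * x)
    (hf : ¬ Sub (FreeMonoid.lift (two a b) (FreeMonoid.lift φ f)) (x * y * x)) : ¬ Sub f p := by
  refine not_sub_of_class h φ 1 1 (by simpa using hu) fun q hq => ?_
  simpa using FIC_xyx_avoid (hα q hq) a b hw hf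

/-- Erasing all letters but x and `k` takes `u`, and therefore `p`, to the class xx⁺y, where no x
follows y. -/
theorem not_sub_gam {u p : Word} (k : ℕ) (h : FIC (varMα gam (x ^ 2 * y)) u p)
    (hu : squash (FreeMonoid.lift (two 0 k) u) = [0, 1])
    (hu' : occ 0 (FreeMonoid.lift (two 0 k) u) ≠ 1)
    (hu'' : occ 1 (FreeMonoid.lift (two 0 k) u) = 1) (hk : k ≠ 0) :
    ¬ Sub (FreeMonoid.of k * x) p := by
  refine not_sub_of_class h (two 0 k) 1 1 ?_ fun q hq => not_sub_of_squash hq.2 ?_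
  · rw [one_mul, mul_one]
    refine gam_of hu.symm ?_
    intro a ha
    have : a = 0 ∨ a = 1 := by
      have ha' : a ∈ [0, 0, 1] := ha
      simpa using ha'
    rcases this with rfl | rfl
    · simp only [hu', iff_false]; decide
    · simp only [hu'', iff_true]; decide
  · simp only [one_mul, mul_one, map_mul, x, FreeMonoid.lift_eval_of, two, hk, if_true, if_false]
    decide

/-- Erasing all letters but x and `k` takes `u`, and therefore `p`, to the class xyx⁺, where a
single x precedes y. -/
theorem not_sub_lam {u p : Word} (k : ℕ) (h : FIC (varMα lam (x * y * x)) u p)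
    (hu : lam (x * y * x) (FreeMonoid.lift (two 0 k) u)) (hk : k ≠ 0) :
    ¬ Sub (x * x * FreeMonoid.of k) p := by
  refine not_sub_of_class h (two 0 k) 1 1 (by simpa using hu) fun q hq => ?_
  have := not_sub_of_lam hq (a := 0) (b := 1) (by decide) (by decide) (by decide) (by decide)
  simpa [x, two, hk, y] using this

theorem gam'_iff {u v : Word} : gam' u v ↔ gam u v ∧ FIC (varM (x * y * x)) u v := Iff.rfl

theorem FIC_xyx_cube (a b : Word) : FIC (varM (x * y * x)) (a * x ^ 2 * b) (a * x ^ 3 * b) :=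
  (FIC _).mul ((FIC _).mul ((FIC _).refl a) FIC_xyx_sq) ((FIC _).refl b)

theorem sub_of_head {a b : ℕ} (hab : b ≠ a) {p : Word} (hb : 1 ≤ occ b p)
    (h : (squash (FreeMonoid.lift (two a b) p)).head? = some 0) :
    Sub (FreeMonoid.of a * FreeMonoid.of b) p := by
  obtain ⟨c, d, rfl, -⟩ := exists_eq_of_occ hb
  rw [head?_squash, mul_assoc, map_mul, FreeMonoid.toList_mul] at h
  have ha : a ∈ FreeMonoid.toList c := by
    cases hl : FreeMonoid.toList (FreeMonoid.lift (two a b) c) with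
    | nil =>
      rw [hl, map_mul, FreeMonoid.lift_eval_of, show two a b b = y by simp [two, hab]] at h
      simp [y] at h
    | cons i l =>
      rw [hl] at h
      obtain rfl : i = 0 := by simpa using h
      have hi : 0 ∈ FreeMonoid.toList (FreeMonoid.lift (two a b) c) := by rw [hl]; simp
      rw [toList_lift, List.mem_flatMap] at hi
      obtain ⟨i, hi, h0⟩ := hi
      by_cases hia : i = a
      · exact hia ▸ hi
      · by_cases hib : i = b <;> simp [two, hia, hib, y, hab] at h0
  have := ((of_sub_iff.2 (mem_iff_occ.1 ha)).mul (Sub.refl (FreeMonoid.of b))).mul (one_sub d)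
  simpa using this

theorem forall_mem_triple {P : Word → Prop} {f g h : Word} (hf : P f) (hg : P g) (hh : P h) :
    ∀ e ∈ [f, g, h], P e := by
  simp [hf, hg, hh]

theorem forall_mem_pair {P : Word → Prop} {f g : Word} (hf : P f) (hg : P g) :
    ∀ e ∈ [f, g], P e := by
  simp [hf, hg]

theorem swapEquiv_of {u v : Word} (h : ∀ φ : ℕ → Word, (φ 0 * φ 1 = φ 1 * φ 0) →
    (∀ w, φ 0 * (φ 1 * w) = φ 1 * (φ 0 * w)) → FreeMonoid.lift φ u = FreeMonoid.lift φ v) :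
    SwapEquiv u v := by
  intro φ hc
  refine h φ hc fun w => ?_
  rw [← mul_assoc, hc, mul_assoc]

theorem FIC_varMα_gam'_of {w u v : Word} (k : ℕ)
    (hk : FreeMonoid.lift (two 1 k) w = x * y * x)
    (hw : ∀ a ∈ FreeMonoid.toList w, 2 ≤ occ a w → a = 0 ∨ a = 1)
    (hu : 3 ≤ occ 0 u) (hv : 3 ≤ occ 0 v)
    (hE : ∀ φ : ℕ → Word, φ 0 = 1 → FreeMonoid.lift φ u = FreeMonoid.lift φ v)
    (hS : ∀ φ : ℕ → sqCon.Quotient, φ 0 * φ 0 = φ 0 → (∀ w, φ 0 * (φ 0 * w) = φ 0 * w) →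
      FreeMonoid.lift φ u = FreeMonoid.lift φ v) :
    FIC (varMα gam' w) u v := by
  refine FIC_varMα_gam' k hk hw hu hv hE fun φ h => hS φ h fun w => ?_
  rw [← mul_assoc, h]

/-! ### Joins of 𝐌_λ(xyx⁺) with varieties 𝐌_γ'(w) -/

/-- The varieties `𝐌_λ(xyx⁺) ∨ 𝐌_γ'(w)`. -/
theorem nonmodular_lam_gam' {w u v e₁ e₂ : Word} (k j : ℕ) (l : List ℕ) (f g : Word)
    (hj : FreeMonoid.lift (two 1 j) w = x * y * x)
    (hw : ∀ a ∈ FreeMonoid.toList w, 2 ≤ occ a w → a = 0 ∨ a = 1)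
    (h3 : 3 ≤ occ 0 u ∧ 3 ≤ occ 0 v ∧ 3 ≤ occ 0 e₁ ∧ 3 ≤ occ 0 e₂)
    (huv : SwapEquiv u v) (he : SwapEquiv e₁ e₂)
    (hE₁ : ∀ φ : ℕ → Word, φ 0 = 1 → FreeMonoid.lift φ u = FreeMonoid.lift φ e₁)
    (hE₂ : ∀ φ : ℕ → Word, φ 0 = 1 → FreeMonoid.lift φ v = FreeMonoid.lift φ e₂)
    (hS₁ : ∀ φ : ℕ → sqCon.Quotient, φ 0 * φ 0 = φ 0 → (∀ w, φ 0 * (φ 0 * w) = φ 0 * w) →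
      FreeMonoid.lift φ u = FreeMonoid.lift φ e₁)
    (hS₂ : ∀ φ : ℕ → sqCon.Quotient, φ 0 * φ 0 = φ 0 → (∀ w, φ 0 * (φ 0 * w) = φ 0 * w) →
      FreeMonoid.lift φ v = FreeMonoid.lift φ e₂)
    (hcl : gam' w (FreeMonoid.lift (er l) u))
    (hv : squash w ≠ squash (FreeMonoid.lift (er l) v))
    (hk : occ k u = 1) (hk0 : k ≠ 0)
    (hu : ∀ a ∈ FreeMonoid.toList u, 2 ≤ occ a u → a = 0 ∨ a = 1)
    (ho : (2 ≤ occ 0 u ∧ 2 ≤ occ 1 u) ∧ (2 ≤ occ 0 v ∧ 2 ≤ occ 1 v) ∧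
      (2 ≤ occ 0 e₁ ∧ 2 ≤ occ 1 e₁) ∧ (2 ≤ occ 0 e₂ ∧ 2 ≤ occ 1 e₂))
    (hlam : lam (x * y * x) (FreeMonoid.lift (two 0 k) u))
    (hf : ∀ p, FIC (varMα lam (x * y * x)) u p → FIC (varMα gam' w) u p → ¬ Sub f p)
    (hg : ¬ Sub (FreeMonoid.lift (two 1 j) (FreeMonoid.lift (er l) g)) (x * y * x))
    (h₁ : Blocked [x * x * FreeMonoid.of k, f, g] k e₁)
    (h₂ : Blocked [x * x * FreeMonoid.of k, f, g] k e₂) :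
    HasNonmodularSubvarietyLattice (varMα lam (x * y * x) ⊔ varMα gam' w) := by
  refine nonmodular_of_swap k [x * x * FreeMonoid.of k, f, g] keeps_lam (m := 1) (by decide)
    (by decide) huv he (FIC_varMα_gam'_of j hj hw h3.1 h3.2.2.1 hE₁ hS₁)
    (FIC_varMα_gam'_of j hj hw h3.2.1 h3.2.2.2 hE₂ hS₂) ?_ ?_ hk hu ho h₁ h₂
  -- Erasing `l` takes `u` to the class of `w`, but the image of `v` has a different reduced form.
  · intro h
    have := class_of_FIC h (er l) 1 1 (by simpa using hcl)
    rw [one_mul, mul_one] at this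
    exact hv this.1.2
  · intro p hpA hpB
    exact forall_mem_triple (not_sub_lam k hpA hlam hk0) (hf p hpA hpB)
      (not_sub_of_pin (fun _ h => (gam'_iff.1 h).2) hpB (er l) hcl 1 j hj hg)

/-- The letter s splits the block of x in w. In 𝐌_γ'(w) an x may move from the block after s to the
one before it, whereas 𝐌_λ(xyx⁺) allows only one x before s in words equal to `u`. -/
theorem nonmodular_lam_gam'_yx2ty : HasNonmodularSubvarietyLattice
    (varMα lam (x * y * x) ⊔ varMα gam' (y * x ^ 2 * t * y)) := by
  have hcl : gam' (y * x ^ 2 * t * y) (FreeMonoid.lift (er [4]) (y * x * s * x ^ 2 * t * y)) :=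
    gam'_iff.2 ⟨gam_of (by decide) (by decide), (FIC_xyx_cube y (t * y))⟩
  refine nonmodular_lam_gam' (u := y * x * s * x ^ 2 * t * y) (v := x * y * s * x ^ 2 * t * y)
    (e₁ := y * x ^ 2 * s * x * t * y) (e₂ := x ^ 2 * y * s * x * t * y) 4 3 [4] (s * y * y)
    (y * y * y) rfl (by decide) (by decide) (swapEquiv_of fun φ h h' => ?_)
    (swapEquiv_of fun φ h h' => ?_) (fun φ h => ?_) (fun φ h => ?_) (fun φ h h' => ?_)
    (fun φ h h' => ?_) hcl (by decide) rfl (by decide) (by decide) (by decide)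
    (lam_of (by decide) (by decide)) (fun p hA hB => ?_) (by decide) (by decide) (by decide)
  · simp [x, y, z, t, s, er, pow_succ, mul_assoc, h, h']
  · simp [x, y, z, t, s, er, pow_succ, mul_assoc, h, h']
  · simp [x, y, z, t, s, er, pow_succ, mul_assoc, h]
  · simp [x, y, z, t, s, er, pow_succ, mul_assoc, h]
  · simp [x, y, z, t, s, er, pow_succ, mul_assoc, h, h']
  · simp [x, y, z, t, s, er, pow_succ, mul_assoc, h, h']
  -- Sending s to x²t and erasing x and t takes `u` to w itself, so the restriction ysy of `u` is
  -- inherited by `p`.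
  · refine not_sub_of_pin (fun _ h => (gam'_iff.1 h).2) hB
      (fun i => if i = 1 then y else if i = 4 then x ^ 2 * t else 1)
      (by exact gam'.refl _) 1 3 rfl (by decide)

theorem nonmodular_lam_gam'_ytyx2 : HasNonmodularSubvarietyLattice
    (varMα lam (x * y * x) ⊔ varMα gam' (y * t * y * x ^ 2)) := by
  have hcl : gam' (y * t * y * x ^ 2) (FreeMonoid.lift (er [4]) (y * t * y * x * s * x ^ 2)) :=
    gam'_iff.2 ⟨gam_of (by decide) (by decide), (by exact FIC_xyx_cube (y * t * y) 1)⟩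
  refine nonmodular_lam_gam' (u := y * t * y * x * s * x ^ 2) (v := y * t * x * y * s * x ^ 2)
    (e₁ := y * t * y * x ^ 2 * s * x) (e₂ := y * t * x ^ 2 * y * s * x) 4 3 [4] (s * y)
    (y * y * y) rfl (by decide) (by decide) (swapEquiv_of fun φ h h' => ?_)
    (swapEquiv_of fun φ h h' => ?_) (fun φ h => ?_) (fun φ h => ?_) (fun φ h h' => ?_)
    (fun φ h h' => ?_) hcl (by decide) rfl (by decide) (by decide) (by decide)
    (lam_of (by decide) (by decide)) (fun p hA hB => ?_) (by decide) (by decide) (by decide)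
  · simp [x, y, z, t, s, er, pow_succ, mul_assoc, h, h']
  · simp [x, y, z, t, s, er, pow_succ, mul_assoc, h, h']
  · simp [x, y, z, t, s, er, pow_succ, mul_assoc, h]
  · simp [x, y, z, t, s, er, pow_succ, mul_assoc, h]
  · simp [x, y, z, t, s, er, pow_succ, mul_assoc, h, h']
  · simp [x, y, z, t, s, er, pow_succ, mul_assoc, h, h']
  -- An x precedes the simple letter s in `p`, so a y after s would give the subword xy, excluded by
  -- the class of ytyx².
  · intro hsy
    have hA' : lam (x * y * x) (FreeMonoid.lift (two 0 4) p) := by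
      simpa using class_of_FIC hA (two 0 4) 1 1 (by exact lam_of (by decide) (by decide))
    have hs1 : occ 4 p = 1 := by
      have := keeps_FIC_varMα keeps_lam (w := x * y * x) (k := 1) (by decide) _ _ hA 4
      rw [show occ 4 (y * t * y * x * s * x ^ 2) = 1 by decide] at this
      omega
    have hxs : Sub (x * s) p := by
      refine sub_of_head (by decide) hs1.ge ?_
      rw [← hA'.1.2]
      decide
    have hxy : ¬ Sub (x * y) p := by
      refine not_sub_of_class hB (er [4]) 1 1 (by simpa using hcl) fun q hq => ?_
      exact not_sub_of_squash (gam'_iff.1 hq).1.2 (by decide)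
    refine hxy (Sub.trans ?_ (Sub.glue hs1 hxs hsy))
    decide

/-- No auxiliary letter is needed: three occurrences of x suffice for 𝐌(xyx) to ignore their
positions, so the first block of w may be cut down to one x inside the γ'-class. -/
theorem nonmodular_lam_gam'_x2yzytx2 : HasNonmodularSubvarietyLattice
    (varMα lam (x * y * x) ⊔ varMα gam' (x ^ 2 * y * z * y * t * x ^ 2)) := by
  have hcl : gam' (x ^ 2 * y * z * y * t * x ^ 2) (FreeMonoid.lift (er []) (x * y * z * y * t * x ^ 2)) :=
    gam'_iff.2 ⟨gam_of (by decide) (by decide), (FIC_xyx_erase (by decide) (by decide) fun φ h => by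
      simp [x, y, z, t, s, er, pow_succ, mul_assoc, h])⟩
  refine nonmodular_lam_gam' (u := x * y * z * y * t * x ^ 2) (v := y * x * z * y * t * x ^ 2)
    (e₁ := x ^ 2 * y * z * y * t * x) (e₂ := y * x ^ 2 * z * y * t * x) 2 2 [] (z * y * y)
    (y * y * y) rfl (by decide) (by decide) (swapEquiv_of fun φ h h' => ?_)
    (swapEquiv_of fun φ h h' => ?_) (fun φ h => ?_) (fun φ h => ?_) (fun φ h h' => ?_)
    (fun φ h h' => ?_) hcl (by decide) rfl (by decide) (by decide) (by decide)
    (lam_of (by decide) (by decide)) (fun p hA hB => ?_) (by decide) (by decide) (by decide)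
  · simp [x, y, z, t, s, er, pow_succ, mul_assoc, h, h']
  · simp [x, y, z, t, s, er, pow_succ, mul_assoc, h, h']
  · simp [x, y, z, t, s, er, pow_succ, mul_assoc, h]
  · simp [x, y, z, t, s, er, pow_succ, mul_assoc, h]
  · simp [x, y, z, t, s, er, pow_succ, mul_assoc, h, h']
  · simp [x, y, z, t, s, er, pow_succ, mul_assoc, h, h']
  · exact not_sub_of_pin (fun _ h => (gam'_iff.1 h).2) hB (er []) hcl 1 2 rfl (by decide)

theorem nonmodular_lam_gam'_x2yzx2ty : HasNonmodularSubvarietyLattice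
    (varMα lam (x * y * x) ⊔ varMα gam' (x ^ 2 * y * z * x ^ 2 * t * y)) := by
  have hcl : gam' (x ^ 2 * y * z * x ^ 2 * t * y) (FreeMonoid.lift (er []) (x * y * z * x ^ 2 * t * y)) :=
    gam'_iff.2 ⟨gam_of (by decide) (by decide), (FIC_xyx_erase (by decide) (by decide) fun φ h => by
      simp [x, y, z, t, s, er, pow_succ, mul_assoc, h])⟩
  refine nonmodular_lam_gam' (u := x * y * z * x ^ 2 * t * y) (v := y * x * z * x ^ 2 * t * y)
    (e₁ := x ^ 2 * y * z * x * t * y) (e₂ := y * x ^ 2 * z * x * t * y) 2 2 [] (z * y * y)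
    (y * y * y) rfl (by decide) (by decide) (swapEquiv_of fun φ h h' => ?_)
    (swapEquiv_of fun φ h h' => ?_) (fun φ h => ?_) (fun φ h => ?_) (fun φ h h' => ?_)
    (fun φ h h' => ?_) hcl (by decide) rfl (by decide) (by decide) (by decide)
    (lam_of (by decide) (by decide)) (fun p hA hB => ?_) (by decide) (by decide) (by decide)
  · simp [x, y, z, t, s, er, pow_succ, mul_assoc, h, h']
  · simp [x, y, z, t, s, er, pow_succ, mul_assoc, h, h']
  · simp [x, y, z, t, s, er, pow_succ, mul_assoc, h]
  · simp [x, y, z, t, s, er, pow_succ, mul_assoc, h]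
  · simp [x, y, z, t, s, er, pow_succ, mul_assoc, h, h']
  · simp [x, y, z, t, s, er, pow_succ, mul_assoc, h, h']
  · exact not_sub_of_pin (fun _ h => (gam'_iff.1 h).2) hB (er []) hcl 1 2 rfl (by decide)

theorem nonmodular_lam_gam'_yzx2ytx2 : HasNonmodularSubvarietyLattice
    (varMα lam (x * y * x) ⊔ varMα gam' (y * z * x ^ 2 * y * t * x ^ 2)) := by
  have hcl : gam' (y * z * x ^ 2 * y * t * x ^ 2) (FreeMonoid.lift (er []) (y * z * x * y * t * x ^ 2)) :=
    gam'_iff.2 ⟨gam_of (by decide) (by decide), (FIC_xyx_erase (by decide) (by decide) fun φ h => by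
      simp [x, y, z, t, s, er, pow_succ, mul_assoc, h])⟩
  refine nonmodular_lam_gam' (u := y * z * x * y * t * x ^ 2) (v := y * z * y * x * t * x ^ 2)
    (e₁ := y * z * x ^ 2 * y * t * x) (e₂ := y * z * y * x ^ 2 * t * x) 3 2 [] (t * y)
    (y * y * y) rfl (by decide) (by decide) (swapEquiv_of fun φ h h' => ?_)
    (swapEquiv_of fun φ h h' => ?_) (fun φ h => ?_) (fun φ h => ?_) (fun φ h h' => ?_)
    (fun φ h h' => ?_) hcl (by decide) rfl (by decide) (by decide) (by decide)
    (lam_of (by decide) (by decide)) (fun p hA hB => ?_) (by decide) (by decide) (by decide)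
  · simp [x, y, z, t, s, er, pow_succ, mul_assoc, h, h']
  · simp [x, y, z, t, s, er, pow_succ, mul_assoc, h, h']
  · simp [x, y, z, t, s, er, pow_succ, mul_assoc, h]
  · simp [x, y, z, t, s, er, pow_succ, mul_assoc, h]
  · simp [x, y, z, t, s, er, pow_succ, mul_assoc, h, h']
  · simp [x, y, z, t, s, er, pow_succ, mul_assoc, h, h']
  · refine not_sub_of_class hB (er []) 1 1 (by simpa using hcl) fun q hq => ?_
    exact not_sub_of_squash (gam'_iff.1 hq).1.2 (by decide)

theorem nonmodular_lam_gam'_x2zytx2y : HasNonmodularSubvarietyLattice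
    (varMα lam (x * y * x) ⊔ varMα gam' (x ^ 2 * z * y * t * x ^ 2 * y)) := by
  have hcl : gam' (x ^ 2 * z * y * t * x ^ 2 * y) (FreeMonoid.lift (er []) (x * z * y * t * x ^ 2 * y)) :=
    gam'_iff.2 ⟨gam_of (by decide) (by decide), (FIC_xyx_erase (by decide) (by decide) fun φ h => by
      simp [x, y, z, t, s, er, pow_succ, mul_assoc, h])⟩
  refine nonmodular_lam_gam' (u := x * z * y * t * x ^ 2 * y) (v := x * z * y * t * y * x ^ 2)
    (e₁ := x ^ 2 * z * y * t * x * y) (e₂ := x ^ 2 * z * y * t * y * x) 3 3 [] (t * y * y)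
    (y * y * y) rfl (by decide) (by decide) (swapEquiv_of fun φ h h' => ?_)
    (swapEquiv_of fun φ h h' => ?_) (fun φ h => ?_) (fun φ h => ?_) (fun φ h h' => ?_)
    (fun φ h h' => ?_) hcl (by decide) rfl (by decide) (by decide) (by decide)
    (lam_of (by decide) (by decide)) (fun p hA hB => ?_) (by decide) (by decide) (by decide)
  · simp [x, y, z, t, s, er, pow_succ, mul_assoc, h, h']
  · simp [x, y, z, t, s, er, pow_succ, mul_assoc, h, h']
  · simp [x, y, z, t, s, er, pow_succ, mul_assoc, h]
  · simp [x, y, z, t, s, er, pow_succ, mul_assoc, h]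
  · simp [x, y, z, t, s, er, pow_succ, mul_assoc, h, h']
  · simp [x, y, z, t, s, er, pow_succ, mul_assoc, h, h']
  · exact not_sub_of_pin (fun _ h => (gam'_iff.1 h).2) hB (er []) hcl 1 3 rfl (by decide)

/-! ### Joins with `𝐌_γ(xx⁺y)`, and with classes of `ν` and `η` -/

theorem not_sub_sq_of_mem_Pre {g k : ℕ} {C : ℕ → ℕ → Prop} {p : Word} (h : p ∈ Pre [g] k C) :
    ¬ Sub (FreeMonoid.of g * FreeMonoid.of g * FreeMonoid.of k) p := by
  intro hs
  have := (Pre.sub h (by simp) hs).length_le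
  simp at this

theorem FIC_H_of {u v : Word} (h : FIC D₁ u v) : FIC H u v := FIC_mono inf_le_left h

theorem FIC_H_sq (a b X Y : Word) : FIC H (a * X * Y * X * b) (a * X * Y * X ^ 2 * b) := by
  refine FIC_H_of (FIC_context (FIC_var (u := x * y * x) (v := x * y * x ^ 2) (by simp))
    (fun i => if i = 0 then X else Y) a b ?_ ?_) <;> simp [x, y, mul_assoc]

theorem FIC_H_append (a b X Y : Word) : FIC H (a * X ^ 2 * Y * b) (a * X ^ 2 * Y * X * b) := by
  refine FIC_H_of (FIC_context (FIC_var (u := x ^ 2 * y) (v := x ^ 2 * y * x) (by simp))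
    (fun i => if i = 0 then X else Y) a b ?_ ?_) <;> simp [x, y, mul_assoc]

/-- The words `e₁`, `e₂` append an x to `u`, `v`. In 𝐇 a later x can be doubled, copied to the right
end and reduced again; in 𝐌_γ(xx⁺y) no x may follow t. -/
theorem nonmodular_gam_H : HasNonmodularSubvarietyLattice (varMα gam (x ^ 2 * y) ⊔ H) := by
  refine nonmodular_of_swap (u := x * y * z * x * t * y) (v := y * x * z * x * t * y)
    (e₁ := x * y * z * x * t * y * x) (e₂ := y * x * z * x * t * y * x) 3 [t * x, y * y * t]
    keeps_gam (m := 1) (by decide) (by decide) (swapEquiv_of fun φ h h' => ?_)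
    (swapEquiv_of fun φ h h' => ?_) ?_ ?_ ?_ (fun p hpA hpB => forall_mem_pair ?_ ?_) (by decide)
    (by decide) (by decide) (by decide) (by decide)
  · simp [x, y, z, t, mul_assoc, h, h']
  · simp [x, y, z, t, mul_assoc, h, h']
  · have h1 := FIC_H_sq 1 (t * y) x (y * z)
    have h2 := FIC_H_append (x * y * z) 1 x (t * y)
    have h3 := FIC_H_sq 1 (t * y * x) x (y * z)
    simp only [one_mul, mul_one, mul_assoc] at h1 h2 h3 ⊢
    exact (FIC H).trans ((FIC H).trans h1 h2) ((FIC H).symm h3)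
  · have h1 := FIC_H_sq y (t * y) x z
    have h2 := FIC_H_append (y * x * z) 1 x (t * y)
    have h3 := FIC_H_sq y (t * y * x) x z
    simp only [one_mul, mul_one, mul_assoc] at h1 h2 h3 ⊢
    exact (FIC H).trans ((FIC H).trans h1 h2) ((FIC H).symm h3)
  · intro h
    have := (mem_iff_of_FIC (mem_H (L := [0, 1]) (k := 2) (by decide) (by decide)) h).1
      ⟨by decide, by decide, by decide⟩
    exact absurd this.2.1 (by decide)
  · exact not_sub_gam 3 hpA (by decide) (by decide) (by decide) (by decide)
  · exact not_sub_sq_of_mem_Pre ((mem_iff_of_FIC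
      (mem_H (L := [1]) (k := 3) (by decide) (by decide)) hpB).1 ⟨by decide, by decide, by decide⟩)

theorem nu_iff {u v : Word} : nu u v ↔ FIC (var {(x * y, x * y * x)}) u v ∧
    FIC (varM (x * y * x)) u v := FIC_sup

theorem eta_iff {u v : Word} : eta u v ↔
    FIC (var {(x * y * x * z, x * y * x * z * x), (y * t * x ^ 2 * y, y * t * y * x ^ 2)}) u v ∧
    FIC (varM (x * y * x)) u v := FIC_sup

theorem FIC_first (a b X Y : Word) :
    FIC (var {(x * y, x * y * x)}) (a * X * Y * b) (a * X * Y * X * b) := by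
  refine FIC_context (FIC_var (u := x * y) (v := x * y * x) (by simp))
    (fun i => if i = 0 then X else Y) a b ?_ ?_ <;> simp [x, y, mul_assoc]

theorem FIC_eta_append (a b X Y Z : Word) :
    FIC (var {(x * y * x * z, x * y * x * z * x), (y * t * x ^ 2 * y, y * t * y * x ^ 2)})
      (a * X * Y * X * Z * b) (a * X * Y * X * Z * X * b) := by
  refine FIC_context (FIC_var (u := x * y * x * z) (v := x * y * x * z * x) (by simp))
    (fun i => if i = 0 then X else if i = 1 then Y else Z) a b ?_ ?_ <;>
  simp [x, y, z, mul_assoc]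

/-- The identity xy ≈ xyx fixes the order of first occurrences, and in yx²ty the letter y comes
first. -/
theorem not_FIC_nu {u v : Word} (l : List ℕ)
    (hu : nu (y * x ^ 2 * t * y) (FreeMonoid.lift (er l) u))
    (hv : FreeMonoid.lift (er l) v ∉ firstOne) :
    ¬ FIC (varMα nu (y * x ^ 2 * t * y)) u v := by
  intro h
  have h1 := class_of_FIC h (er l) 1 1 (by simpa using hu)
  rw [one_mul, mul_one] at h1
  exact hv ((mem_iff_of_FIC mem_firstOne (nu_iff.1 h1).1).1 (by unfold firstOne; decide))

theorem not_mem_firstOne {p : Word}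
    (h : ((FreeMonoid.toList p).filter (· ∈ [0, 1])).head? ≠ some 1) : p ∉ firstOne := h

theorem nu_cube : nu (y * x ^ 2 * t * y) (y * x ^ 3 * t * y) := by
  refine nu_iff.2 ⟨?_, FIC_xyx_cube y (t * y)⟩
  have := FIC_first y (x * t * y) x 1
  simpa [pow_succ, mul_assoc] using this

/-- An x is again appended on the right. The power x³ makes x occur more than twice on all sides, so
that 𝐌(xyx) imposes no condition on its positions. -/
theorem nonmodular_gam_nu : HasNonmodularSubvarietyLattice
    (varMα gam (x ^ 2 * y) ⊔ varMα nu (y * x ^ 2 * t * y)) := by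
  refine nonmodular_of_swap (u := y * x ^ 3 * t * y) (v := x * y * x ^ 2 * t * y)
    (e₁ := y * x ^ 3 * t * y * x) (e₂ := x * y * x ^ 2 * t * y * x) 3 [t * x, y * y * t, y * y * y]
    keeps_gam (m := 1) (by decide) (by decide) (swapEquiv_of fun φ h h' => ?_)
    (swapEquiv_of fun φ h h' => ?_) ?_ ?_ (not_FIC_nu [] (by exact nu_cube)
      (not_mem_firstOne (by decide))) (fun p hpA hpB => forall_mem_triple ?_ ?_ ?_) (by decide)
    (by decide) (by decide) (by decide) (by decide)
  · simp [x, y, z, t, pow_succ, mul_assoc, h, h']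
  · simp [x, y, z, t, pow_succ, mul_assoc, h, h']
  · refine FIC_varMα_of_FIC (FIC_sup.2 ⟨?_, FIC_xyx_erase (by decide) (by decide) fun φ h => ?_⟩)
    · have := FIC_first y 1 x (x ^ 2 * t * y)
      simpa [pow_succ, mul_assoc] using this
    · simp [x, y, z, t, pow_succ, mul_assoc, h]
  · refine FIC_varMα_of_FIC (FIC_sup.2 ⟨?_, FIC_xyx_erase (by decide) (by decide) fun φ h => ?_⟩)
    · have := FIC_first 1 1 x (y * x ^ 2 * t * y)
      simpa [pow_succ, mul_assoc] using this
    · simp [x, y, z, t, pow_succ, mul_assoc, h]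
  · exact not_sub_gam 3 hpA (by decide) (by decide) (by decide) (by decide)
  all_goals
    exact not_sub_of_pin (fun _ h => (nu_iff.1 h).2) hpB (er []) (by exact nu_cube) 1 3 rfl
      (by decide)

theorem not_FIC_eta {u v : Word} (l : List ℕ)
    (hu : eta (x * y * z * x ^ 2 * t * y) (FreeMonoid.lift (er l) u))
    (hv : FreeMonoid.lift (er l) v ∉ Pre [0, 1] 2 fun _ n => 2 ≤ n) :
    ¬ FIC (varMα eta (x * y * z * x ^ 2 * t * y)) u v := by
  intro h
  have h1 := class_of_FIC h (er l) 1 1 (by simpa using hu)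
  rw [one_mul, mul_one] at h1
  exact hv ((mem_iff_of_FIC (mem_var_eta (by decide) (by decide)) (eta_iff.1 h1).1).1
    ⟨by decide, by decide, by decide⟩)

theorem nonmodular_gam_eta : HasNonmodularSubvarietyLattice
    (varMα gam (x ^ 2 * y) ⊔ varMα eta (x * y * z * x ^ 2 * t * y)) := by
  refine nonmodular_of_swap (u := x * y * z * x ^ 2 * t * y) (v := y * x * z * x ^ 2 * t * y)
    (e₁ := x * y * z * x ^ 2 * t * y * x) (e₂ := y * x * z * x ^ 2 * t * y * x) 3
    [t * x, y * y * t, y * y * y] keeps_gam (m := 1) (by decide) (by decide)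
    (swapEquiv_of fun φ h h' => ?_) (swapEquiv_of fun φ h h' => ?_) ?_ ?_
    (not_FIC_eta [] (by exact eta.refl _) fun h => absurd h.2.1 (by decide))
    (fun p hpA hpB => forall_mem_triple ?_ ?_ ?_) (by decide)
    (by decide) (by decide) (by decide) (by decide)
  · simp [x, y, z, t, pow_succ, mul_assoc, h, h']
  · simp [x, y, z, t, pow_succ, mul_assoc, h, h']
  · refine FIC_varMα_of_FIC (FIC_sup.2 ⟨?_, FIC_xyx_erase (by decide) (by decide) fun φ h => ?_⟩)
    · have := FIC_eta_append 1 1 x (y * z) (x * t * y)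
      simpa [pow_succ, mul_assoc] using this
    · simp [x, y, z, t, pow_succ, mul_assoc, h]
  · refine FIC_varMα_of_FIC (FIC_sup.2 ⟨?_, FIC_xyx_erase (by decide) (by decide) fun φ h => ?_⟩)
    · have := FIC_eta_append y 1 x z (x * t * y)
      simpa [pow_succ, mul_assoc] using this
    · simp [x, y, z, t, pow_succ, mul_assoc, h]
  · exact not_sub_gam 3 hpA (by decide) (by decide) (by decide) (by decide)
  all_goals
    exact not_sub_of_pin (fun _ h => (eta_iff.1 h).2) hpB (er []) (by exact eta.refl _) 1 3 rfl
      (by decide)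

/-- One x moves from the last block to the first. For ν only the first occurrence of x matters once
x occurs three times, but λ keeps the first two apart: a single x precedes t. -/
theorem nonmodular_lam_nu : HasNonmodularSubvarietyLattice
    (varMα lam (x * y * x) ⊔ varMα nu (y * x ^ 2 * t * y)) := by
  have hcl : nu (y * x ^ 2 * t * y) (y * x * t * y * x ^ 2) := by
    refine nu.trans nu_cube (nu_iff.2 ⟨?_, FIC_xyx_erase (by decide) (by decide) fun φ h => ?_⟩)
    · have h1 := FIC_first y (t * y) x 1
      have h2 := FIC_first y (x * t * y) x 1
      have h3 := FIC_first y 1 x (t * y)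
      have h4 := FIC_first y 1 x (t * y * x)
      simp only [one_mul, mul_one, mul_assoc, pow_succ, pow_zero] at h1 h2 h3 h4 ⊢
      exact (FIC _).trans ((FIC _).symm ((FIC _).trans h1 h2)) ((FIC _).trans h3 h4)
    · simp [x, y, z, t, pow_succ, mul_assoc, h]
  refine nonmodular_of_swap (u := y * x * t * y * x ^ 2) (v := x * y * t * y * x ^ 2)
    (e₁ := y * x ^ 2 * t * y * x) (e₂ := x ^ 2 * y * t * y * x) 3 [x * x * t, t * y * y, y * y * y]
    keeps_lam (m := 1) (by decide) (by decide) (swapEquiv_of fun φ h h' => ?_)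
    (swapEquiv_of fun φ h h' => ?_) ?_ ?_ (not_FIC_nu [] (by exact hcl)
      (not_mem_firstOne (by decide))) (fun p hpA hpB => forall_mem_triple ?_ ?_ ?_) (by decide)
    (by decide) (by decide) (by decide) (by decide)
  · simp [x, y, z, t, pow_succ, mul_assoc, h, h']
  · simp [x, y, z, t, pow_succ, mul_assoc, h, h']
  · refine FIC_varMα_of_FIC (FIC_sup.2 ⟨?_, FIC_xyx_erase (by decide) (by decide) fun φ h => ?_⟩)
    · have h1 := FIC_first y 1 x (t * y * x)
      have h2 := FIC_first y (t * y * x) x 1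
      simp only [one_mul, mul_one, mul_assoc, pow_succ, pow_zero] at h1 h2 ⊢
      exact (FIC _).trans ((FIC _).symm h1) h2
    · simp [x, y, z, t, pow_succ, mul_assoc, h]
  · refine FIC_varMα_of_FIC (FIC_sup.2 ⟨?_, FIC_xyx_erase (by decide) (by decide) fun φ h => ?_⟩)
    · have h1 := FIC_first 1 1 x (y * t * y * x)
      have h2 := FIC_first 1 (y * t * y * x) x 1
      simp only [one_mul, mul_one, mul_assoc, pow_succ, pow_zero] at h1 h2 ⊢
      exact (FIC _).trans ((FIC _).symm h1) h2
    · simp [x, y, z, t, pow_succ, mul_assoc, h]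
  · exact not_sub_lam 3 hpA (lam_of (by decide) (by decide)) (by decide)
  all_goals
    exact not_sub_of_pin (fun _ h => (nu_iff.1 h).2) hpB (er []) (by exact hcl) 1 3 rfl
      (by decide)

/-! ### Joins with `𝐌(xyx)` -/

/-- The simple letters `i` and `j` pin x and y to two occurrences each in words equal to `u`, so
cubes serve as the forbidden subwords; in the applications `e₁` and `e₂` contain x three times. -/
theorem nonmodular_xyx {B : Variety} {u v e₁ e₂ : Word} (i j : ℕ)
    (hi : FreeMonoid.lift (two 0 i) u = x * y * x) (hj : FreeMonoid.lift (two 1 j) u = x * y * x)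
    (hi' : ¬ Sub (FreeMonoid.lift (two 0 i) (x * x * x)) (x * y * x))
    (hj' : ¬ Sub (FreeMonoid.lift (two 1 j) (y * y * y)) (x * y * x))
    (huv : SwapEquiv u v) (he : SwapEquiv e₁ e₂)
    (hB₁ : FIC B u e₁) (hB₂ : FIC B v e₂) (hV : ¬ FIC B u v) (hk : occ 3 u = 1)
    (hu : ∀ a ∈ FreeMonoid.toList u, 2 ≤ occ a u → a = 0 ∨ a = 1)
    (ho : (2 ≤ occ 0 u ∧ 2 ≤ occ 1 u) ∧ (2 ≤ occ 0 v ∧ 2 ≤ occ 1 v) ∧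
      (2 ≤ occ 0 e₁ ∧ 2 ≤ occ 1 e₁) ∧ (2 ≤ occ 0 e₂ ∧ 2 ≤ occ 1 e₂))
    (h₁ : Blocked [x * x * x, y * y * y] 3 e₁) (h₂ : Blocked [x * x * x, y * y * y] 3 e₂) :
    HasNonmodularSubvarietyLattice (varM (x * y * x) ⊔ B) := by
  have key := nonmodular_of_swap (α := ⊥) (w := x * y * x) (B := B) 3 [x * x * x, y * y * y]
    keeps_bot (m := 1) (by decide) (by decide) huv he hB₁ hB₂ hV (fun p hpA hpB => ?_) hk hu ho h₁ h₂
  · rwa [← varM_eq] at key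
  · rw [← varM_eq] at hpA
    exact forall_mem_pair (FIC_xyx_avoid hpA 0 i hi hi') (FIC_xyx_avoid hpA 1 j hj hj')

theorem nonmodular_xyx_H : HasNonmodularSubvarietyLattice (varM (x * y * x) ⊔ H) := by
  refine nonmodular_xyx (u := x * y * z * x * t * y) (v := y * x * z * x * t * y)
    (e₁ := x * y * z * x ^ 2 * t * y) (e₂ := y * x * z * x ^ 2 * t * y) 2 3 rfl rfl
    (by decide) (by decide) (swapEquiv_of fun φ h h' => ?_)
    (swapEquiv_of fun φ h h' => ?_) ?_ ?_ ?_ (by decide) (by decide) (by decide) (by decide)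
    (by decide)
  · simp [x, y, z, t, mul_assoc, h, h']
  · simp [x, y, z, t, mul_assoc, h, h']
  · simpa only [one_mul, mul_assoc] using FIC_H_sq 1 (t * y) x (y * z)
  · simpa only [one_mul, mul_assoc] using FIC_H_sq y (t * y) x z
  · intro h
    have := (mem_iff_of_FIC (mem_H (L := [0, 1]) (k := 2) (by decide) (by decide)) h).1
      ⟨by decide, by decide, by decide⟩
    exact absurd this.2.1 (by decide)

theorem nonmodular_xyx_lam_xyzxty : HasNonmodularSubvarietyLattice
    (varM (x * y * x) ⊔ varMα lam (x * y * z * x * t * y)) := by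
  refine nonmodular_xyx (u := x * y * z * x * t * y) (v := y * x * z * x * t * y)
    (e₁ := x * y * z * x ^ 2 * t * y) (e₂ := y * x * z * x ^ 2 * t * y) 2 3 rfl rfl
    (by decide) (by decide) (swapEquiv_of fun φ h h' => ?_)
    (swapEquiv_of fun φ h h' => ?_) ?_ ?_ ?_ (by decide) (by decide) (by decide) (by decide)
    (by decide)
  · simp [x, y, z, t, mul_assoc, h, h']
  · simp [x, y, z, t, mul_assoc, h, h']
  · exact FIC_varMα_lam (c := x * y * z) (d := t * y) (by decide) (by decide) (by decide)
      (by decide) (by decide) (by decide) (by decide)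
  · exact FIC_varMα_lam (c := y * x * z) (d := t * y) (by decide) (by decide) (by decide)
      (by decide) (by decide) (by decide) (by decide)
  · intro h
    have := class_of_FIC h (er []) 1 1 (by exact lam.refl _)
    exact absurd this.1.2 (by decide)

/-- The letter s separates the two x, which lets 𝐌(xyx) pin them; erasing s returns to the class
xx⁺yty⁺. -/
theorem nonmodular_xyx_lam_x2yty : HasNonmodularSubvarietyLattice
    (varM (x * y * x) ⊔ varMα lam (x ^ 2 * y * t * y)) := by
  refine nonmodular_xyx (u := x * s * x * y * t * y) (v := x * s * y * x * t * y)
    (e₁ := x * s * x ^ 2 * y * t * y) (e₂ := x * s * y * x ^ 2 * t * y) 4 3 rfl rfl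
    (by decide) (by decide) (swapEquiv_of fun φ h h' => ?_)
    (swapEquiv_of fun φ h h' => ?_) ?_ ?_ ?_ (by decide) (by decide) (by decide) (by decide)
    (by decide)
  · simp [x, y, s, t, mul_assoc, h, h']
  · simp [x, y, s, t, pow_succ, mul_assoc, h, h']
  · exact FIC_varMα_lam (c := x * s) (d := y * t * y) (by decide) (by decide) (by decide)
      (by decide) (by decide) (by decide) (by decide)
  · exact FIC_varMα_lam (c := x * s * y) (d := t * y) (by decide) (by decide) (by decide)
      (by decide) (by decide) (by decide) (by decide)
  · intro h
    have := class_of_FIC h (er [4]) 1 1 (by exact lam.refl _)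
    exact absurd this.1.2 (by decide)

/-! ### The join `𝐌_λ(xyx⁺) ∨ 𝐌_λ̄(x⁺yx)` -/

theorem mem_lift_zero_of_divides {α : Con Word} (hα : Keeps α) {u : Word} {φ : ℕ → Word}
    (h : Divides α (x * y * x) (FreeMonoid.lift φ u)) (hu : 2 ≤ occ 0 u) :
    ∀ a ∈ FreeMonoid.toList (φ 0), a = 0 := by
  intro a ha
  have h1 := hα.of_divides h hu ha
  by_contra h0
  have h2 : occ a (x * y * x) ≤ 1 := by
    simp only [x, y, occ_mul, occ_of]
    split_ifs <;> omega
  omega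

theorem FIC_lam_xyx {u v : Word} (hu : 2 ≤ occ 0 u) (hv : 2 ≤ occ 0 v)
    (h : ∀ φ : ℕ → Word, (∀ a ∈ FreeMonoid.toList (φ 0), a = 0) →
      lam (FreeMonoid.lift φ u) (FreeMonoid.lift φ v)) : FIC (varMα lam (x * y * x)) u v :=
  FIC_varMα_of fun φ hφ => h φ <| hφ.elim (fun h => mem_lift_zero_of_divides keeps_lam h hu)
    fun h => mem_lift_zero_of_divides keeps_lam h hv

/-- Read from right to left, instances of `u` and `v` become instances of the reversed words `u'`
and `v'`, where λ can be used. -/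
theorem FIC_dual_lam_xyx {u v u' v' : Word} (hu : 2 ≤ occ 0 u) (hv : 2 ≤ occ 0 v)
    (hu' : ∀ φ : ℕ → Word, (FreeMonoid.lift φ u).reverse =
      FreeMonoid.lift (fun i => (φ i).reverse) u')
    (hv' : ∀ φ : ℕ → Word, (FreeMonoid.lift φ v).reverse =
      FreeMonoid.lift (fun i => (φ i).reverse) v')
    (h : ∀ φ : ℕ → Word, (∀ a ∈ FreeMonoid.toList (φ 0), a = 0) →
      lam (FreeMonoid.lift φ u') (FreeMonoid.lift φ v')) :
    FIC (varMα (dualCon lam) (x * y * x)) u v := by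
  have key : ∀ φ : ℕ → Word, (∀ a ∈ FreeMonoid.toList (φ 0), a = 0) →
      dualCon lam (FreeMonoid.lift φ u) (FreeMonoid.lift φ v) := by
    intro φ hφ
    change lam (FreeMonoid.lift φ u).reverse (FreeMonoid.lift φ v).reverse
    rw [hu', hv']
    refine h _ fun a ha => hφ a ?_
    have : a ∈ (FreeMonoid.toList (φ 0)).reverse := ha
    simpa using this
  exact FIC_varMα_of fun φ hφ => key φ <| hφ.elim
    (fun h => mem_lift_zero_of_divides (keeps_dualCon keeps_lam) h hu)
    fun h => mem_lift_zero_of_divides (keeps_dualCon keeps_lam) h hv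

/-- One variety ignores the exponent of x after y in these words, the other the exponent before y. A
word equal to xyx in both avoids xxy and yxx, hence has at most two x; an instance of `e₁` or `e₂`
has at least three copies of the image of x, which must therefore be empty. -/
theorem nonmodular_lam_dual : HasNonmodularSubvarietyLattice
    (varMα lam (x * y * x) ⊔ varMα (dualCon lam) (x * y * x)) := by
  refine nonmodular_of (e₁ := x ^ 2 * y * x) (e₂ := x ^ 2 * y * x ^ 2) (u := x * y * x)
    (v := x * y * x ^ 2) ?_ ?_ (inf_le_of_FIC ?_ ?_) ?_ ?_
  · refine FIC_lam_xyx (by decide) (by decide) fun φ hφ => ?_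
    simpa only [mul_one] using lam_lift_sq (c := x ^ 2 * y) (d := 1) (by decide) hφ
  · refine FIC_lam_xyx (by decide) (by decide) fun φ hφ => ?_
    simpa only [mul_one] using lam_lift_sq (c := x * y) (d := 1) (by decide) hφ
  · refine FIC_dual_lam_xyx (u' := x * y * x) (v' := x * y * x ^ 2) (by decide) (by decide)
      (fun φ => ?_) (fun φ => ?_) fun φ hφ => ?_
    · simp [x, y, FreeMonoid.reverse_mul, pow_succ, mul_assoc]
    · simp [x, y, FreeMonoid.reverse_mul, pow_succ, mul_assoc]
    · simpa only [mul_one] using lam_lift_sq (c := x * y) (d := 1) (by decide) hφ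
  · refine FIC_dual_lam_xyx (u' := x ^ 2 * y * x) (v' := x ^ 2 * y * x ^ 2) (by decide) (by decide)
      (fun φ => ?_) (fun φ => ?_) fun φ hφ => ?_
    · simp [x, y, FreeMonoid.reverse_mul, pow_succ, mul_assoc]
    · simp [x, y, FreeMonoid.reverse_mul, pow_succ, mul_assoc]
    · simpa only [mul_one] using lam_lift_sq (c := x ^ 2 * y) (d := 1) (by decide) hφ
  · intro h
    have h1 := class_of_FIC (FIC_sup.1 h).2 FreeMonoid.of 1 1 (by exact (dualCon lam).refl _)
    have h2 := h1.2 0 (by decide)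
    exact absurd (h2.2 (by decide)) (by decide)
  · intro p hp φ a b hab
    obtain ⟨hA, hB⟩ := FIC_sup.1 hp
    have hkeep := keeps_FIC_varMα keeps_lam (w := x * y * x) (k := 1) (by decide) _ _ hA
    have h1 : ¬ Sub (x * x * y) p := not_sub_lam 1 hA (by exact lam.refl _) (by decide)
    have h2 : ¬ Sub (y * x * x) p := by
      refine not_sub_of_class hB FreeMonoid.of 1 1 (by exact (dualCon lam).refl _) fun q hq hs => ?_
      have hs' : Sub (y * x * x) q := by simpa [x, y] using hs
      exact not_sub_of_lam (a := 0) (b := 1) hq (by decide) (by decide) (by decide) (by decide)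
        (List.reverse_sublist.2 hs')
    have hzero : ∀ c : Word, ¬ Sub (x * x) c → occ 0 c ≤ 1 := by
      intro c hc
      by_contra h
      exact hc (List.replicate_sublist_iff.2 (show 2 ≤ (FreeMonoid.toList c).count 0 by
        change ¬ occ 0 c ≤ 1 at h
        unfold occ at h
        omega))
    have h0 : occ 0 p ≤ 2 := by
      obtain ⟨c, d, rfl, -⟩ := exists_eq_of_occ (k := 1) (p := p) (by
        have := hkeep 1
        rw [show occ 1 (x * y * x) = 1 by decide] at this
        omega)
      have hc := hzero c fun h => h1 (by
        simpa [y] using (h.mul (Sub.refl y)).mul (one_sub d))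
      have hd := hzero d fun h => h2 (by
        simpa [mul_assoc, y] using (one_sub c).mul ((Sub.refl y).mul h))
      simp only [occ_mul, occ_of]
      simp
      omega
    have hφ : φ 0 = 1 := by
      refine FreeMonoid.toList.injective (List.eq_nil_iff_forall_not_mem.2 fun g hg => ?_)
      rw [mem_iff_occ] at hg
      have h3 : 3 ≤ occ g p := by
        have e1 := mul_occ_le_occ_lift φ g 0 (x ^ 2 * y * x)
        have e2 := mul_occ_le_occ_lift φ g 0 (x ^ 2 * y * x ^ 2)
        rw [show occ 0 (x ^ 2 * y * x) = 3 by decide] at e1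
        rw [show occ 0 (x ^ 2 * y * x ^ 2) = 4 by decide] at e2
        rcases hab with rfl | rfl <;> simp only [occ_mul] at e1 e2 ⊢ <;> omega
      have h4 := hkeep g
      have h5 : 2 ≤ occ g (x * y * x) → g = 0 := by
        simp only [x, y, occ_mul, occ_of]
        intro h
        by_contra hne
        split_ifs at h <;> omega
      obtain rfl := h5 (by omega)
      omega
    simp [x, y, hφ]

/-! ### Joins with `𝐌(xyxzx)` -/

theorem FIC_varM_pin {w u p : Word} (h : FIC (varM w) u p) (φ : ℕ → Word) (a b : Word)
    (hu : w = a * FreeMonoid.lift φ u * b) : a * FreeMonoid.lift φ p * b = w := by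
  rw [varM_eq] at h
  exact (show w = _ from class_of_FIC h φ a b hu).symm

/-- The letters `i` and `j` separate three occurrences of x in `u`, so words equal to `u` avoid x⁴;
y is pinned by one letter. In the applications `e₁` and `e₂` contain x four times. -/
theorem nonmodular_xyxzx {B : Variety} {u v e₁ e₂ : Word} (i j l : ℕ)
    (hx : x * y * x * z * x = FreeMonoid.lift
      (fun n => if n = 0 then x else if n = i then y else if n = j then z else 1) u)
    (hy : x * y * x = FreeMonoid.lift (two 1 l) u)
    (huv : SwapEquiv u v) (he : SwapEquiv e₁ e₂)
    (hB₁ : FIC B u e₁) (hB₂ : FIC B v e₂) (hV : ¬ FIC B u v) (hk : occ 3 u = 1)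
    (hu : ∀ a ∈ FreeMonoid.toList u, 2 ≤ occ a u → a = 0 ∨ a = 1)
    (ho : (2 ≤ occ 0 u ∧ 2 ≤ occ 1 u) ∧ (2 ≤ occ 0 v ∧ 2 ≤ occ 1 v) ∧
      (2 ≤ occ 0 e₁ ∧ 2 ≤ occ 1 e₁) ∧ (2 ≤ occ 0 e₂ ∧ 2 ≤ occ 1 e₂))
    (h₁ : Blocked [x * x * x * x, y * y * y * y] 3 e₁)
    (h₂ : Blocked [x * x * x * x, y * y * y * y] 3 e₂) :
    HasNonmodularSubvarietyLattice (varM (x * y * x * z * x) ⊔ B) := by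
  have key := nonmodular_of_swap (α := ⊥) (w := x * y * x * z * x) (B := B) 3
    [x * x * x * x, y * y * y * y] keeps_bot (m := 1) (by decide) (by decide) huv he hB₁ hB₂ hV
    (fun p hpA hpB => ?_) hk hu ho h₁ h₂
  · rwa [← varM_eq] at key
  · refine forall_mem_pair ?_ ?_
    · refine not_sub_of_class hpA _ 1 1 (by rw [one_mul, mul_one, ← hx]; exact rfl)
        fun q hq => ?_
      obtain rfl := show x * y * x * z * x = q from hq
      simp only [x, map_mul, FreeMonoid.lift_eval_of, if_true]
      decide
    -- The context zx completes the image xyx of `u` to xyxzx.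
    · refine not_sub_of_class hpA (two 1 l) 1 (z * x) (by
        rw [one_mul, ← hy, ← mul_assoc]; exact rfl) fun q hq => ?_
      obtain rfl := show x * y * x * z * x = q from hq
      simp only [y, map_mul, FreeMonoid.lift_eval_of, two, if_true]
      decide

theorem nonmodular_xyxzx_nu : HasNonmodularSubvarietyLattice
    (varM (x * y * x * z * x) ⊔ varMα nu (y * x ^ 2 * t * y)) := by
  have hcl : nu (y * x ^ 2 * t * y) (y * x * x * t * x * y) := by
    refine nu_iff.2 ⟨?_, (FIC _).trans (FIC_xyx_cube y (t * y))
      (FIC_xyx_erase (by decide) (by decide) fun φ h => ?_)⟩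
    · simpa [pow_succ, mul_assoc] using FIC_first y y x (x * t)
    · simp [x, y, z, t, pow_succ, mul_assoc, h]
  refine nonmodular_xyxzx (u := y * x * z * x * t * x * y) (v := x * y * z * x * t * x * y)
    (e₁ := y * x * z * x * t * x ^ 2 * y) (e₂ := x * y * z * x * t * x ^ 2 * y) 2 3 2 rfl rfl (swapEquiv_of fun φ h h' => ?_) (swapEquiv_of fun φ h h' => ?_)
    ?_ ?_ (not_FIC_nu [2] (by exact hcl) (not_mem_firstOne (by decide))) (by decide) (by decide)
    (by decide) (by decide) (by decide)
  · simp [x, y, z, t, pow_succ, mul_assoc, h, h']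
  · simp [x, y, z, t, pow_succ, mul_assoc, h, h']
  · refine FIC_varMα_of_FIC (FIC_sup.2 ⟨?_, FIC_xyx_erase (by decide) (by decide) fun φ h => ?_⟩)
    · simpa [pow_succ, mul_assoc] using FIC_first y y x (z * x * t * x)
    · simp [x, y, z, t, pow_succ, mul_assoc, h]
  · refine FIC_varMα_of_FIC (FIC_sup.2 ⟨?_, FIC_xyx_erase (by decide) (by decide) fun φ h => ?_⟩)
    · simpa [pow_succ, mul_assoc] using FIC_first 1 y x (y * z * x * t * x)
    · simp [x, y, z, t, pow_succ, mul_assoc, h]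

theorem not_FIC_gam' {w u v : Word} (l : List ℕ) (hu : gam' w (FreeMonoid.lift (er l) u))
    (hv : squash w ≠ squash (FreeMonoid.lift (er l) v)) : ¬ FIC (varMα gam' w) u v := by
  intro h
  have h1 := class_of_FIC h (er l) 1 1 (by simpa using hu)
  rw [one_mul, mul_one] at h1
  exact hv (gam'_iff.1 h1).1.2

/-- The letters s and z only separate the x; erasing them leaves yx³ty, a member of the class
yxx⁺ty. -/
theorem nonmodular_xyxzx_gam'_yx2ty : HasNonmodularSubvarietyLattice
    (varM (x * y * x * z * x) ⊔ varMα gam' (y * x ^ 2 * t * y)) := by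
  have hcl : gam' (y * x ^ 2 * t * y) (y * x ^ 3 * t * y) :=
    gam'_iff.2 ⟨gam_of (by decide) (by decide), FIC_xyx_cube y (t * y)⟩
  refine nonmodular_xyxzx (u := y * x * s * x * z * x * t * y) (v := x * y * s * x * z * x * t * y)
    (e₁ := y * x * s * x * z * x ^ 2 * t * y) (e₂ := x * y * s * x * z * x ^ 2 * t * y) 4 2 3 rfl rfl (swapEquiv_of fun φ h h' => ?_)
    (swapEquiv_of fun φ h h' => ?_)
    (FIC_varMα_gam'_of 3 rfl (by decide) (by decide) (by decide) (fun φ h => ?_) fun φ h h' => ?_)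
    (FIC_varMα_gam'_of 3 rfl (by decide) (by decide) (by decide) (fun φ h => ?_) fun φ h h' => ?_)
    (not_FIC_gam' [2, 4] (by exact hcl) (by decide)) (by decide) (by decide)
    (by decide) (by decide) (by decide)
  all_goals first
  | simp [x, y, z, t, s, pow_succ, mul_assoc, h, h']
  | simp [x, y, z, t, s, pow_succ, mul_assoc, h]

theorem nonmodular_xyxzx_gam'_x2yty : HasNonmodularSubvarietyLattice
    (varM (x * y * x * z * x) ⊔ varMα gam' (x ^ 2 * y * t * y)) := by
  have hcl : gam' (x ^ 2 * y * t * y) (x ^ 3 * y * t * y) :=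
    gam'_iff.2 ⟨gam_of (by decide) (by decide), by exact FIC_xyx_cube 1 (y * t * y)⟩
  refine nonmodular_xyxzx (u := x * s * x * z * x * y * t * y) (v := x * s * x * z * y * x * t * y)
    (e₁ := x * s * x * z * x ^ 2 * y * t * y) (e₂ := x * s * x * z * y * x ^ 2 * t * y) 4 2 3 rfl rfl (swapEquiv_of fun φ h h' => ?_)
    (swapEquiv_of fun φ h h' => ?_)
    (FIC_varMα_gam'_of 3 rfl (by decide) (by decide) (by decide) (fun φ h => ?_) fun φ h h' => ?_)
    (FIC_varMα_gam'_of 3 rfl (by decide) (by decide) (by decide) (fun φ h => ?_) fun φ h h' => ?_)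
    (not_FIC_gam' [2, 4] (by exact hcl) (by decide)) (by decide) (by decide)
    (by decide) (by decide) (by decide)
  all_goals first
  | simp [x, y, z, t, s, pow_succ, mul_assoc, h, h']
  | simp [x, y, z, t, s, pow_succ, mul_assoc, h]

theorem not_FIC_lam' {w u v : Word} (l : List ℕ) (hu : w = FreeMonoid.lift (er l) u)
    (hv : squash w ≠ squash (FreeMonoid.lift (er l) v)) : ¬ FIC (varMα lam' w) u v := by
  intro h
  have h1 := class_of_FIC h (er l) 1 1 (by rw [one_mul, mul_one, ← hu]; exact lam'.refl _)
  rw [one_mul, mul_one] at h1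
  have h2 : lam w (FreeMonoid.lift (er l) v) := h1.1
  exact hv h2.1.2

theorem nonmodular_xyxzx_lam'_xyzx2ty : HasNonmodularSubvarietyLattice
    (varM (x * y * x * z * x) ⊔ varMα lam' (x * y * z * x ^ 2 * t * y)) := by
  refine nonmodular_xyxzx (u := x * y * z * x * s * x * t * y) (v := y * x * z * x * s * x * t * y)
    (e₁ := x * y * z * x * s * x ^ 2 * t * y) (e₂ := y * x * z * x * s * x ^ 2 * t * y) 2 4 2 rfl rfl (swapEquiv_of fun φ h h' => ?_)
    (swapEquiv_of fun φ h h' => ?_)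
    (FIC_varMα_lam' (c := x * y * z * x * s) (d := t * y) 2 rfl (by decide) (by decide) (by decide)
      (FIC_xyx_erase (by decide) (by decide) fun φ h => ?_))
    (FIC_varMα_lam' (c := y * x * z * x * s) (d := t * y) 2 rfl (by decide) (by decide) (by decide)
      (FIC_xyx_erase (by decide) (by decide) fun φ h => ?_))
    (not_FIC_lam' [4] rfl (by decide)) (by decide) (by decide) (by decide) (by decide) (by decide)
  all_goals first
  | simp [x, y, z, t, s, pow_succ, mul_assoc, h, h']
  | simp [x, y, z, t, s, pow_succ, mul_assoc, h]

theorem nonmodular_xyxzx_lam'_xyzytx2 : HasNonmodularSubvarietyLattice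
    (varM (x * y * x * z * x) ⊔ varMα lam' (x * y * z * y * t * x ^ 2)) := by
  refine nonmodular_xyxzx (u := x * y * z * y * t * x * s * x) (v := y * x * z * y * t * x * s * x)
    (e₁ := x * y * z * y * t * x * s * x ^ 2) (e₂ := y * x * z * y * t * x * s * x ^ 2) 2 4 2 rfl rfl (swapEquiv_of fun φ h h' => ?_)
    (swapEquiv_of fun φ h h' => ?_)
    (FIC_varMα_lam' (c := x * y * z * y * t * x * s) (d := 1) 2 rfl (by decide) (by decide)
      (by decide) (FIC_xyx_erase (by decide) (by decide) fun φ h => ?_))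
    (FIC_varMα_lam' (c := y * x * z * y * t * x * s) (d := 1) 2 rfl (by decide) (by decide)
      (by decide) (FIC_xyx_erase (by decide) (by decide) fun φ h => ?_))
    (not_FIC_lam' [4] rfl (by decide)) (by decide) (by decide) (by decide) (by decide) (by decide)
  all_goals first
  | simp [x, y, z, t, s, pow_succ, mul_assoc, h, h']
  | simp [x, y, z, t, s, pow_succ, mul_assoc, h]

theorem nonmodular_xyxzx_lam'_yzyxtx2 : HasNonmodularSubvarietyLattice
    (varM (x * y * x * z * x) ⊔ varMα lam' (y * z * y * x * t * x ^ 2)) := by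
  refine nonmodular_xyxzx (u := y * z * y * x * t * x * s * x) (v := y * z * x * y * t * x * s * x)
    (e₁ := y * z * y * x * t * x * s * x ^ 2) (e₂ := y * z * x * y * t * x * s * x ^ 2) 3 4 2 rfl rfl (swapEquiv_of fun φ h h' => ?_)
    (swapEquiv_of fun φ h h' => ?_)
    (FIC_varMα_lam' (c := y * z * y * x * t * x * s) (d := 1) 2 rfl (by decide) (by decide)
      (by decide) (FIC_xyx_erase (by decide) (by decide) fun φ h => ?_))
    (FIC_varMα_lam' (c := y * z * x * y * t * x * s) (d := 1) 2 rfl (by decide) (by decide)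
      (by decide) (FIC_xyx_erase (by decide) (by decide) fun φ h => ?_))
    (not_FIC_lam' [4] rfl (by decide)) (by decide) (by decide) (by decide) (by decide) (by decide)
  all_goals first
  | simp [x, y, z, t, s, pow_succ, mul_assoc, h, h']
  | simp [x, y, z, t, s, pow_succ, mul_assoc, h]

/-! ### Joins with `𝐌_μ(xyxzx⁺)` -/

theorem le_occ_iff_sub {g n : ℕ} {p : Word} : n ≤ occ g p ↔ Sub (FreeMonoid.of g ^ n) p := by
  unfold Sub
  rw [toList_of_pow, List.replicate_sublist_iff]
  rfl

theorem Pre.sub_mul_of {L : List ℕ} {k : ℕ} {C : ℕ → ℕ → Prop} {q : Word} (h : q ∈ Pre L k C) :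
    Sub (FreeMonoid.ofList L * FreeMonoid.of k) q := by
  obtain ⟨a, b, rfl, ha⟩ := exists_eq_of_occ h.1.ge
  have h2 := h.2.1
  rw [mul_assoc, before_mul_of_not_mem ha, before_mul_of_mem (by simp [occ_of])] at h2
  have h3 : before k (FreeMonoid.of k) = [] := by simp [before]
  rw [h3, List.append_nil] at h2
  have h4 : Sub (FreeMonoid.ofList L) a := by
    unfold Sub
    rw [FreeMonoid.toList_ofList]
    conv_lhs => rw [← h2]
    exact List.filter_sublist
  simpa using (h4.mul (Sub.refl (FreeMonoid.of k))).mul (one_sub b)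

/-- The substitution sending `c₀`, `c₁`, `c₂` to `x`, `y`, `z` and erasing the other letters. -/
def three (c₀ c₁ c₂ i : ℕ) : Word := if i = c₀ then x else if i = c₁ then y else if i = c₂ then z else 1

theorem occ_zero_lift_three {c₀ c₁ c₂ : ℕ} (p : Word) :
    occ 0 (FreeMonoid.lift (three c₀ c₁ c₂) p) = occ c₀ p := by
  induction p using FreeMonoid.inductionOn' with
  | one => rfl
  | of_mul b u ih =>
    rw [map_mul, FreeMonoid.lift_eval_of, occ_mul, occ_mul, ih, occ_of]
    unfold three
    split_ifs <;> simp [x, y, z, occ_of, occ_one]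

theorem nonmodular_mu {B : Variety}
    (hB₁ : FIC B (x * y * z * x * t * y * s * x) (x * y * z * x ^ 2 * t * y * s * x))
    (hB₂ : FIC B (y * x * z * x * t * y * s * x) (y * x * z * x ^ 2 * t * y * s * x))
    (hV : ¬ FIC B (x * y * z * x * t * y * s * x) (y * x * z * x * t * y * s * x)) :
    HasNonmodularSubvarietyLattice (varMα mu (x * y * x * z * x) ⊔ B) := by
  refine nonmodular_of_swap 4 [x * x * x * s, s * y, y * y * y] keeps_mu (m := 1) (by decide)
    (by decide) (swapEquiv_of fun φ h h' => ?_) (swapEquiv_of fun φ h h' => ?_) hB₁ hB₂ hV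
    (fun p hpA hpB => ?_) (by decide) (by decide) (by decide) (by decide) (by decide)
  · simp [x, y, z, t, s, pow_succ, mul_assoc, h, h']
  · simp [x, y, z, t, s, pow_succ, mul_assoc, h, h']
  have hy : ¬ Sub (y * y * y) p := by
    refine not_sub_of_class hpA (two 1 2) 1 (z * x) (by exact mu.refl _) fun q hq hs => ?_
    have h1 : Sub (x * x * x * z) q := Sub.trans (by decide) hs
    exact absurd (Pre.sub (f := x * x * x) (mem_muClass hq) (by decide) h1) (by decide)
  refine forall_mem_triple ?_ (fun hs => hy ?_) hy
  -- Restricted to x, z, s, the word `u` becomes a copy of xyxzx with s in the role of z, before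
  -- which only two x are allowed.
  · refine not_sub_of_class hpA (three 0 2 4) 1 1 (by exact mu.refl _) fun q hq hs => ?_
    have h1 : Sub (x * x * x * z) q := by exact hs
    exact absurd (Pre.sub (f := x * x * x) (mem_muClass hq) (by decide) h1) (by decide)
  -- Two y already precede s in `p`, so a y after s would be the third; the image shows four x, one
  -- of them coming from the context.
  · have hq : FreeMonoid.lift (three 1 2 4) p * x ∈ muClass := by
      have := mem_muClass (class_of_FIC hpA (three 1 2 4) 1 x (by exact mu.refl _))
      rwa [one_mul] at this
    have h1 : Sub (x * y * x * z) (FreeMonoid.lift (three 1 2 4) p * x) := Pre.sub_mul_of hq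
    have h2 : Sub (z * (x * x)) (FreeMonoid.lift (three 1 2 4) p * x) :=
      (hs.lift (three 1 2 4)).mul (Sub.refl x)
    have h3 := (Sub.glue hq.1 h1 h2).occ_le 0
    have h4 : occ 0 (FreeMonoid.lift (three 1 2 4) p * x) = occ 1 p + 1 := by
      rw [occ_mul, occ_zero_lift_three]
      rfl
    rw [h4, show occ 0 (x * y * x * FreeMonoid.of 2 * (x * x)) = 4 by decide] at h3
    exact le_occ_iff_sub.1 (show 3 ≤ occ 1 p by omega)

theorem nonmodular_mu_lam' : HasNonmodularSubvarietyLattice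
    (varMα mu (x * y * x * z * x) ⊔ varMα lam' (x * y * z * x * t * y * s * x)) := by
  refine nonmodular_mu
    (FIC_varMα_lam' (c := x * y * z) (d := t * y * s * x) 2 rfl (by decide) (by decide)
      (by decide) (FIC_xyx_erase (by decide) (by decide) fun φ h => ?_))
    (FIC_varMα_lam' (c := y * x * z) (d := t * y * s * x) 2 rfl (by decide) (by decide)
      (by decide) (FIC_xyx_erase (by decide) (by decide) fun φ h => ?_))
    (not_FIC_lam' [] rfl (by decide))
  all_goals simp [x, y, z, t, s, pow_succ, mul_assoc, h]

theorem nonmodular_mu_eta : HasNonmodularSubvarietyLattice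
    (varMα mu (x * y * x * z * x) ⊔ varMα eta (x * y * z * x ^ 2 * t * y)) := by
  have hcl : eta (x * y * z * x ^ 2 * t * y) (x * y * z * x * t * y * x) := by
    refine eta_iff.2 ⟨?_, FIC_xyx_erase (by decide) (by decide) fun φ h => ?_⟩
    · have h1 := FIC_eta_append 1 (t * y) x (y * z) 1
      have h2 := FIC_eta_append 1 1 x (y * z) (t * y)
      simp only [one_mul, mul_one, mul_assoc, pow_succ, pow_zero] at h1 h2 ⊢
      exact (FIC _).trans ((FIC _).symm h1) h2
    · simp [x, y, z, t, s, pow_succ, mul_assoc, h]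
  refine nonmodular_mu
    (FIC_varMα_of_FIC (FIC_sup.2 ⟨?_, FIC_xyx_erase (by decide) (by decide) fun φ h => ?_⟩))
    (FIC_varMα_of_FIC (FIC_sup.2 ⟨?_, FIC_xyx_erase (by decide) (by decide) fun φ h => ?_⟩))
    (not_FIC_eta [4] (by exact hcl) fun h => absurd h.2.1 (by decide))
  · have := FIC_eta_append 1 (t * y * s * x) x (y * z) 1
    simpa [pow_succ, mul_assoc] using this
  · simp [x, y, z, t, s, pow_succ, mul_assoc, h]
  · have := FIC_eta_append y (t * y * s * x) x z 1
    simpa [pow_succ, mul_assoc] using this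
  · simp [x, y, z, t, s, pow_succ, mul_assoc, h]

/-! ### Joins with `𝐍` -/

theorem exists_mem_ne_of_not_commute {u v : Word} (h : u * v ≠ v * u) :
    ∃ c d, 1 ≤ occ c u ∧ 1 ≤ occ d v ∧ c ≠ d := by
  by_contra! hc
  cases hu : FreeMonoid.toList u with
  | nil =>
    obtain rfl : u = 1 := FreeMonoid.toList.injective hu
    simp at h
  | cons m l =>
    have hm : ∀ d, 1 ≤ occ d v → m = d := fun d hd => hc m d (mem_iff_occ.1 (by simp [hu])) hd
    cases hv : FreeMonoid.toList v with
    | nil =>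
      obtain rfl : v = 1 := FreeMonoid.toList.injective hv
      simp at h
    | cons n k =>
      obtain rfl := hm n (mem_iff_occ.1 (by simp [hv]))
      refine h (commute_of_forall_mem (m := m) (fun a ha => ?_) fun a ha => ?_)
      · exact hc a m (mem_iff_occ.1 ha) (mem_iff_occ.1 (by simp [hv]))
      · exact (hm a (mem_iff_occ.1 ha)).symm

theorem eq_of_of_occ {c : ℕ} {X : Word} (hc : occ c X = 1) (h : ∀ a, a ≠ c → occ a X = 0) :
    X = FreeMonoid.of c := by
  obtain ⟨i, rfl⟩ := eq_pow_of_forall_mem (m := c) (u := X) fun a ha => by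
    by_contra hac
    rw [mem_iff_occ, h a hac] at ha
    omega
  rw [occ_pow, occ_of] at hc
  obtain rfl : i = 1 := by simpa using hc
  rw [pow_one]

/-- If no word containing the pattern `xyxy` or `yxxy` of two letters is a factor of `w`, then
`𝐌(w)` satisfies the identities which permute two letters in such words. -/
theorem FIC_varM_of_pattern {w u v : Word}
    (hw : ∀ a ∈ FreeMonoid.toList w, occ a w = 2 ∧ (a = 0 ∨ a = 1) ∨ occ a w = 1)
    (hs : SwapEquiv u v) (hu : Sub (x * y * x * y) u) (hv : Sub (y * x * x * y) v)
    (h₁ : ¬ Sub (y * x * y * x) w) (h₂ : ¬ Sub (y * x * x * y) w) (h₃ : ¬ Sub (x * y * y * x) w)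
    (h₄ : ∀ φ : ℕ → Word, φ 0 = x → φ 1 = y → ∀ a b, w ≠ a * FreeMonoid.lift φ u * b) :
    FIC (varM w) u v := by
  rw [varM_eq]
  refine FIC_varMα_of fun φ hφ => ?_
  by_contra hne
  have hcomm : φ 0 * φ 1 ≠ φ 1 * φ 0 := fun h => hne (by rw [hs φ h]; exact Con.refl _ _)
  obtain ⟨c, d, hc, hd, hcd⟩ := exists_mem_ne_of_not_commute hcomm
  have hocc : ∀ g, 2 * occ g (φ 0) + 2 * occ g (φ 1) ≤ occ g w := by
    intro g
    rcases hφ with ⟨a, b, h⟩ | ⟨a, b, h⟩ <;> rw [show w = _ from h]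
    · have := ((hu.lift φ).of_context a b).occ_le g
      simp only [x, y, map_mul, FreeMonoid.lift_eval_of, occ_mul] at this ⊢
      omega
    · have := ((hv.lift φ).of_context a b).occ_le g
      simp only [x, y, map_mul, FreeMonoid.lift_eval_of, occ_mul] at this ⊢
      omega
  have hle : ∀ g, occ g (φ 0) + occ g (φ 1) ≤ 1 ∧ (1 ≤ occ g (φ 0) + occ g (φ 1) → g = 0 ∨ g = 1) := by
    intro g
    have h1 := hocc g
    by_cases hg : g ∈ FreeMonoid.toList w
    · rcases hw g hg with ⟨h2, h3⟩ | h2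
      · exact ⟨by omega, fun _ => h3⟩
      · omega
    · rw [mem_iff_occ] at hg
      omega
  -- Letters of the images must occur twice in `w`, so they are x and y, and the counts leave room
  -- for each of them only once.
  have key : φ 0 = FreeMonoid.of c ∧ φ 1 = FreeMonoid.of d := by
    have hc' := hle c
    have hd' := hle d
    constructor
    · refine eq_of_of_occ (by omega) fun a ha => ?_
      have := hle a
      by_cases had : a = d
      · subst had; omega
      · omega
    · refine eq_of_of_occ (by omega) fun a ha => ?_
      have := hle a
      by_cases had : a = c
      · subst had; omega
      · omega
  have hsub : (∃ a b, w = a * FreeMonoid.lift φ u * b) ∨ Sub (FreeMonoid.lift φ (y * x * x * y)) w := by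
    rcases hφ with ⟨a, b, h⟩ | ⟨a, b, h⟩
    · exact Or.inl ⟨a, b, h⟩
    · refine Or.inr ?_
      rw [show w = _ from h]
      exact (hv.lift φ).of_context a b
  have h01 : c = 0 ∧ d = 1 ∨ c = 1 ∧ d = 0 := by
    have hc' := (hle c).2 (by omega)
    have hd' := (hle d).2 (by omega)
    omega
  rcases h01 with ⟨rfl, rfl⟩ | ⟨rfl, rfl⟩
  · rcases hsub with ⟨a, b, h⟩ | h
    · exact h₄ φ key.1 key.2 a b h
    · refine h₂ ?_
      simpa [x, y, key.1, key.2] using h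
  · rcases hsub with ⟨a, b, h⟩ | h
    · refine h₁ ?_
      rw [h]
      have := (hu.lift φ).of_context a b
      simpa [x, y, key.1, key.2] using this
    · refine h₃ ?_
      simpa [x, y, key.1, key.2] using h

/-- A word in which `z` is simple and lies between the occurrences of `x`, between those of `y`
and before those of `s` can contain the images of `xyzxy` and `yxzxy` in a non-trivial way
only if the images of the first two letters contain `x` and `y`. -/
theorem exists_split {p : Word} (hm : ∀ g, 2 ≤ occ g p → g = 0 ∨ g = 1 ∨ g = 4)
    (h2 : occ 2 p = 1) (hn : ∀ f ∈ [z * x * x, x * x * z, z * y * y, y * y * z, s * z], ¬ Sub f p)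
    {φ : ℕ → Word} {a b : Word} (hp : p = a * FreeMonoid.lift φ (x * y * z * x * y) * b ∨
      p = a * FreeMonoid.lift φ (y * x * z * x * y) * b) (hne : φ 0 * φ 1 ≠ φ 1 * φ 0) :
    ∃ a H Z K b, p = a * H * Z * K * b ∧ (∀ g, occ g H = occ g K) ∧ 1 ≤ occ 0 K ∧ 1 ≤ occ 1 K ∧
      occ 4 K = 0 ∧ 1 ≤ occ 2 Z := by
  obtain ⟨c, d, hc, hd, hcd⟩ := exists_mem_ne_of_not_commute hne
  obtain ⟨a, H, Z, K, b, rfl, hHK, hcK, hdK⟩ : ∃ a H Z K b, p = a * H * Z * K * b ∧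
      (∀ g, occ g H = occ g K) ∧ 1 ≤ occ c K ∧ 1 ≤ occ d K := by
    rcases hp with rfl | rfl
    · refine ⟨a, φ 0 * φ 1, φ 2, φ 0 * φ 1, b, ?_, fun _ => rfl, ?_, ?_⟩
      · simp [x, y, z, mul_assoc]
      · rw [occ_mul]; omega
      · rw [occ_mul]; omega
    · refine ⟨a, φ 1 * φ 0, φ 2, φ 0 * φ 1, b, ?_, fun _ => ?_, ?_, ?_⟩
      · simp [x, y, z, mul_assoc]
      · rw [occ_mul, occ_mul, add_comm]
      · rw [occ_mul]; omega
      · rw [occ_mul]; omega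
  simp only [List.mem_cons, List.not_mem_nil, or_false, forall_eq_or_imp, forall_eq] at hn
  obtain ⟨n1, n2, n3, n4, n5⟩ := hn
  have hm' : ∀ g, 1 ≤ occ g K → g = 0 ∨ g = 1 ∨ g = 4 := fun g hg => by
    refine hm g ?_
    have := hHK g
    simp only [occ_mul]
    omega
  -- If z lay outside `Z`, the copies of `g` in `H` and `K` would be on the same side of it.
  have hmid : ∀ g, 1 ≤ occ g K → ¬ Sub (z * FreeMonoid.of g * FreeMonoid.of g) (a * H * Z * K * b) →
      ¬ Sub (FreeMonoid.of g * FreeMonoid.of g * z) (a * H * Z * K * b) → 1 ≤ occ 2 Z := by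
    intro g hg h3 h4
    have hH := hHK g
    have h2' := hHK 2
    simp only [occ_mul] at h2
    by_contra hZ
    have hab : 1 ≤ occ 2 a ∨ 1 ≤ occ 2 b := by omega
    rcases hab with h | h
    · refine h3 ?_
      have := (((of_sub_iff.2 h).mul (of_sub_iff.2 (hH ▸ hg : 1 ≤ occ g H))).mul (one_sub Z)).mul
        (of_sub_iff.2 hg) |>.mul (one_sub b)
      simpa [z] using this
    · refine h4 ?_
      have := ((((one_sub a).mul (of_sub_iff.2 (hH ▸ hg : 1 ≤ occ g H))).mul (one_sub Z)).mul
        (of_sub_iff.2 hg)).mul (of_sub_iff.2 h)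
      simpa [z] using this
  have hZ : 1 ≤ occ 2 Z := by
    have : (1 ≤ occ 0 K) ∨ (1 ≤ occ 1 K) := by
      rcases hm' c hcK with rfl | rfl | rfl
      · exact Or.inl hcK
      · exact Or.inr hcK
      · rcases hm' d hdK with rfl | rfl | rfl
        · exact Or.inl hdK
        · exact Or.inr hdK
        · exact absurd rfl hcd
    rcases this with h | h
    · exact hmid 0 h n1 n2
    · exact hmid 1 h n3 n4
  -- An s in `K` has a copy in `H`, before the z in `Z`.
  have hs : occ 4 K = 0 := by
    by_contra h
    refine n5 ?_
    have := ((((one_sub a).mul (of_sub_iff.2 (show 1 ≤ occ 4 H by rw [hHK]; omega))).mul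
      (of_sub_iff.2 hZ)).mul (one_sub K)).mul (one_sub b)
    simpa [z, s] using this
  refine ⟨a, H, Z, K, b, rfl, hHK, ?_, ?_, hs, hZ⟩
  · rcases hm' c hcK with rfl | rfl | rfl
    · exact hcK
    · rcases hm' d hdK with rfl | rfl | rfl
      · exact hdK
      · exact absurd rfl hcd
      · omega
    · omega
  · rcases hm' c hcK with rfl | rfl | rfl
    · rcases hm' d hdK with rfl | rfl | rfl
      · exact absurd rfl hcd
      · exact hdK
      · omega
    · exact hcK
    · omega

/-- The substitution sending `y`, `z`, `s`, `t` to `x`, `z`, `y`, `t`, and erasing `x`. -/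
def yToX (i : ℕ) : Word :=
  if i = 1 then x else if i = 2 then z else if i = 4 then y else if i = 3 then t else 1

theorem length_lift_yToX (p : Word) : (FreeMonoid.toList (FreeMonoid.lift yToX p)).length =
    occ 1 p + occ 2 p + occ 3 p + occ 4 p := by
  induction p using FreeMonoid.inductionOn' with
  | one => rfl
  | of_mul b u ih =>
    simp only [map_mul, FreeMonoid.lift_eval_of, occ_mul, occ_of, FreeMonoid.toList_mul,
      List.length_append, ih]
    unfold yToX
    split_ifs <;> simp [x, y, z, t] <;> omega

/-- Here `ψ` undoes `φ` up to erased letters, so a subword of `p` is recovered from its image. -/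
theorem lift_sub_of {ψ φ : ℕ → Word} {p q : Word} (h : FreeMonoid.lift φ p = q)
    (hψ : ∀ i, Sub (FreeMonoid.lift ψ (φ i)) (FreeMonoid.of i)) : Sub (FreeMonoid.lift ψ q) p := by
  have := Sub.lift_mono hψ p
  rw [← h, lift_lift]
  rwa [lift_of] at this

/-- By the bound on the length, a subword `f` with image `w` forces the image of `p` to be `w`; in
𝐌(w) the image of `u` is then `w` as well. -/
theorem not_sub_of_yToX {w u p f : Word} (h : FIC (varM w) u p) (hf : FreeMonoid.lift yToX f = w)
    (hl : occ 1 p + occ 2 p + occ 3 p + occ 4 p ≤ (FreeMonoid.toList w).length)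
    (hu : FreeMonoid.lift yToX u ≠ w) : ¬ Sub f p := by
  intro hs
  have h1 := hs.lift yToX
  rw [hf] at h1
  have h2 : w = FreeMonoid.lift yToX p := FreeMonoid.toList.injective
    (List.Sublist.eq_of_length_le h1 (by rwa [length_lift_yToX]))
  have h3 := FIC_varM_pin ((FIC _).symm h) yToX 1 1 (by simpa using h2)
  exact hu (by simpa using h3)

theorem sub_of_mul {k : ℕ} {f a b : Word} (ha : occ k a = 0)
    (h : Sub (FreeMonoid.of k * f) (a * b)) : Sub (FreeMonoid.of k * f) b := by
  unfold Sub at h ⊢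
  rw [FreeMonoid.toList_mul a b, List.sublist_append_iff] at h
  obtain ⟨l₁, l₂, h0, h1, h2⟩ := h
  rcases l₁ with _ | ⟨c, l₁⟩
  · rw [h0]; exact h2
  · have hc : k = c := by
      rw [FreeMonoid.toList_mul] at h0
      simpa using congrArg List.head? h0
    have : k ∈ FreeMonoid.toList a := h1.subset (by simp [hc])
    rw [mem_iff_occ] at this
    omega

/-- The substitution sending `x`, `z`, `s`, `t` to `x`, `z`, `y`, `t`, and erasing `y`. -/
def sToY (i : ℕ) : Word :=
  if i = 0 then x else if i = 2 then z else if i = 4 then y else if i = 3 then t else 1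

theorem sub_lift_sToY (i : ℕ) :
    Sub (FreeMonoid.lift (fun i => if i = 0 then x else if i = 2 then z else if i = 1 then s else
      if i = 3 then t else 1) (sToY i)) (FreeMonoid.of i) := by
  unfold sToY
  split_ifs with h0 h2 h4 h3
  · subst h0; decide
  · subst h2; decide
  · subst h4; decide
  · subst h3; decide
  · exact one_sub _

theorem FIC_N_of_mem {l r : Word} (h : (l, r) ∈ ({(x ^ 2, x ^ 3), (x ^ 2 * y, y * x ^ 2),
    (x * y * x * z * x, x ^ 2 * y * z), (x * z * y * t * x * y, x * z * y * t * y * x),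
    (x * z * x * y * t * y, x * z * y * x * t * y)} : Set (Word × Word))) : FIC N l r :=
  FIC_var h

/-- The substitution of words for `x`, `y`, `z`, `t`. -/
def four (X Y Z T : Word) (i : ℕ) : Word :=
  if i = 0 then X else if i = 1 then Y else if i = 2 then Z else T

theorem occ_le_two_of {p : Word} {g : ℕ} (h : ¬ Sub (FreeMonoid.of g ^ 3) p) : occ g p ≤ 2 := by
  by_contra h'
  exact h (le_occ_iff_sub.1 (by omega))

theorem mem_xzxyty {a : ℕ} (ha : a ∈ FreeMonoid.toList (x * z * x * y * t * y)) :
    occ a (x * z * x * y * t * y) = 2 ∧ (a = 0 ∨ a = 1) ∨ occ a (x * z * x * y * t * y) = 1 := by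
  revert a; decide

theorem mem_xzytxy {a : ℕ} (ha : a ∈ FreeMonoid.toList (x * z * y * t * x * y)) :
    occ a (x * z * y * t * x * y) = 2 ∧ (a = 0 ∨ a = 1) ∨ occ a (x * z * y * t * x * y) = 1 := by
  revert a; decide

theorem lift_ne_of_not_sub {w u : Word} (hu : Sub (x * y * x * y) u)
    (hw : ¬ Sub (x * y * x * y) w) {φ : ℕ → Word} (h0 : φ 0 = x) (h1 : φ 1 = y) (a b : Word) :
    w ≠ a * FreeMonoid.lift φ u * b := by
  intro h
  refine hw ?_
  have h2 := (hu.lift φ).of_context a b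
  rw [← h] at h2
  simp only [map_mul] at h2
  rwa [show FreeMonoid.lift φ x = x from h0, show FreeMonoid.lift φ y = y from h1] at h2

theorem swapEquiv_xyzxy : SwapEquiv (x * y * z * x * y) (y * x * z * x * y) :=
  swapEquiv_of fun φ h h' => by simp [x, y, z, mul_assoc, h, h']

/-- In 𝐍 the words `u` and `v` equal `u'` and `v'`, which begin with instances of xyzxy and yxzxy;
`φ 2` is the part between the two pairs of x and y. -/
theorem FIC_inf_N {u u' v v' : Word} (h₁ : FIC N u' u) (h₂ : FIC N v' v) {φ : ℕ → Word}
    (hφ : φ 0 = x) (hφ' : φ 1 = y) (b : Word) (hu : u' = x * y * φ 2 * x * y * b)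
    (hv : v' = y * x * φ 2 * x * y * b) :
    N ⊓ var {(x * y * z * x * y, y * x * z * x * y)} ≤ var {(u, v)} := by
  have h : FIC (var {(x * y * z * x * y, y * x * z * x * y)}) u' v' :=
    FIC_context (FIC_var (u := x * y * z * x * y) (v := y * x * z * x * y)
      (Set.mem_singleton _)) φ 1 b
      (by
        simp only [hu, map_mul, one_mul]
        rw [show FreeMonoid.lift φ x = x from hφ, show FreeMonoid.lift φ y = y from hφ',
          show FreeMonoid.lift φ z = φ 2 from rfl]) (by
        simp only [hv, map_mul, one_mul]
        rw [show FreeMonoid.lift φ x = x from hφ, show FreeMonoid.lift φ y = y from hφ',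
          show FreeMonoid.lift φ z = φ 2 from rfl])
  exact FIC_iff_le.1 ((FIC _).trans ((FIC _).trans (FIC_mono inf_le_left ((FIC N).symm h₁))
    (FIC_mono inf_le_right h)) (FIC_mono inf_le_left h₂))

/-- The last two identities of 𝐍 exchange adjacent non-first occurrences; here this brings the
second y next to the second x. Suppose `p` equals `u` and contains a non-trivial instance. Both
copies of xy or yx then precede sts, so y, z, s, t form the subword yzysts, while in `u` they form
yzsyts, which 𝐌(xzxyty) distinguishes. -/
theorem nonmodular_xzxyty_N : HasNonmodularSubvarietyLattice (varM (x * z * x * y * t * y) ⊔ N) := by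
  have h5 : FIC N (x * z * x * y * t * y) (x * z * y * x * t * y) := FIC_N_of_mem (by simp)
  refine nonmodular_of (e₁ := x * y * z * x * y) (e₂ := y * x * z * x * y)
    (u := x * y * z * x * s * y * t * s) (v := y * x * z * x * s * y * t * s)
    (FIC_varM_of_pattern (fun a => mem_xzxyty) swapEquiv_xyzxy (by decide) (by decide) (by decide)
      (by decide) (by decide) fun φ => lift_ne_of_not_sub (by decide) (by decide))
    (FIC_varM_of_pattern (fun a => mem_xzxyty) (swapEquiv_of fun φ h h' => ?_) (by decide)
      (by decide) (by decide) (by decide) (by decide) fun φ =>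
        lift_ne_of_not_sub (by decide) (by decide))
    (FIC_inf_N (FIC_context h5 (four y s (z * x) t) x 1 rfl rfl)
      (FIC_context h5 (four y s (x * z * x) t) 1 1 rfl rfl)
      (φ := four x y z 1) rfl rfl (s * t * s) (by rfl) (by rfl)) ?_ fun p hp φ a b hab => ?_
  · simp [x, y, z, t, s, mul_assoc, h, h']
  · intro h
    have := (mem_iff_of_FIC (mem_N (L := [0, 1]) (k := 2) (by decide) (by decide))
      (FIC_sup.1 h).2).1 ⟨by decide, by decide, by decide⟩
    exact absurd this.2.1 (by decide)
  · by_contra hne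
    have hcomm : φ 0 * φ 1 ≠ φ 1 * φ 0 := fun h => hne (swapEquiv_xyzxy φ h)
    have hA := (FIC_sup.1 hp).1
    have hkeep : ∀ g, min (occ g (x * y * z * x * s * y * t * s)) 2 = min (occ g p) 2 := by
      have hA' := hA
      rw [varM_eq] at hA'
      exact keeps_FIC_varMα keeps_bot (k := 2) (by decide) _ _ hA'
    have e1 : FreeMonoid.lift sToY p = x * z * x * y * t * y := by
      simpa using FIC_varM_pin hA sToY 1 1 (by rfl)
    -- The letter `5` does not occur in `u`; only y and z matter, and the context supplies the rest
    -- of w.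
    have e2 : FreeMonoid.lift (three 1 5 2) p = x * z * x := by
      exact mul_right_cancel (by
        simpa only [one_mul, mul_assoc] using FIC_varM_pin hA (three 1 5 2) 1 (y * t * y) (by rfl) :
          FreeMonoid.lift (three 1 5 2) p * (y * t * y) = x * z * x * (y * t * y))
    have n1 : ∀ {f : Word}, ¬ Sub (FreeMonoid.lift sToY f) (x * z * x * y * t * y) → ¬ Sub f p :=
      fun hf hs => hf (e1 ▸ hs.lift sToY)
    have n2 : ∀ {f : Word}, ¬ Sub (FreeMonoid.lift (three 1 5 2) f) (x * z * x) → ¬ Sub f p :=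
      fun hf hs => hf (e2 ▸ hs.lift _)
    have o : ∀ g, occ g (x * y * z * x * s * y * t * s) ≤ 1 →
        occ g p = occ g (x * y * z * x * s * y * t * s) := fun g hg => by
      have := hkeep g
      omega
    have hm : ∀ g ∈ FreeMonoid.toList (x * y * z * x * s * y * t * s), 2 ≤ occ g (x * y * z * x * s * y * t * s) →
        g = 0 ∨ g = 1 ∨ g = 4 := by decide
    have o1 : occ 1 p ≤ 2 := occ_le_two_of (n2 (by decide))
    have o4 : occ 4 p ≤ 2 := occ_le_two_of (n1 (by decide))
    have o2 : occ 2 p = 1 := o 2 (by decide)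
    have o3 : occ 3 p = 1 := o 3 (by decide)
    have hS : ¬ Sub (y * z * y * s * t * s) p := not_sub_of_yToX hA rfl
      (show _ ≤ 6 by omega) fun h => absurd (congrArg FreeMonoid.toList h) (by decide)
    obtain ⟨a, H, Z, K, b, rfl, hHK, h0, h1, h4, hZ⟩ := exists_split (fun g hg => by
      have := hkeep g
      exact hm g (mem_iff_occ.2 (by omega)) (by omega)) o2 (by
        simp only [List.mem_cons, List.not_mem_nil, or_false, forall_eq_or_imp, forall_eq]
        exact ⟨n1 (by decide), n1 (by decide), n2 (by decide), n2 (by decide), n1 (by decide)⟩)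
      hab hcomm
    refine hS ?_
    have hs4 : occ 4 (a * H * Z * K) = 0 := by
      have h : occ 4 (a * H * Z) = 0 := by
        by_contra h
        refine n1 (f := s * x) (by decide) ?_
        simpa [s, x] using ((of_sub_iff.2 (by omega : 1 ≤ occ 4 (a * H * Z))).mul
          (of_sub_iff.2 h0)).mul (one_sub b)
      rw [occ_mul, h, h4]
    have hb : Sub (s * (t * s)) b := by
      refine sub_of_mul hs4 ?_
      exact Sub.trans (by decide) (lift_sub_of e1 sub_lift_sToY)
    have := ((((one_sub a).mul (of_sub_iff.2 (show 1 ≤ occ 1 H by rw [hHK]; omega))).mul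
      (of_sub_iff.2 hZ)).mul (of_sub_iff.2 h1)).mul hb
    simpa [y, z, mul_assoc] using this

theorem nonmodular_xzytxy_N : HasNonmodularSubvarietyLattice (varM (x * z * y * t * x * y) ⊔ N) := by
  have h5 : FIC N (x * z * y * t * x * y) (x * z * y * t * y * x) := FIC_N_of_mem (by simp)
  -- Although xyxy is a subword of xzytxy, the only x immediately followed by y is the last one,
  -- after which there is no x.
  have hstart : ∀ {φ : ℕ → Word} {r : Word}, 1 ≤ occ 0 r → φ 0 = x → φ 1 = y → ∀ a b,
      x * z * y * t * x * y ≠ a * FreeMonoid.lift φ (x * y * r) * b := by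
    intro φ r hr hx hy a b h
    have h0 := congrArg (occ 0) h
    have hr' := mul_occ_le_occ_lift φ 0 0 r
    rw [hx, show occ 0 x = 1 from rfl, mul_one] at hr'
    rw [map_mul, map_mul, show FreeMonoid.lift φ x = x from hx,
      show FreeMonoid.lift φ y = y from hy] at h h0
    rw [show occ 0 (x * z * y * t * x * y) = 2 by decide] at h0
    simp only [occ_mul, show occ 0 x = 1 from rfl, show occ 0 y = 0 from rfl] at h0
    have ha : 0 ∉ FreeMonoid.toList a := by rw [mem_iff_occ]; omega
    have hl := congrArg FreeMonoid.toList h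
    cases hal : FreeMonoid.toList a with
    | nil =>
      obtain rfl : a = 1 := FreeMonoid.toList.injective hal
      simp [x, y, z, t] at hl
    | cons c l =>
      rw [hal] at ha
      simp only [FreeMonoid.toList_mul, hal] at hl
      simp [x, y, z, t] at hl
      simp [← hl.1] at ha

  refine nonmodular_of (e₁ := x * y * z * x * y) (e₂ := y * x * z * x * y)
    (u := x * y * z * s * t * x * s * y) (v := y * x * z * s * t * x * s * y)
    (FIC_varM_of_pattern (fun a => mem_xzytxy) swapEquiv_xyzxy (by decide) (by decide) (by decide)
      (by decide) (by decide) fun φ h h' => hstart (r := z * x * y) (by decide) h h')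
    (FIC_varM_of_pattern (fun a => mem_xzytxy) (swapEquiv_of fun φ h h' => ?_) (by decide)
      (by decide) (by decide) (by decide) (by decide) fun φ h h' =>
        hstart (r := z * s * t * x * s * y) (by decide) h h')
    (FIC_inf_N (FIC_context h5 (four y s z (t * x)) x 1 rfl rfl)
      (FIC_context h5 (four y s (x * z) (t * x)) 1 1 rfl rfl)
      (φ := four x y (z * s * t) 1) rfl rfl s (by rfl) (by rfl)) ?_ fun p hp φ a b hab => ?_
  · simp [x, y, z, t, s, mul_assoc, h, h']
  · intro h
    have := (mem_iff_of_FIC (mem_N (L := [0, 1]) (k := 2) (by decide) (by decide))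
      (FIC_sup.1 h).2).1 ⟨by decide, by decide, by decide⟩
    exact absurd this.2.1 (by decide)
  · by_contra hne
    have hcomm : φ 0 * φ 1 ≠ φ 1 * φ 0 := fun h => hne (swapEquiv_xyzxy φ h)
    have hA := (FIC_sup.1 hp).1
    have hkeep : ∀ g, min (occ g (x * y * z * s * t * x * s * y)) 2 = min (occ g p) 2 := by
      have hA' := hA
      rw [varM_eq] at hA'
      exact keeps_FIC_varMα keeps_bot (k := 2) (by decide) _ _ hA'
    have e1 : FreeMonoid.lift sToY p = x * z * y * t * x * y := by
      simpa using FIC_varM_pin hA sToY 1 1 (by rfl)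
    -- The image zyt of z turns the restriction yzy of `u` into the prefix xzytx of w.
    have e2 : FreeMonoid.lift (fun i => if i = 1 then x else if i = 2 then z * y * t else 1) p =
        x * z * y * t * x := by
      have := FIC_varM_pin hA (fun i => if i = 1 then x else if i = 2 then z * y * t else 1) 1 y
        (by rfl)
      rw [one_mul] at this
      exact mul_right_cancel this
    have n1 : ∀ {f : Word}, ¬ Sub (FreeMonoid.lift sToY f) (x * z * y * t * x * y) → ¬ Sub f p :=
      fun hf hs => hf (e1 ▸ hs.lift sToY)
    have n2 : ∀ {f : Word}, ¬ Sub (FreeMonoid.lift (fun i => if i = 1 then x else if i = 2 then z * y * t else 1) f)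
        (x * z * y * t * x) → ¬ Sub f p :=
      fun hf hs => hf (e2 ▸ hs.lift _)
    have o : ∀ g, occ g (x * y * z * s * t * x * s * y) ≤ 1 →
        occ g p = occ g (x * y * z * s * t * x * s * y) := fun g hg => by
      have := hkeep g
      omega
    have hm : ∀ g ∈ FreeMonoid.toList (x * y * z * s * t * x * s * y), 2 ≤ occ g (x * y * z * s * t * x * s * y) →
        g = 0 ∨ g = 1 ∨ g = 4 := by decide
    have o1 : occ 1 p ≤ 2 := occ_le_two_of (n2 (by decide))
    have o4 : occ 4 p ≤ 2 := occ_le_two_of (n1 (by decide))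
    have o2 : occ 2 p = 1 := o 2 (by decide)
    have o3 : occ 3 p = 1 := o 3 (by decide)
    -- In `u` the letters y, z, s, t form yzstsy, with the last two letters in the other order.
    have hS : ¬ Sub (y * z * s * t * y * s) p := not_sub_of_yToX hA rfl
      (show _ ≤ 6 by omega) fun h => absurd (congrArg FreeMonoid.toList h) (by decide)
    obtain ⟨a, H, Z, K, b, rfl, hHK, h0, h1, h4, hZ⟩ := exists_split (fun g hg => by
      have := hkeep g
      exact hm g (mem_iff_occ.2 (by omega)) (by omega)) o2 (by
        simp only [List.mem_cons, List.not_mem_nil, or_false, forall_eq_or_imp, forall_eq]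
        exact ⟨n1 (by decide), n1 (by decide), n2 (by decide), n2 (by decide), n1 (by decide)⟩)
      hab hcomm
    refine hS ?_
    have hH0 := hHK 0
    have hH1 := hHK 1
    have hH3 := hHK 3
    have hs4 : occ 4 (a * H * Z) ≤ 1 := by
      by_contra h
      refine n1 (f := s * s * x) (by decide) ?_
      have := ((le_occ_iff_sub.1 (by omega : 2 ≤ occ 4 (a * H * Z))).mul (of_sub_iff.2 h0)).mul
        (one_sub b)
      simpa [s, x, pow_succ] using this
    have hb : 1 ≤ occ 4 b := by
      have h := hkeep 4
      rw [show occ 4 (x * y * z * s * t * x * s * y) = 2 by decide] at h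
      rw [occ_mul, occ_mul, h4] at h
      omega
    have ht : 1 ≤ occ 3 Z := by
      have ha : ¬ 1 ≤ occ 3 a := fun h => n1 (f := t * z) (by decide) (by
        simpa [t, z] using ((((of_sub_iff.2 h).mul (one_sub H)).mul (of_sub_iff.2 hZ)).mul
          (one_sub K)).mul (one_sub b))
      have hb : ¬ 1 ≤ occ 3 b := fun h => n1 (f := x * x * t) (by decide) (by
        simpa [t, x] using ((((one_sub a).mul (of_sub_iff.2 (hH0 ▸ h0 : 1 ≤ occ 0 H))).mul
          (one_sub Z)).mul (of_sub_iff.2 h0)).mul (of_sub_iff.2 h))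
      simp only [occ_mul] at o3
      omega
    have s1 : Sub (y * z) (a * H * Z * K * b) := by
      simpa [y, z] using ((((one_sub a).mul (of_sub_iff.2 (hH1 ▸ h1 : 1 ≤ occ 1 H))).mul
        (of_sub_iff.2 hZ)).mul (one_sub K)).mul (one_sub b)
    have s2 : Sub (z * (s * t)) (a * H * Z * K * b) :=
      Sub.trans (by decide) (lift_sub_of e1 sub_lift_sToY)
    have s3 : Sub (t * (y * s)) (a * H * Z * K * b) := by
      simpa [y, t, s, mul_assoc] using ((((one_sub a).mul (one_sub H)).mul (of_sub_iff.2 ht)).mul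
        (of_sub_iff.2 h1)).mul (of_sub_iff.2 hb)
    -- The subwords yz, zst and tys overlap in the simple letters z and t, and glue to yzstys.
    have s4 : Sub (y * z * s * t) (a * H * Z * K * b) := by
      simpa only [z, mul_assoc] using Sub.glue o2 s1 s2
    simpa only [t, mul_assoc] using Sub.glue o3 s4 s3

end MonVar

/-- A class written by a regular expression, such as `xx⁺y` for `γ`, is given here by a word in it,
such as `x²y`; `varMα α w` is the variety `𝐌_α([w]^α)`. -/
theorem proposition4p1 :
    -- (i) `𝐌_γ(xx⁺y) ∨ 𝐇`
    HasNonmodularSubvarietyLattice (varMα gam (x ^ 2 * y) ⊔ H) ∧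
    -- (ii) `𝐌_γ(xx⁺y) ∨ 𝐌_ν([yx²ty]^ν)`
    HasNonmodularSubvarietyLattice (varMα gam (x ^ 2 * y) ⊔ varMα nu (y * x ^ 2 * t * y)) ∧
    -- (iii) `𝐌_γ(xx⁺y) ∨ 𝐌_η([xyzx²ty]^η)`
    HasNonmodularSubvarietyLattice
      (varMα gam (x ^ 2 * y) ⊔ varMα eta (x * y * z * x ^ 2 * t * y)) ∧
    -- (iv) `𝐌_λ(xyx⁺) ∨ 𝐌_λ̄(x⁺yx)`
    HasNonmodularSubvarietyLattice (varMα lam (x * y * x) ⊔ varMα (dualCon lam) (x * y * x)) ∧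
    -- (v) `𝐌_λ(xyx⁺) ∨ 𝐌_ν([yx²ty]^ν)`
    HasNonmodularSubvarietyLattice (varMα lam (x * y * x) ⊔ varMα nu (y * x ^ 2 * t * y)) ∧
    -- (vi) `𝐌_λ(xyx⁺) ∨ 𝐌_γ'(yxx⁺ty)`
    HasNonmodularSubvarietyLattice (varMα lam (x * y * x) ⊔ varMα gam' (y * x ^ 2 * t * y)) ∧
    -- (vii) `𝐌_λ(xyx⁺) ∨ 𝐌_γ'(ytyxx⁺)`
    HasNonmodularSubvarietyLattice (varMα lam (x * y * x) ⊔ varMα gam' (y * t * y * x ^ 2)) ∧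
    -- (viii) `𝐌_λ(xyx⁺) ∨ 𝐌_γ'([x²yzytx²]^γ')`
    HasNonmodularSubvarietyLattice
      (varMα lam (x * y * x) ⊔ varMα gam' (x ^ 2 * y * z * y * t * x ^ 2)) ∧
    -- (ix) `𝐌_λ(xyx⁺) ∨ 𝐌_γ'([x²yzx²ty]^γ')`
    HasNonmodularSubvarietyLattice
      (varMα lam (x * y * x) ⊔ varMα gam' (x ^ 2 * y * z * x ^ 2 * t * y)) ∧
    -- (x) `𝐌_λ(xyx⁺) ∨ 𝐌_γ'([yzx²ytx²]^γ')`
    HasNonmodularSubvarietyLattice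
      (varMα lam (x * y * x) ⊔ varMα gam' (y * z * x ^ 2 * y * t * x ^ 2)) ∧
    -- (xi) `𝐌_λ(xyx⁺) ∨ 𝐌_γ'([x²zytx²y]^γ')`
    HasNonmodularSubvarietyLattice
      (varMα lam (x * y * x) ⊔ varMα gam' (x ^ 2 * z * y * t * x ^ 2 * y)) ∧
    -- (xii) `𝐌(xyx) ∨ 𝐇`
    HasNonmodularSubvarietyLattice (varM (x * y * x) ⊔ H) ∧
    -- (xiii) `𝐌(xyx) ∨ 𝐌_λ(xyzx⁺ty⁺)`
    HasNonmodularSubvarietyLattice (varM (x * y * x) ⊔ varMα lam (x * y * z * x * t * y)) ∧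
    -- (xiv) `𝐌(xyx) ∨ 𝐌_λ(xx⁺yty⁺)`
    HasNonmodularSubvarietyLattice (varM (x * y * x) ⊔ varMα lam (x ^ 2 * y * t * y)) ∧
    -- (xv) `𝐌(xyxzx) ∨ 𝐌_ν([yx²ty]^ν)`
    HasNonmodularSubvarietyLattice
      (varM (x * y * x * z * x) ⊔ varMα nu (y * x ^ 2 * t * y)) ∧
    -- (xvi) `𝐌(xyxzx) ∨ 𝐌_γ'(yxx⁺ty)`
    HasNonmodularSubvarietyLattice
      (varM (x * y * x * z * x) ⊔ varMα gam' (y * x ^ 2 * t * y)) ∧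
    -- (xvii) `𝐌(xyxzx) ∨ 𝐌_γ'(xx⁺yty)`
    HasNonmodularSubvarietyLattice
      (varM (x * y * x * z * x) ⊔ varMα gam' (x ^ 2 * y * t * y)) ∧
    -- (xviii) `𝐌(xyxzx) ∨ 𝐌_λ'(xyzxx⁺ty)`
    HasNonmodularSubvarietyLattice
      (varM (x * y * x * z * x) ⊔ varMα lam' (x * y * z * x ^ 2 * t * y)) ∧
    -- (xix) `𝐌(xyxzx) ∨ 𝐌_λ'(xyzytxx⁺)`
    HasNonmodularSubvarietyLattice
      (varM (x * y * x * z * x) ⊔ varMα lam' (x * y * z * y * t * x ^ 2)) ∧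
    -- (xx) `𝐌(xyxzx) ∨ 𝐌_λ'(yzyxtxx⁺)`
    HasNonmodularSubvarietyLattice
      (varM (x * y * x * z * x) ⊔ varMα lam' (y * z * y * x * t * x ^ 2)) ∧
    -- (xxi) `𝐌_μ(xyxzx⁺) ∨ 𝐌_λ'(xyzx⁺tysx⁺)`
    HasNonmodularSubvarietyLattice
      (varMα mu (x * y * x * z * x) ⊔ varMα lam' (x * y * z * x * t * y * s * x)) ∧
    -- (xxii) `𝐌_μ(xyxzx⁺) ∨ 𝐌_η([xyzx²ty]^η)`
    HasNonmodularSubvarietyLattice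
      (varMα mu (x * y * x * z * x) ⊔ varMα eta (x * y * z * x ^ 2 * t * y)) ∧
    -- (xxiii) `𝐌(xzxyty) ∨ 𝐍`
    HasNonmodularSubvarietyLattice (varM (x * z * x * y * t * y) ⊔ N) ∧
    -- (xxiv) `𝐌(xzytxy) ∨ 𝐍`
    HasNonmodularSubvarietyLattice (varM (x * z * y * t * x * y) ⊔ N) := by
  exact ⟨nonmodular_gam_H, nonmodular_gam_nu, nonmodular_gam_eta, nonmodular_lam_dual,
    nonmodular_lam_nu, nonmodular_lam_gam'_yx2ty, nonmodular_lam_gam'_ytyx2,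
    nonmodular_lam_gam'_x2yzytx2, nonmodular_lam_gam'_x2yzx2ty, nonmodular_lam_gam'_yzx2ytx2,
    nonmodular_lam_gam'_x2zytx2y, nonmodular_xyx_H, nonmodular_xyx_lam_xyzxty,
    nonmodular_xyx_lam_x2yty, nonmodular_xyxzx_nu, nonmodular_xyxzx_gam'_yx2ty,
    nonmodular_xyxzx_gam'_x2yty, nonmodular_xyxzx_lam'_xyzx2ty, nonmodular_xyxzx_lam'_xyzytx2,
    nonmodular_xyxzx_lam'_yzyxtx2, nonmodular_mu_lam', nonmodular_mu_eta, nonmodular_xzxyty_N,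
    nonmodular_xzytxy_N⟩
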